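/- Let $\mathfrak g$ be the real Lie algebra with basis $A,B,P,Q,R,S$ and non-zero brackets $[P,Q]=R$, $[P,R]=S$, $[A,P]=\frac12P$, $[B,P]=-\frac12P$, $[B,Q]=Q$, $[A,R]=\frac12R$, $[B,R]=\frac12R$, $[A,S]=S$, and let $G$ be the connected, simply connected Lie group of $\mathfrak g$. Put $X=A+B$, $Y=A-B$, $\mathfrak h=\mathrm{span}\{Q,R,S\}$, $H=\exp\mathfrak h$ (an abelian normal subgroup), $G_0=\exp(\mathrm{span}\{X,Y,P\})$, so that $G=G_0H$. Write $(x,y,p)$ for $\exp(xX)\exp(yY)\exp(pP)\in G_0$ and equip $G_0$ with its left Haar measure $dx\,dy\,dp$. Let $Q^*,R^*,S^*$ be the basis of $\mathfrak h^*$ dual to $Q,R,S$. For $l\in\mathfrak h^*$ let $\chi_l(\exp W)=e^{i\,l(W)}$ ($W\in\mathfrak h$), and let $\sigma_l=\mathrm{ind}_H^G\chi_l$, realized on $L^2(G/H,\chi_l)=L^2(G_0)=L^2(\mathbb R^3)$ by restricting covariant functions to $G_0$, and extended to the group C*-algebra $C^*(G)$. Let $U:L^2(G_0)\to\int_{\mathbb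 R}^{\oplus}L^2(\mathbb R^2)\,db=L^2(\mathbb R;L^2(\mathbb R^2))$ be the unitary operator $$(U\xi)(b)(x,p)=\int_{\mathbb R}\xi\big(\exp(xX)\exp(pP)\exp(yY)\big)\,e^{-y/2}\,e^{-2\pi i b y}\,dy$$ (the integral being the $L^2$ Fourier transform in $y$), and let $\rho(T)=UTU^*$ for $T\in B(L^2(G_0))$. Let $\mathcal K$ be the algebra of compact operators on $L^2(\mathbb R^2)$; $C_0(\mathbb R,\mathcal K)$ (norm continuous maps vanishing at infinity) is regarded as a subalgebra of $B(L^2(\mathbb R;L^2(\mathbb R^2)))$ through $(\phi\xi)(b)=\phi(b)(\xi(b))$. The distance $\mathrm{dis}$ is taken in the operator norm. Fix $D>0$ and a function $\delta\mapsto r_\delta\in(0,\infty)$ on $(0,\infty)$ with $\lim_{\delta\to0}r_\delta=+\infty$ and $\lim_{\delta\to0}e^{r_\delta}\delta^{1/2}=0$. For $c>0$ and $m\in\mathbb Z$ let $I_{c,m}=[cm,cm+c)$. For $\delta>0$, $D'>0$ and $k\in\mathbb Z^3$ let $$S_{\delta,D',2,k}=\{(x,y,p): e^{-x}\le\delta^6,\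 x\in I_{r_\delta,k_1},\ y\in I_{r_\delta,k_2},\ p\in I_{D'\delta^2e^{r_\delta(k_1-k_2)},\,k_3}\},$$ $$R_{\delta,D,2,k}=\bigcup_{j\in\mathbb Z^3,\ |j_i|\le1}S_{\delta,\,De^{r_\delta(-j_1+j_2)},\,2,\,k+j},$$ and let $M_{\delta,D,2,k}$ and $P_{\delta,D,2,k}$ be the operators on $L^2(G_0)$ of multiplication with the characteristic functions of $S_{\delta,D,2,k}$ and $R_{\delta,D,2,k}$. Let $\varepsilon\in\{1,-1\}$. Then for every $a\in C^*(G)$ and every $\delta>0$ the series $$\sigma_{\varepsilon,\delta,D,2}(a)=\sum_{k\in\mathbb Z^3}P_{\delta,D,2,k}\circ\sigma_{-\varepsilon\delta^2k_3De^{r_\delta(k_1-k_2)}Q^*}(a)\circ M_{\delta,D,2,k}$$ converges strongly and unconditionally to a bounded operator on $L^2(G_0)$, and $$\lim_{\delta\to0}\mathrm{dis}\Big(\rho\big(\sigma_{\varepsilon R^*}(a)-\sigma_{\varepsilon,\delta,D,2}(a)\big),\,C_0(\mathbb R,\mathcal K)\Big)=0.$$ -/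

import Mathlib

open MeasureTheory Filter Topology Set
open scoped ENNReal NNReal ZeroAtInfty

noncomputable section

namespace N628

/-!
### The group

The Lie algebra `𝔤` has basis `A, B, P, Q, R, S` and non-zero brackets
`[P,Q]=R`, `[P,R]=S`, `[A,P]=P/2`, `[B,P]=-P/2`, `[B,Q]=Q`, `[A,R]=R/2`, `[B,R]=R/2`, `[A,S]=S`.
With `X = A + B`, `Y = A - B` this reads `[X,P]=0`, `[Y,P]=P`, `[X,Q]=Q`, `[Y,Q]=-Q`, `[X,R]=R`,
`[Y,R]=0`, `[X,S]=S`, `[Y,S]=S`, `[P,Q]=R`, `[P,R]=S`.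
The connected simply connected group `G` of `𝔤` is the semidirect product of
`G₀ = exp(ℝX + ℝY + ℝP)` and of the abelian normal subgroup `H = exp 𝔥`, `𝔥 = ℝQ + ℝR + ℝS`.
-/

/-- The group `G₀`; the triple `(x, y, p)` is the element `exp(xX) exp(yY) exp(pP)`.
Its measure is Lebesgue measure `dx dy dp`, which is left invariant
(`G0.measurePreserving_mul_left`). -/
def G0 : Type := ℝ × ℝ × ℝ

namespace G0
instance : TopologicalSpace G0 := inferInstanceAs (TopologicalSpace (ℝ × ℝ × ℝ))
instance : MeasureSpace G0 := inferInstanceAs (MeasureSpace (ℝ × ℝ × ℝ))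
instance : BorelSpace G0 := inferInstanceAs (BorelSpace (ℝ × ℝ × ℝ))
instance : SecondCountableTopology G0 := inferInstanceAs (SecondCountableTopology (ℝ × ℝ × ℝ))
instance : T2Space G0 := inferInstanceAs (T2Space (ℝ × ℝ × ℝ))
instance : LocallyCompactSpace G0 := inferInstanceAs (LocallyCompactSpace (ℝ × ℝ × ℝ))
instance : SigmaFinite (volume : Measure G0) :=
  inferInstanceAs (SigmaFinite (volume : Measure (ℝ × ℝ × ℝ)))
instance : IsLocallyFiniteMeasure (volume : Measure G0) :=
  inferInstanceAs (IsLocallyFiniteMeasure (volume : Measure (ℝ × ℝ × ℝ)))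
instance : (volume : Measure G0).InnerRegularCompactLTTop :=
  inferInstanceAs ((volume : Measure (ℝ × ℝ × ℝ)).InnerRegularCompactLTTop)

def mk (x y p : ℝ) : G0 := (x, y, p)
def x (g : G0) : ℝ := Prod.fst (α := ℝ) (β := ℝ × ℝ) g
def y (g : G0) : ℝ := (Prod.snd (α := ℝ) (β := ℝ × ℝ) g).1
def p (g : G0) : ℝ := (Prod.snd (α := ℝ) (β := ℝ × ℝ) g).2

@[simp] lemma x_mk (a b c : ℝ) : (mk a b c).x = a := rfl
@[simp] lemma y_mk (a b c : ℝ) : (mk a b c).y = b := rfl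
@[simp] lemma p_mk (a b c : ℝ) : (mk a b c).p = c := rfl

@[fun_prop] lemma continuous_x : Continuous x := continuous_fst (X := ℝ) (Y := ℝ × ℝ)
@[fun_prop] lemma continuous_y : Continuous y :=
  continuous_fst.comp (continuous_snd (X := ℝ) (Y := ℝ × ℝ))
@[fun_prop] lemma continuous_p : Continuous p :=
  continuous_snd.comp (continuous_snd (X := ℝ) (Y := ℝ × ℝ))
@[fun_prop] lemma continuous_mk {Z : Type*} [TopologicalSpace Z] {a b c : Z → ℝ}
    (ha : Continuous a) (hb : Continuous b) (hc : Continuous c) :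
    Continuous fun z => mk (a z) (b z) (c z) :=
  Continuous.prodMk (X := ℝ) (Y := ℝ × ℝ) ha (hb.prodMk hc)

@[ext] lemma ext {g h : G0} (h1 : g.x = h.x) (h2 : g.y = h.y) (h3 : g.p = h.p) : g = h :=
  Prod.ext (α := ℝ) (β := ℝ × ℝ) h1 (Prod.ext h2 h3)

/-- `exp(pP) exp(yY) = exp(yY) exp(e^{-y} pP)` since `[Y,P] = P` and `[X,P] = [X,Y] = 0`. -/
instance : Mul G0 := ⟨fun g h => mk (g.x + h.x) (g.y + h.y) (Real.exp (-h.y) * g.p + h.p)⟩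
instance : One G0 := ⟨mk 0 0 0⟩
instance : Inv G0 := ⟨fun g => mk (-g.x) (-g.y) (-(Real.exp g.y * g.p))⟩

@[simp] lemma x_mul (g h : G0) : (g * h).x = g.x + h.x := rfl
@[simp] lemma y_mul (g h : G0) : (g * h).y = g.y + h.y := rfl
@[simp] lemma p_mul (g h : G0) : (g * h).p = Real.exp (-h.y) * g.p + h.p := rfl
@[simp] lemma x_one : (1 : G0).x = 0 := rfl
@[simp] lemma y_one : (1 : G0).y = 0 := rfl
@[simp] lemma p_one : (1 : G0).p = 0 := rfl
@[simp] lemma x_inv (g : G0) : (g⁻¹).x = -g.x := rfl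
@[simp] lemma y_inv (g : G0) : (g⁻¹).y = -g.y := rfl
@[simp] lemma p_inv (g : G0) : (g⁻¹).p = -(Real.exp g.y * g.p) := rfl

instance : Group G0 :=
  Group.ofLeftAxioms
    (fun a b c => by
      ext
      · simp [add_assoc]
      · simp [add_assoc]
      · simp only [p_mul, y_mul, neg_add, Real.exp_add]; ring)
    (fun a => by ext <;> simp)
    (fun a => by ext <;> simp [Real.exp_neg])

instance : IsTopologicalGroup G0 where
  continuous_mul := by
    change Continuous fun z : G0 × G0 => mk (z.1.x + z.2.x) (z.1.y + z.2.y)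
      (Real.exp (-z.2.y) * z.1.p + z.2.p)
    fun_prop
  continuous_inv := by
    change Continuous fun g : G0 => mk (-g.x) (-g.y) (-(Real.exp g.y * g.p))
    fun_prop

lemma measurePreserving_mul_left (g : G0) : MeasurePreserving (fun k : G0 => g * k) := by
  have h1 : MeasurePreserving (fun z : ℝ × ℝ × ℝ =>
      (g.x + z.1, g.y + z.2.1, Real.exp (-z.2.1) * g.p + z.2.2)) := by
    have h2 : MeasurePreserving (fun z : ℝ × ℝ =>
        (g.y + z.1, Real.exp (-z.1) * g.p + z.2)) :=
      MeasurePreserving.skew_product (μa := volume) (μc := volume) (μb := volume) (μd := volume)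
        (f := fun y : ℝ => g.y + y) (g := fun y p : ℝ => Real.exp (-y) * g.p + p)
        (measurePreserving_add_left volume g.y) (by fun_prop)
        (.of_forall fun y => (measurePreserving_add_left volume (Real.exp (-y) * g.p)).map_eq)
    exact (measurePreserving_add_left volume g.x).prod h2
  exact h1

end G0

/-- `Ad(k⁻¹) W` for `k = exp(xX) exp(yY) exp(pP)` and `W = qQ + rR + sS ∈ 𝔥`, written `(q, r, s)`:
it is `exp(-p ad P) exp(-y ad Y) exp(-x ad X) W`, so that
`Q ↦ e^{-x+y} (Q - pR + (p²/2) S)`, `R ↦ e^{-x} (R - pS)`, `S ↦ e^{-x-y} S`. -/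
def adInv (k : G0) (W : ℝ × ℝ × ℝ) : ℝ × ℝ × ℝ :=
  (Real.exp (-k.x + k.y) * W.1,
   Real.exp (-k.x) * W.2.1 - k.p * (Real.exp (-k.x + k.y) * W.1),
   Real.exp (-k.x - k.y) * W.2.2 - k.p * (Real.exp (-k.x) * W.2.1)
      + k.p ^ 2 / 2 * (Real.exp (-k.x + k.y) * W.1))

@[simp] lemma adInv_one (W : ℝ × ℝ × ℝ) : adInv 1 W = W := by simp [adInv]

lemma adInv_add (k : G0) (V W : ℝ × ℝ × ℝ) : adInv k (V + W) = adInv k V + adInv k W := by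
  ext <;> simp only [adInv, Prod.fst_add, Prod.snd_add] <;> ring

lemma adInv_neg (k : G0) (W : ℝ × ℝ × ℝ) : adInv k (-W) = -adInv k W := by
  ext <;> simp only [adInv, Prod.fst_neg, Prod.snd_neg] <;> ring

lemma adInv_mul (k m : G0) (W : ℝ × ℝ × ℝ) : adInv (k * m) W = adInv m (adInv k W) := by
  ext <;> simp only [adInv, G0.x_mul, G0.y_mul, G0.p_mul, neg_add, sub_eq_add_neg, Real.exp_add,
    Real.exp_neg] <;> field_simp <;> ring

@[fun_prop] lemma continuous_adInv {Z : Type*} [TopologicalSpace Z] {k : Z → G0}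
    {W : Z → ℝ × ℝ × ℝ} (hk : Continuous k) (hW : Continuous W) :
    Continuous fun z => adInv (k z) (W z) := by
  unfold adInv
  fun_prop

/-- The group `G`; the pair `(k, W)` is the element `k * exp W` with `k ∈ G₀` and `W ∈ 𝔥`.
Its measure is Lebesgue measure in these coordinates, which is a left Haar measure
(`G6.measurePreserving_mul_left`). -/
def G6 : Type := G0 × (ℝ × ℝ × ℝ)

namespace G6
instance : TopologicalSpace G6 := inferInstanceAs (TopologicalSpace (G0 × (ℝ × ℝ × ℝ)))
instance : MeasureSpace G6 := inferInstanceAs (MeasureSpace (G0 × (ℝ × ℝ × ℝ)))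
instance : BorelSpace G6 := inferInstanceAs (BorelSpace (G0 × (ℝ × ℝ × ℝ)))
instance : SecondCountableTopology G6 :=
  inferInstanceAs (SecondCountableTopology (G0 × (ℝ × ℝ × ℝ)))

def mk (k : G0) (W : ℝ × ℝ × ℝ) : G6 := (k, W)
def base (g : G6) : G0 := Prod.fst (α := G0) (β := ℝ × ℝ × ℝ) g
def fib (g : G6) : ℝ × ℝ × ℝ := Prod.snd (α := G0) (β := ℝ × ℝ × ℝ) g

@[simp] lemma base_mk (k : G0) (W : ℝ × ℝ × ℝ) : (mk k W).base = k := rfl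
@[simp] lemma fib_mk (k : G0) (W : ℝ × ℝ × ℝ) : (mk k W).fib = W := rfl

@[fun_prop] lemma continuous_base : Continuous base :=
  continuous_fst (X := G0) (Y := ℝ × ℝ × ℝ)
@[fun_prop] lemma continuous_fib : Continuous fib :=
  continuous_snd (X := G0) (Y := ℝ × ℝ × ℝ)

@[ext] lemma ext {g h : G6} (h1 : g.base = h.base) (h2 : g.fib = h.fib) : g = h :=
  Prod.ext (α := G0) (β := ℝ × ℝ × ℝ) h1 h2

/-- `k exp(W) k' exp(W') = k k' exp(Ad(k'⁻¹) W + W')`. -/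
instance : Mul G6 := ⟨fun g h => mk (g.base * h.base) (adInv h.base g.fib + h.fib)⟩
instance : One G6 := ⟨mk 1 0⟩
instance : Inv G6 := ⟨fun g => mk g.base⁻¹ (-adInv g.base⁻¹ g.fib)⟩

@[simp] lemma base_mul (g h : G6) : (g * h).base = g.base * h.base := rfl
@[simp] lemma fib_mul (g h : G6) : (g * h).fib = adInv h.base g.fib + h.fib := rfl
@[simp] lemma base_one : (1 : G6).base = 1 := rfl
@[simp] lemma fib_one : (1 : G6).fib = 0 := rfl
@[simp] lemma base_inv (g : G6) : (g⁻¹).base = g.base⁻¹ := rfl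
@[simp] lemma fib_inv (g : G6) : (g⁻¹).fib = -adInv g.base⁻¹ g.fib := rfl

instance : Group G6 :=
  Group.ofLeftAxioms
    (fun a b c => by ext1 <;> simp [mul_assoc, adInv_add, adInv_mul, add_assoc])
    (fun a => by ext1 <;> simp [adInv])
    (fun a => by ext1 <;> simp [adInv_neg, ← adInv_mul])

instance : (volume : Measure (ℝ × ℝ × ℝ)).IsAddLeftInvariant := by
  have : (volume : Measure (ℝ × ℝ)).IsAddLeftInvariant :=
    inferInstanceAs (((volume : Measure ℝ).prod volume).IsAddLeftInvariant)
  exact inferInstanceAs (((volume : Measure ℝ).prod (volume : Measure (ℝ × ℝ))).IsAddLeftInvariant)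

lemma measurePreserving_mul_left (g : G6) : MeasurePreserving (fun h : G6 => g * h) :=
  MeasurePreserving.skew_product (μa := (volume : Measure G0)) (μb := (volume : Measure G0))
    (μc := (volume : Measure (ℝ × ℝ × ℝ))) (μd := (volume : Measure (ℝ × ℝ × ℝ)))
    (f := fun k : G0 => g.base * k) (g := fun k W => adInv k g.fib + W)
    (G0.measurePreserving_mul_left g.base)
    (Continuous.measurable (by unfold Function.uncurry; fun_prop))
    (.of_forall fun k => (measurePreserving_add_left volume (adInv k g.fib)).map_eq)

end G6

/-! ### The group C*-algebra -/

/-- A strongly continuous unitary representation of `G` on a complex Hilbert space. -/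
structure UnitaryRep where
  H : Type
  [normedAddCommGroup : NormedAddCommGroup H]
  [innerProductSpace : InnerProductSpace ℂ H]
  [completeSpace : CompleteSpace H]
  toHom : G6 →* (H ≃ₗᵢ[ℂ] H)
  continuous_apply : ∀ ξ : H, Continuous fun g => toHom g ξ

attribute [instance] UnitaryRep.normedAddCommGroup UnitaryRep.innerProductSpace
  UnitaryRep.completeSpace

/-- `L¹(G)`. -/
abbrev L1G : Type := Lp ℂ 1 (volume : Measure G6)

namespace UnitaryRep

lemma integrable_smul (π : UnitaryRep) (F : L1G) (ξ : π.H) :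
    Integrable fun g => F g • π.toHom g ξ := by
  have hF : Integrable F := L1.integrable_coeFn F
  refine (hF.norm.mul_const ‖ξ‖).mono'
    (hF.aestronglyMeasurable.smul (π.continuous_apply ξ).aestronglyMeasurable) ?_
  exact .of_forall fun g => by simp [norm_smul]

/-- The integrated form `π(F) ξ = ∫ F(g) π(g) ξ dg` of a unitary representation. -/
def integrated (π : UnitaryRep) (F : L1G) : π.H →L[ℂ] π.H :=
  LinearMap.mkContinuous
    { toFun := fun ξ => ∫ g, F g • π.toHom g ξ
      map_add' := fun ξ η => by
        simp only [map_add, smul_add]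
        exact integral_add (π.integrable_smul F ξ) (π.integrable_smul F η)
      map_smul' := fun c ξ => by
        simp only [map_smul, smul_comm _ c, RingHom.id_apply]
        exact integral_smul c _ }
    ‖F‖ (fun ξ => by
      refine (norm_integral_le_integral_norm _).trans (le_of_eq ?_)
      simp only [norm_smul, LinearIsometryEquiv.norm_map, integral_mul_const]
      rw [L1.norm_eq_integral_norm])

lemma integrated_apply (π : UnitaryRep) (F : L1G) (ξ : π.H) :
    π.integrated F ξ = ∫ g, F g • π.toHom g ξ := rfl

lemma norm_integrated_le (π : UnitaryRep) (F : L1G) : ‖π.integrated F‖ ≤ ‖F‖ :=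
  LinearMap.mkContinuous_norm_le _ (norm_nonneg _) _

end UnitaryRep

/-- The C*-algebra of all uniformly bounded operator fields `(a(π) ∈ B(H_π))_π` over the unitary
representations `π` of `G`, with the supremum norm. -/
abbrev OperatorField : Type 1 := lp (fun π : UnitaryRep => π.H →L[ℂ] π.H) ∞

/-- The universal representation `F ↦ (π(F))_π` of `L¹(G)`. -/
def universalRep : L1G →ₗ[ℂ] OperatorField where
  toFun F := ⟨fun π => π.integrated F, memℓp_infty ⟨‖F‖, by
    rintro _ ⟨π, rfl⟩
    exact π.norm_integrated_le F⟩⟩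
  map_add' F F' := by
    ext π ξ
    change ∫ g, (F + F') g • π.toHom g ξ = (∫ g, F g • π.toHom g ξ) + ∫ g, F' g • π.toHom g ξ
    rw [← integral_add (π.integrable_smul F ξ) (π.integrable_smul F' ξ)]
    refine integral_congr_ae ?_
    filter_upwards [Lp.coeFn_add F F'] with g hg
    rw [hg, Pi.add_apply, add_smul]
  map_smul' c F := by
    ext π ξ
    change ∫ g, (c • F) g • π.toHom g ξ = c • ∫ g, F g • π.toHom g ξ
    rw [← integral_smul]
    refine integral_congr_ae ?_
    filter_upwards [Lp.coeFn_smul c F] with g hg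
    rw [hg, Pi.smul_apply, smul_assoc]

/-- The full group C*-algebra `C*(G)`: the completion of `L¹(G)` in the norm `sup_π ‖π(F)‖`, that is
the norm closure of the image of `L¹(G)` under the universal representation. (Cyclic
representations act on completions of quotients of `L¹(G)`, hence Hilbert spaces in `Type`
suffice.) -/
def groupCStar : Submodule ℂ OperatorField := (LinearMap.range universalRep).topologicalClosure

/-! ### The representations `σ_l = ind_H^G χ_l` -/

/-- The pairing of `𝔥*` (coordinates in the basis `Q*, R*, S*`) with `𝔥` (basis `Q, R, S`). -/
def pairing (l W : ℝ × ℝ × ℝ) : ℝ := l.1 * W.1 + l.2.1 * W.2.1 + l.2.2 * W.2.2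

lemma pairing_add (l V W : ℝ × ℝ × ℝ) : pairing l (V + W) = pairing l V + pairing l W := by
  simp only [pairing, Prod.fst_add, Prod.snd_add]; ring

/-- `Q* ∈ 𝔥*` -/
def Qstar : ℝ × ℝ × ℝ := (1, 0, 0)
/-- `R* ∈ 𝔥*` -/
def Rstar : ℝ × ℝ × ℝ := (0, 1, 0)

/-- The unitary character `χ_l(exp W) = e^{i l(W)}` of `H`. -/
def chi (l W : ℝ × ℝ × ℝ) : ℂ := Complex.exp (Complex.I * (pairing l W : ℝ))

lemma chi_ne_zero (l W : ℝ × ℝ × ℝ) : chi l W ≠ 0 := Complex.exp_ne_zero _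

lemma chi_add (l V W : ℝ × ℝ × ℝ) : chi l (V + W) = chi l V * chi l W := by
  simp [chi, pairing_add, mul_add, Complex.exp_add]

@[simp] lemma chi_zero (l : ℝ × ℝ × ℝ) : chi l 0 = 1 := by simp [chi, pairing]

@[simp] lemma norm_chi (l W : ℝ × ℝ × ℝ) : ‖chi l W‖ = 1 := by
  rw [chi, mul_comm, Complex.norm_exp_ofReal_mul_I]

@[fun_prop] lemma continuous_chi {Z : Type*} [TopologicalSpace Z] (l : ℝ × ℝ × ℝ)
    {W : Z → ℝ × ℝ × ℝ} (hW : Continuous W) : Continuous fun z => chi l (W z) := by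
  unfold chi pairing
  fun_prop

/-- `L²(G/H) = L²(G₀)`. -/
abbrev L2G0 : Type := Lp ℂ 2 (volume : Measure G0)

/-- The function on `G` with `f(k exp W) = χ_l(exp W)⁻¹ ξ(k)`; this identifies `L²(G₀)` with the space
`L²(G/H, χ_l)` of the induced representation (see `equivariantExt_mul` for the covariance). -/
def equivariantExt (l : ℝ × ℝ × ℝ) (ξ : G0 → ℂ) (m : G6) : ℂ := (chi l m.fib)⁻¹ * ξ m.base

lemma equivariantExt_mul (l : ℝ × ℝ × ℝ) (ξ : G0 → ℂ) (m : G6) (W : ℝ × ℝ × ℝ) :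
    equivariantExt l ξ (m * G6.mk 1 W) = (chi l W)⁻¹ * equivariantExt l ξ m := by
  simp [equivariantExt, chi_add, mul_left_comm, mul_comm]

lemma memLp_phase_mul (u : C(G0, ℂ)) (hu : ∀ k, ‖u k‖ = 1) (ξ : L2G0) :
    MemLp (fun k => u k * ξ k) 2 volume :=
  (Lp.memLp ξ).of_le
    (u.continuous.aestronglyMeasurable.mul (Lp.aestronglyMeasurable ξ))
    (.of_forall fun k => by simp [hu])

/-- Multiplication by a continuous function of modulus one. -/
def phaseMul (u : C(G0, ℂ)) (hu : ∀ k, ‖u k‖ = 1) : L2G0 →ₗᵢ[ℂ] L2G0 where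
  toFun := fun ξ => (memLp_phase_mul u hu ξ).toLp
  map_add' := fun ξ η => by
    rw [← MemLp.toLp_add]
    refine MemLp.toLp_congr _ _ ?_
    filter_upwards [Lp.coeFn_add ξ η] with k hk
    rw [hk, Pi.add_apply, Pi.add_apply, mul_add]
  map_smul' := fun c ξ => by
    rw [RingHom.id_apply, ← MemLp.toLp_const_smul]
    refine MemLp.toLp_congr _ _ ?_
    filter_upwards [Lp.coeFn_smul c ξ] with k hk
    rw [hk, Pi.smul_apply, Pi.smul_apply, smul_eq_mul, smul_eq_mul, mul_left_comm]
  norm_map' := fun ξ => by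
    change ‖(memLp_phase_mul u hu ξ).toLp‖ = _
    rw [Lp.norm_toLp, Lp.norm_def]
    congr 1
    exact eLpNorm_congr_norm_ae (.of_forall fun k => by simp [hu])

lemma coeFn_phaseMul (u : C(G0, ℂ)) (hu : ∀ k, ‖u k‖ = 1) (ξ : L2G0) :
    phaseMul u hu ξ =ᵐ[volume] fun k => u k * ξ k := by
  exact MemLp.coeFn_toLp (memLp_phase_mul u hu ξ)

lemma tendsto_phaseMul (ξ : L2G0) {u : G6 → C(G0, ℂ)} (hu : ∀ g k, ‖u g k‖ = 1)
    (hc : ∀ k, Continuous fun g => u g k) (g₀ : G6) :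
    Tendsto (fun g => phaseMul (u g) (hu g) ξ) (𝓝 g₀) (𝓝 (phaseMul (u g₀) (hu g₀) ξ)) := by
  have key : Tendsto (fun g => ∫⁻ k, ‖(u g k - u g₀ k) * ξ k‖ₑ ^ (2 : ℝ)) (𝓝 g₀)
      (𝓝 (∫⁻ _ : G0, 0)) := by
    have hξ := Lp.memLp ξ
    refine tendsto_lintegral_filter_of_dominated_convergence'
      (fun k => ‖(2 : ℂ) * ξ k‖ₑ ^ (2 : ℝ)) (.of_forall fun g => ?_) (.of_forall fun g => ?_) ?_ ?_
    · exact ((((u g).continuous.sub (u g₀).continuous).aestronglyMeasurable.mul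
        (Lp.aestronglyMeasurable ξ)).enorm).pow_const _
    · refine .of_forall fun k => ENNReal.rpow_le_rpow ?_ (by norm_num)
      rw [enorm_le_iff_norm_le, norm_mul, norm_mul]
      gcongr
      refine (norm_sub_le _ _).trans ?_
      rw [hu, hu]; norm_num
    · have := (hξ.const_mul (2 : ℂ)).2
      rw [eLpNorm_lt_top_iff_lintegral_rpow_enorm_lt_top (by norm_num) (by norm_num)] at this
      simpa using this.ne
    · refine .of_forall fun k => ?_
      have h1 : Tendsto (fun g => ‖(u g k - u g₀ k) * ξ k‖ₑ) (𝓝 g₀) (𝓝 0) := by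
        have : Continuous fun g => ‖(u g k - u g₀ k) * ξ k‖ₑ :=
          (((hc k).sub continuous_const).mul continuous_const).enorm
        simpa using this.tendsto g₀
      simpa using h1.ennrpow_const 2
  rw [tendsto_iff_edist_tendsto_0]
  have h2 (g : G6) : edist (phaseMul (u g) (hu g) ξ) (phaseMul (u g₀) (hu g₀) ξ) =
      (∫⁻ k, ‖(u g k - u g₀ k) * ξ k‖ₑ ^ (2 : ℝ)) ^ (1 / 2 : ℝ) := by
    rw [Lp.edist_def, eLpNorm_eq_lintegral_rpow_enorm_toReal (by norm_num) (by norm_num)]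
    simp only [ENNReal.toReal_ofNat]
    congr 1
    refine lintegral_congr_ae ?_
    filter_upwards [coeFn_phaseMul (u g) (hu g) ξ, coeFn_phaseMul (u g₀) (hu g₀) ξ] with k h h'
    rw [Pi.sub_apply, h, h', sub_mul]
  simp only [h2]
  simpa using key.ennrpow_const (1 / 2 : ℝ)

/-- The factor of modulus one in the operator `ind_H^G χ_l (g)`. -/
def indPhase (l : ℝ × ℝ × ℝ) (g : G6) : C(G0, ℂ) where
  toFun k := (chi l (g⁻¹ * G6.mk k 0).fib)⁻¹
  continuous_toFun := Continuous.inv₀ (by simp only [G6.fib_mul, G6.base_mk, G6.fib_mk]; fun_prop)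
    (fun k => chi_ne_zero _ _)

lemma norm_indPhase (l : ℝ × ℝ × ℝ) (g : G6) (k : G0) : ‖indPhase l g k‖ = 1 := by
  simp [indPhase]

/-- The operator `ind_H^G χ_l (g)` on `L²(G₀)`, that is left translation by `g` on covariant functions:
`(σ_l(g) ξ)(k) = f(g⁻¹ k)` with `f` the covariant extension of `ξ`, see `coeFn_indOp`. -/
def indOp (l : ℝ × ℝ × ℝ) (g : G6) : L2G0 →ₗᵢ[ℂ] L2G0 :=
  (phaseMul (indPhase l g) (norm_indPhase l g)).comp
    (Lp.compMeasurePreservingₗᵢ ℂ (fun k => g⁻¹.base * k)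
      (G0.measurePreserving_mul_left g⁻¹.base))

lemma coeFn_indOp (l : ℝ × ℝ × ℝ) (g : G6) (ξ : L2G0) :
    indOp l g ξ =ᵐ[volume] fun k => equivariantExt l ξ (g⁻¹ * G6.mk k 0) := by
  have h1 := coeFn_phaseMul (indPhase l g) (norm_indPhase l g)
    (Lp.compMeasurePreserving (fun k => g⁻¹.base * k)
      (G0.measurePreserving_mul_left g⁻¹.base) ξ)
  have h2 := Lp.coeFn_compMeasurePreserving ξ (G0.measurePreserving_mul_left g⁻¹.base)
  filter_upwards [h1, h2] with k hk1 hk2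
  refine hk1.trans ?_
  rw [hk2]
  rfl

lemma indOp_mul (l : ℝ × ℝ × ℝ) (g h : G6) (ξ : L2G0) :
    indOp l (g * h) ξ = indOp l g (indOp l h ξ) := by
  refine Lp.ext ?_
  have h1 := coeFn_indOp l g (indOp l h ξ)
  have h2 := (G0.measurePreserving_mul_left g⁻¹.base).quasiMeasurePreserving.ae
    (coeFn_indOp l h ξ)
  filter_upwards [coeFn_indOp l (g * h) ξ, h1, h2] with k hk hk1 hk2
  have e : (g * h)⁻¹ * G6.mk k 0 =
      h⁻¹ * G6.mk (g⁻¹.base * k) 0 * G6.mk 1 (g⁻¹ * G6.mk k 0).fib := by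
    rw [mul_inv_rev, mul_assoc, mul_assoc]
    congr 1
    ext1 <;> simp
  rw [hk, hk1, e, equivariantExt_mul]
  exact congrArg _ hk2.symm

lemma indOp_one (l : ℝ × ℝ × ℝ) (ξ : L2G0) : indOp l 1 ξ = ξ := by
  refine Lp.ext ?_
  filter_upwards [coeFn_indOp l 1 ξ] with k hk
  rw [hk]
  simp [equivariantExt]

lemma continuous_indOp (l : ℝ × ℝ × ℝ) (ξ : L2G0) : Continuous fun g => indOp l g ξ := by
  rw [continuous_iff_continuousAt]
  intro g₀
  let T (g : G6) : L2G0 := Lp.compMeasurePreserving (fun k => g⁻¹.base * k)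
      (G0.measurePreserving_mul_left g⁻¹.base) ξ
  have hT : Tendsto T (𝓝 g₀) (𝓝 (T g₀)) := by
    let c : G6 → C(G0, G0) := fun g => ⟨fun k => g⁻¹.base * k, by fun_prop⟩
    have hc : Continuous c :=
      ContinuousMap.continuous_of_continuous_uncurry _ (by
        change Continuous fun z : G6 × G0 => z.1.base⁻¹ * z.2
        fun_prop)
    exact Filter.Tendsto.compMeasurePreservingLp tendsto_const_nhds (hc.tendsto g₀)
      (fun g => G0.measurePreserving_mul_left g⁻¹.base)
      (G0.measurePreserving_mul_left g₀⁻¹.base) (by norm_num)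
  have hP := tendsto_phaseMul (T g₀) (norm_indPhase l) (fun k => by
    change Continuous fun g : G6 => (chi l (adInv k (-adInv g.base⁻¹ g.fib) + 0))⁻¹
    exact Continuous.inv₀ (by fun_prop) (fun _ => chi_ne_zero _ _)) g₀
  have hd : Tendsto (fun g => phaseMul (indPhase l g) (norm_indPhase l g) (T g) -
      phaseMul (indPhase l g) (norm_indPhase l g) (T g₀)) (𝓝 g₀) (𝓝 0) := by
    rw [tendsto_zero_iff_norm_tendsto_zero]
    simp only [← map_sub, LinearIsometry.norm_map]
    exact tendsto_iff_norm_sub_tendsto_zero.1 hT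
  have := hd.add hP
  simp only [sub_add_cancel, zero_add] at this
  exact this

/-- The induced representation `σ_l = ind_H^G χ_l`, realized on `L²(G₀) = L²(ℝ³)`. -/
def indRep (l : ℝ × ℝ × ℝ) : UnitaryRep where
  H := L2G0
  toHom :=
    { toFun := fun g =>
        { (indOp l g).toLinearMap with
          invFun := indOp l g⁻¹
          left_inv := fun ξ => by
            change indOp l g⁻¹ (indOp l g ξ) = ξ
            rw [← indOp_mul, inv_mul_cancel, indOp_one]
          right_inv := fun ξ => by
            change indOp l g (indOp l g⁻¹ ξ) = ξ
            rw [← indOp_mul, mul_inv_cancel, indOp_one]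
          norm_map' := (indOp l g).norm_map }
      map_one' := by
        ext1 ξ
        exact indOp_one l ξ
      map_mul' := fun g h => by
        ext1 ξ
        exact indOp_mul l g h ξ }
  continuous_apply := continuous_indOp l

/-- `σ_l(a)` for `a ∈ C*(G)`. -/
def sigma (l : ℝ × ℝ × ℝ) (a : OperatorField) : L2G0 →L[ℂ] L2G0 := a (indRep l)


/-! ### The direct integral and the intertwining operator -/

/-- `L²(ℝ²)` -/
abbrev L2Z : Type := Lp ℂ 2 (volume : Measure (ℝ × ℝ))

/-- The Hilbert space `∫⊕_ℝ L²(ℝ²) db = L²(ℝ; L²(ℝ²))`. -/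
abbrev Htau : Type := Lp L2Z 2 (volume : Measure ℝ)

lemma measurable_of_edist {α Y : Type*} [MeasurableSpace α] [PseudoEMetricSpace Y]
    [SecondCountableTopology Y] [MeasurableSpace Y] [BorelSpace Y] {f : α → Y}
    (h : ∀ y, Measurable fun a => edist (f a) y) : Measurable f := by
  refine measurable_of_isOpen fun U hU => ?_
  obtain ⟨T, hTc, hTs, hTU⟩ := TopologicalSpace.isOpen_sUnion_countable
    {B : Set Y | ∃ y r, B = Metric.eball y r ∧ B ⊆ U}
    (by rintro _ ⟨y, r, rfl, -⟩; exact Metric.isOpen_eball)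
  have hUe : ⋃₀ {B : Set Y | ∃ y r, B = Metric.eball y r ∧ B ⊆ U} = U := by
    refine subset_antisymm (sUnion_subset fun B hB => by
      obtain ⟨_, _, _, h⟩ := hB; exact h) fun y hy => ?_
    obtain ⟨r, hr, hrU⟩ := EMetric.isOpen_iff.1 hU y hy
    exact ⟨_, ⟨y, r, rfl, hrU⟩, Metric.mem_eball_self hr⟩
  rw [← hUe, ← hTU, sUnion_eq_biUnion, preimage_iUnion₂]
  refine MeasurableSet.biUnion hTc fun B hB => ?_
  obtain ⟨y, r, rfl, -⟩ := hTs hB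
  exact (h y) measurableSet_Iio

open Classical in
/-- The section `f(y, ·)` as an element of `L²(ℝ²)` (for almost all `y`). -/
def slice (f : ℝ × (ℝ × ℝ) → ℂ) (y : ℝ) : L2Z :=
  if h : MemLp (fun z => f (y, z)) 2 volume then h.toLp else 0

lemma slice_congr {f g : ℝ × (ℝ × ℝ) → ℂ} (h : f =ᵐ[volume] g) :
    slice f =ᵐ[volume] slice g := by
  have h' : ∀ᵐ y : ℝ, ∀ᵐ z : ℝ × ℝ, f (y, z) = g (y, z) := Measure.ae_ae_of_ae_prod h
  filter_upwards [h'] with y hy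
  have hiff : MemLp (fun z => f (y, z)) 2 volume ↔ MemLp (fun z => g (y, z)) 2 volume :=
    memLp_congr_ae hy
  by_cases hf : MemLp (fun z => f (y, z)) 2 volume
  · rw [slice, slice, dif_pos hf, dif_pos (hiff.1 hf)]
    exact MemLp.toLp_congr _ _ hy
  · rw [slice, slice, dif_neg hf, dif_neg (fun h => hf (hiff.2 h))]

lemma ae_memLp_slice {f : ℝ × (ℝ × ℝ) → ℂ} (hf : MemLp f 2 volume) :
    ∀ᵐ y : ℝ, MemLp (fun z => f (y, z)) 2 volume := by
  have h1 : ∀ᵐ y : ℝ, AEStronglyMeasurable (fun z => f (y, z)) volume :=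
    AEStronglyMeasurable.prodMk_left (μ := (volume : Measure ℝ))
      (ν := (volume : Measure (ℝ × ℝ))) hf.1
  have h2 : ∫⁻ y : ℝ, ∫⁻ z : ℝ × ℝ, ‖f (y, z)‖ₑ ^ (2 : ℝ) < ∞ := by
    rw [← lintegral_prod (μ := (volume : Measure ℝ)) (ν := (volume : Measure (ℝ × ℝ)))
      (fun w => ‖f w‖ₑ ^ (2 : ℝ)) (hf.1.enorm.pow_const _)]
    have := hf.2
    rw [eLpNorm_lt_top_iff_lintegral_rpow_enorm_lt_top (by norm_num) (by norm_num)] at this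
    simp only [ENNReal.toReal_ofNat] at this
    exact this
  have h3 : ∀ᵐ y : ℝ, ∫⁻ z : ℝ × ℝ, ‖f (y, z)‖ₑ ^ (2 : ℝ) < ∞ :=
    ae_lt_top' ((hf.1.enorm.pow_const _).lintegral_prod_right') h2.ne
  filter_upwards [h1, h3] with y hy1 hy3
  refine ⟨hy1, ?_⟩
  rw [eLpNorm_lt_top_iff_lintegral_rpow_enorm_lt_top (by norm_num) (by norm_num)]
  simpa using hy3

lemma coeFn_slice {f : ℝ × (ℝ × ℝ) → ℂ} (hf : MemLp f 2 volume) :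
    ∀ᵐ y : ℝ, slice f y =ᵐ[volume] fun z => f (y, z) := by
  filter_upwards [ae_memLp_slice hf] with y hy
  rw [slice, dif_pos hy]
  exact MemLp.coeFn_toLp hy

lemma aestronglyMeasurable_slice {f : ℝ × (ℝ × ℝ) → ℂ} (hf : MemLp f 2 volume) :
    AEStronglyMeasurable (slice f) volume := by
  obtain ⟨f₀, hf₀, hff₀⟩ := hf.1
  refine AEStronglyMeasurable.congr ?_ (slice_congr hff₀).symm
  borelize L2Z
  have : Fact ((2 : ℝ≥0∞) ≠ ∞) := ⟨by norm_num⟩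
  have : SecondCountableTopology L2Z := Lp.SecondCountableTopology
  refine (Measurable.aestronglyMeasurable ?_)
  refine measurable_of_edist fun h => ?_
  have hs (y : ℝ) : AEStronglyMeasurable (fun z => f₀ (y, z)) volume :=
    (hf₀.comp_measurable measurable_prodMk_left).aestronglyMeasurable
  have hmem (y : ℝ) : MemLp (fun z => f₀ (y, z)) 2 volume ↔
      ∫⁻ z, ‖f₀ (y, z)‖ₑ ^ (2 : ℝ) < ∞ := by
    rw [MemLp, eLpNorm_lt_top_iff_lintegral_rpow_enorm_lt_top (by norm_num) (by norm_num)]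
    simp [hs y]
  have hA : MeasurableSet {y : ℝ | ∫⁻ z, ‖f₀ (y, z)‖ₑ ^ (2 : ℝ) < ∞} :=
    (Measurable.lintegral_prod_right' (f := fun w : ℝ × (ℝ × ℝ) => ‖f₀ w‖ₑ ^ (2 : ℝ))
      (hf₀.enorm.pow_const _)) measurableSet_Iio
  have hB : Measurable fun y : ℝ => (∫⁻ z, ‖f₀ (y, z) - h z‖ₑ ^ (2 : ℝ)) ^ (1 / 2 : ℝ) := by
    refine (Measurable.lintegral_prod_right'
      (f := fun w : ℝ × (ℝ × ℝ) => ‖f₀ w - h w.2‖ₑ ^ (2 : ℝ)) ?_).pow_const _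
    exact ((hf₀.sub ((Lp.stronglyMeasurable h).comp_measurable measurable_snd)).enorm).pow_const _
  have heq : (fun y => edist (slice f₀ y) h) =
      fun y => if ∫⁻ z, ‖f₀ (y, z)‖ₑ ^ (2 : ℝ) < ∞ then
        (∫⁻ z, ‖f₀ (y, z) - h z‖ₑ ^ (2 : ℝ)) ^ (1 / 2 : ℝ) else edist 0 h := by
    funext y
    by_cases hy : ∫⁻ z, ‖f₀ (y, z)‖ₑ ^ (2 : ℝ) < ∞
    · rw [if_pos hy, slice, dif_pos ((hmem y).2 hy), Lp.edist_def,
        eLpNorm_eq_lintegral_rpow_enorm_toReal (by norm_num) (by norm_num)]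
      simp only [ENNReal.toReal_ofNat]
      congr 1
      refine lintegral_congr_ae ?_
      filter_upwards [MemLp.coeFn_toLp ((hmem y).2 hy)] with z hz
      rw [Pi.sub_apply, hz]
    · rw [if_neg hy, slice, dif_neg (fun h' => hy ((hmem y).1 h'))]
  rw [heq]
  exact Measurable.ite hA hB measurable_const

lemma eLpNorm_slice {f : ℝ × (ℝ × ℝ) → ℂ} (hf : MemLp f 2 volume) :
    eLpNorm (slice f) 2 volume = eLpNorm f 2 volume := by
  rw [eLpNorm_eq_lintegral_rpow_enorm_toReal (by norm_num) (by norm_num),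
    eLpNorm_eq_lintegral_rpow_enorm_toReal (by norm_num) (by norm_num)]
  simp only [ENNReal.toReal_ofNat]
  congr 1
  have : ∫⁻ w, ‖f w‖ₑ ^ (2 : ℝ) = ∫⁻ y : ℝ, ∫⁻ z : ℝ × ℝ, ‖f (y, z)‖ₑ ^ (2 : ℝ) :=
    lintegral_prod (μ := (volume : Measure ℝ)) (ν := (volume : Measure (ℝ × ℝ)))
      (fun w => ‖f w‖ₑ ^ (2 : ℝ)) (hf.1.enorm.pow_const _)
  rw [this]
  refine lintegral_congr_ae ?_
  filter_upwards [coeFn_slice hf] with y hy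
  rw [Lp.enorm_def, eLpNorm_congr_ae hy,
    eLpNorm_eq_lintegral_rpow_enorm_toReal (by norm_num) (by norm_num)]
  simp only [ENNReal.toReal_ofNat]
  rw [← ENNReal.rpow_mul]
  norm_num

lemma memLp_slice {f : ℝ × (ℝ × ℝ) → ℂ} (hf : MemLp f 2 volume) : MemLp (slice f) 2 volume :=
  ⟨aestronglyMeasurable_slice hf, by rw [eLpNorm_slice hf]; exact hf.2⟩

/-- The canonical isometry `L²(ℝ × ℝ²) → L²(ℝ; L²(ℝ²))`, `f ↦ (y ↦ f(y, ·))`. -/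
def curryL2 : Lp ℂ 2 (volume : Measure (ℝ × (ℝ × ℝ))) →ₗᵢ[ℂ] Htau where
  toFun f := (memLp_slice (Lp.memLp f)).toLp
  map_add' f g := by
    rw [← MemLp.toLp_add]
    refine MemLp.toLp_congr _ _ ?_
    have h := Lp.coeFn_add f g
    have h' : ∀ᵐ y : ℝ, ∀ᵐ z : ℝ × ℝ, (f + g) (y, z) = f (y, z) + g (y, z) :=
      Measure.ae_ae_of_ae_prod h
    filter_upwards [coeFn_slice (Lp.memLp f), coeFn_slice (Lp.memLp g),
      coeFn_slice (Lp.memLp (f + g)), h'] with y h1 h2 h3 h4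
    refine Lp.ext ?_
    rw [Pi.add_apply]
    filter_upwards [h1, h2, h3, h4, Lp.coeFn_add (slice f y) (slice g y)] with z k1 k2 k3 k4 k5
    rw [k3, k4, k5, Pi.add_apply, k1, k2]
  map_smul' c f := by
    rw [RingHom.id_apply, ← MemLp.toLp_const_smul]
    refine MemLp.toLp_congr _ _ ?_
    have h := Lp.coeFn_smul c f
    have h' : ∀ᵐ y : ℝ, ∀ᵐ z : ℝ × ℝ, (c • f) (y, z) = c • f (y, z) :=
      Measure.ae_ae_of_ae_prod h
    filter_upwards [coeFn_slice (Lp.memLp f), coeFn_slice (Lp.memLp (c • f)), h'] with y h1 h3 h4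
    refine Lp.ext ?_
    rw [Pi.smul_apply]
    filter_upwards [h1, h3, h4, Lp.coeFn_smul c (slice f y)] with z k1 k3 k4 k5
    rw [k3, k4, k5, Pi.smul_apply, k1]
  norm_map' f := by
    change ‖(memLp_slice (Lp.memLp f)).toLp‖ = _
    rw [Lp.norm_toLp, Lp.norm_def, eLpNorm_slice (Lp.memLp f)]

/-- The map `(y, (x, p)) ↦ exp(xX) exp(pP) exp(yY)`. -/
def polar (w : ℝ × (ℝ × ℝ)) : G0 := G0.mk w.2.1 0 w.2.2 * G0.mk 0 w.1 0

lemma continuous_polar : Continuous polar := by unfold polar; fun_prop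

lemma lintegral_polar (F : G0 → ℝ≥0∞) (hF : Measurable F) :
    ∫⁻ w, ENNReal.ofReal (Real.exp (-w.1)) * F (polar w) = ∫⁻ k, F k := by
  have hp (y : ℝ) (g : ℝ → ℝ≥0∞) (hg : Measurable g) :
      ∫⁻ p : ℝ, ENNReal.ofReal (Real.exp (-y)) * g (Real.exp (-y) * p) = ∫⁻ p, g p := by
    rw [lintegral_const_mul _ (f := fun p => g (Real.exp (-y) * p))
        (hg.comp (measurable_const_mul _)),
      ← lintegral_map (μ := volume) hg (measurable_const_mul (Real.exp (-y))),
      Real.map_volume_mul_left (Real.exp_ne_zero _), lintegral_smul_measure, smul_eq_mul,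
      ← mul_assoc, ← ENNReal.ofReal_mul (Real.exp_nonneg _),
      abs_of_pos (inv_pos.2 (Real.exp_pos _)), mul_inv_cancel₀ (Real.exp_ne_zero _),
      ENNReal.ofReal_one, one_mul]
  have hpol (y x p : ℝ) : polar (y, (x, p)) = G0.mk x y (Real.exp (-y) * p) := by
    ext <;> simp [polar]
  have hmk : Measurable fun w : ℝ × (ℝ × ℝ) => F (G0.mk w.2.1 w.1 w.2.2) :=
    hF.comp (Continuous.measurable (by fun_prop))
  have hmeas : Measurable fun w : ℝ × (ℝ × ℝ) =>
      ENNReal.ofReal (Real.exp (-w.1)) * F (polar w) :=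
    Measurable.mul (by fun_prop) (hF.comp continuous_polar.measurable)
  calc ∫⁻ w, ENNReal.ofReal (Real.exp (-w.1)) * F (polar w)
      = ∫⁻ y : ℝ, ∫⁻ z : ℝ × ℝ, ENNReal.ofReal (Real.exp (-y)) * F (polar (y, z)) :=
        lintegral_prod _ hmeas.aemeasurable
    _ = ∫⁻ y : ℝ, ∫⁻ x : ℝ, ∫⁻ p : ℝ, F (G0.mk x y p) := by
        refine lintegral_congr fun y => ?_
        have : Measurable fun z : ℝ × ℝ => ENNReal.ofReal (Real.exp (-y)) * F (polar (y, z)) :=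
          hmeas.comp measurable_prodMk_left
        refine (lintegral_prod _ this.aemeasurable).trans (lintegral_congr fun x => ?_)
        simp only [hpol]
        exact hp y (fun p => F (G0.mk x y p)) (hF.comp (Continuous.measurable (by fun_prop)))
    _ = ∫⁻ x : ℝ, ∫⁻ y : ℝ, ∫⁻ p : ℝ, F (G0.mk x y p) := by
        refine lintegral_lintegral_swap (f := fun y x => ∫⁻ p : ℝ, F (G0.mk x y p))
          (Measurable.aemeasurable ?_)
        exact Measurable.lintegral_prod_right' (f := fun w : (ℝ × ℝ) × ℝ =>
          F (G0.mk w.1.2 w.1.1 w.2)) (hF.comp (Continuous.measurable (by fun_prop)))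
    _ = ∫⁻ k, F k := by
        have h1 : ∫⁻ k, F k = ∫⁻ w : ℝ × (ℝ × ℝ), F (G0.mk w.1 w.2.1 w.2.2) := rfl
        have h2 : Measurable fun w : ℝ × (ℝ × ℝ) => F (G0.mk w.1 w.2.1 w.2.2) :=
          hF.comp (Continuous.measurable (by fun_prop))
        rw [h1]
        refine Eq.symm ((lintegral_prod _ h2.aemeasurable).trans (lintegral_congr fun x => ?_))
        exact lintegral_prod _ (h2.comp measurable_prodMk_left).aemeasurable

lemma quasiMeasurePreserving_polar : Measure.QuasiMeasurePreserving polar := by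
  refine ⟨continuous_polar.measurable, Measure.AbsolutelyContinuous.mk fun s hs h0 => ?_⟩
  rw [Measure.map_apply continuous_polar.measurable hs]
  have h := lintegral_polar (s.indicator 1) (measurable_one.indicator hs)
  have hm : Measurable fun w => ENNReal.ofReal (Real.exp (-w.1)) *
      s.indicator (1 : G0 → ℝ≥0∞) (polar w) :=
    Measurable.mul (by fun_prop) ((measurable_one.indicator hs).comp continuous_polar.measurable)
  rw [lintegral_indicator_one hs, h0, lintegral_eq_zero_iff hm] at h
  refine measure_mono_null (fun w hw => ?_) (ae_iff.1 h)
  simpa [indicator, Real.exp_pos] using hw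

/-- `(y, (x, p)) ↦ e^{-y/2} ξ(exp(xX) exp(pP) exp(yY))`. -/
def polarFun (ξ : G0 → ℂ) (w : ℝ × (ℝ × ℝ)) : ℂ :=
  ((Real.exp (-(w.1 / 2)) : ℝ) : ℂ) * ξ (polar w)

lemma eLpNorm_polarFun (ξ : L2G0) : eLpNorm (polarFun ξ) 2 volume = eLpNorm ξ 2 volume := by
  rw [eLpNorm_eq_lintegral_rpow_enorm_toReal (by norm_num) (by norm_num),
    eLpNorm_eq_lintegral_rpow_enorm_toReal (by norm_num) (by norm_num)]
  simp only [ENNReal.toReal_ofNat]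
  congr 1
  rw [← lintegral_polar _ ((Lp.stronglyMeasurable ξ).enorm.pow_const 2)]
  refine lintegral_congr fun w => ?_
  rw [polarFun, enorm_mul, ENNReal.mul_rpow_of_nonneg _ _ (by norm_num)]
  congr 1
  rw [← ofReal_norm, Complex.norm_real, Real.norm_of_nonneg (Real.exp_nonneg _),
    ENNReal.ofReal_rpow_of_pos (Real.exp_pos _), ← Real.exp_mul]
  congr 2
  ring

lemma memLp_polarFun (ξ : L2G0) : MemLp (polarFun ξ) 2 volume := by
  refine ⟨AEStronglyMeasurable.mul (Continuous.aestronglyMeasurable (by fun_prop)) ?_, ?_⟩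
  · exact (Lp.aestronglyMeasurable ξ).comp_quasiMeasurePreserving quasiMeasurePreserving_polar
  · rw [eLpNorm_polarFun]
    exact (Lp.memLp ξ).2

/-- `polarFun` as an isometry of `L²` spaces. -/
def polarL2 : L2G0 →ₗᵢ[ℂ] Lp ℂ 2 (volume : Measure (ℝ × (ℝ × ℝ))) where
  toFun ξ := (memLp_polarFun ξ).toLp
  map_add' ξ η := by
    rw [← MemLp.toLp_add]
    refine MemLp.toLp_congr _ _ ?_
    filter_upwards [quasiMeasurePreserving_polar.ae (Lp.coeFn_add ξ η)] with w hw
    rw [Pi.add_apply, polarFun, hw, Pi.add_apply, mul_add]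
    rfl
  map_smul' c ξ := by
    rw [RingHom.id_apply, ← MemLp.toLp_const_smul]
    refine MemLp.toLp_congr _ _ ?_
    filter_upwards [quasiMeasurePreserving_polar.ae (Lp.coeFn_smul c ξ)] with w hw
    rw [Pi.smul_apply, polarFun, hw, Pi.smul_apply, smul_eq_mul, mul_left_comm]
    rfl
  norm_map' ξ := by
    change ‖(memLp_polarFun ξ).toLp‖ = _
    rw [Lp.norm_toLp, Lp.norm_def, eLpNorm_polarFun]

/-- The unitary operator
`(U ξ)(b)(x, p) = ∫ ξ(exp(xX) exp(pP) exp(yY)) e^{-y/2} e^{-2πi b y} dy`, the integral being the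
(vector valued) `L²` Fourier transform in the variable `y`. -/
def intertwiner : L2G0 →ₗᵢ[ℂ] Htau :=
  (Lp.fourierTransformₗᵢ ℝ L2Z).toLinearIsometry.comp (curryL2.comp polarL2)

/-- `ρ(T) = U T U*`. -/
def rho (T : L2G0 →L[ℂ] L2G0) : Htau →L[ℂ] Htau :=
  intertwiner.toContinuousLinearMap ∘L T ∘L
    ContinuousLinearMap.adjoint intertwiner.toContinuousLinearMap

/-- `C₀(ℝ, 𝒦)`, `𝒦` the compact operators on `L²(ℝ²)`, as a set of operators on `L²(ℝ; L²(ℝ²))`: the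
field `φ` acts by `(φ ξ)(b) = φ(b)(ξ(b))`. -/
def C0K : Set (Htau →L[ℂ] Htau) :=
  {T | ∃ φ : C₀(ℝ, L2Z →L[ℂ] L2Z), (∀ b, IsCompactOperator (φ b)) ∧
    ∀ ξ : Htau, T ξ =ᵐ[volume] fun b => φ b (ξ b)}

/-! ### The approximating operators -/

lemma memLp_indicator {S : Set G0} (hS : MeasurableSet S) (ξ : L2G0) :
    MemLp (S.indicator ξ) 2 volume := (Lp.memLp ξ).indicator hS

/-- The operator `M_S` on `L²(G₀)` of multiplication with the characteristic function of `S`. -/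
def mulInd (S : Set G0) (hS : MeasurableSet S) : L2G0 →L[ℂ] L2G0 :=
  LinearMap.mkContinuous
    { toFun := fun ξ => (memLp_indicator hS ξ).toLp
      map_add' := fun ξ η => by
        rw [← MemLp.toLp_add]
        refine MemLp.toLp_congr _ _ ?_
        filter_upwards [Lp.coeFn_add ξ η] with k hk
        by_cases h : k ∈ S
        · rw [Pi.add_apply, indicator_of_mem h, indicator_of_mem h, indicator_of_mem h, hk,
            Pi.add_apply]
        · simp [h]
      map_smul' := fun c ξ => by
        rw [RingHom.id_apply, ← MemLp.toLp_const_smul]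
        refine MemLp.toLp_congr _ _ ?_
        filter_upwards [Lp.coeFn_smul c ξ] with k hk
        by_cases h : k ∈ S
        · rw [Pi.smul_apply, indicator_of_mem h, indicator_of_mem h, hk, Pi.smul_apply]
        · simp [h] }
    1 (fun ξ => by
      change ‖(memLp_indicator hS ξ).toLp‖ ≤ _
      rw [Lp.norm_toLp, Lp.norm_def, one_mul]
      exact ENNReal.toReal_mono (Lp.memLp ξ).2.ne (eLpNorm_indicator_le _))

/-- The interval `I_{c,l} = [cl, cl + c)`. -/
def cell (c : ℝ) (l : ℤ) : Set ℝ := Set.Ico (c * l) (c * l + c)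

lemma measurableSet_cell (c : ℝ) (l : ℤ) : MeasurableSet (cell c l) := measurableSet_Ico

/-- The set `S_{δ,D,2,k}` (with `r = r_δ`) of all `(x, y, p)` with `e^{-x} ≤ δ⁶`, `x ∈ I_{r,k₁}`,
`y ∈ I_{r,k₂}` and `p ∈ I_{D δ² e^{r(k₁-k₂)}, k₃}`. -/
def box (r δ D : ℝ) (k : ℤ × ℤ × ℤ) : Set G0 :=
  {g | Real.exp (-g.x) ≤ δ ^ 6 ∧ g.x ∈ cell r k.1 ∧ g.y ∈ cell r k.2.1 ∧
    g.p ∈ cell (D * δ ^ 2 * Real.exp (r * (k.1 - k.2.1))) k.2.2}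

lemma measurableSet_box (r δ D : ℝ) (k : ℤ × ℤ × ℤ) : MeasurableSet (box r δ D k) :=
  (measurableSet_le (f := fun g : G0 => Real.exp (-g.x))
    (Continuous.measurable (by fun_prop)) measurable_const).inter
    ((G0.continuous_x.measurable (measurableSet_cell _ _)).inter
      ((G0.continuous_y.measurable (measurableSet_cell _ _)).inter
        (G0.continuous_p.measurable (measurableSet_cell _ _))))

/-- The multi-indices `j ∈ ℤ³` with `|j₁|, |j₂|, |j₃| ≤ 1`. -/
def nbrs : Finset (ℤ × ℤ × ℤ) := Finset.Icc (-1) 1 ×ˢ Finset.Icc (-1) 1 ×ˢ Finset.Icc (-1) 1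

/-- The set `R_{δ,D,2,k} = ⋃_j S_{δ, D e^{r(-j₁+j₂)}, 2, k+j}`, the union over `|j_i| ≤ 1`. -/
def bigBox (r δ D : ℝ) (k : ℤ × ℤ × ℤ) : Set G0 :=
  ⋃ j ∈ nbrs, box r δ (D * Real.exp (r * (-j.1 + j.2.1))) (k + j)

lemma measurableSet_bigBox (r δ D : ℝ) (k : ℤ × ℤ × ℤ) : MeasurableSet (bigBox r δ D k) :=
  Finset.measurableSet_biUnion _ fun _ _ => measurableSet_box _ _ _ _

/-- The operator `P_{δ,D,2,k} ∘ σ_l(a) ∘ M_{δ,D,2,k}` with `l = -ε δ² k₃ D e^{r(k₁-k₂)} Q*`, where `P` and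
`M` are the multiplication operators of `R_{δ,D,2,k}` and `S_{δ,D,2,k}`. -/
def boundaryTerm (ε r δ D : ℝ) (a : OperatorField) (k : ℤ × ℤ × ℤ) : L2G0 →L[ℂ] L2G0 :=
  mulInd (bigBox r δ D k) (measurableSet_bigBox r δ D k) ∘L
    sigma ((-(ε * δ ^ 2 * k.2.2 * D * Real.exp (r * (k.1 - k.2.1)))) • Qstar) a ∘L
    mulInd (box r δ D k) (measurableSet_box r δ D k)

end N628

end

open N628

noncomputable section

namespace N628

/-! By density of step functions in L¹(G) it is enough to treat the indicator function of a product
set, k ∈ A and W ∈ B, in G = G₀H. Since exp W acts in σ_l by multiplication with the character of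
Ad(k⁻¹)W, σ_l of such a function is L(A) ∘ M_s. Here L(A) is an integrated left translation of G₀
that does not depend on l, and the symbol s(k) is the Fourier transform `hat B` at the coadjoint
translate `coad k l` (`sigma_universalRep_indicator`). Everything reduces to comparing symbols.

For l = εR* the symbol depends only on z = (x, e^y p), that is on the class of k in G₀/exp(ℝY),
because exp(ℝY) fixes R*. The operator U is a Fourier transform along this fibre. It turns a
multiplier in z into a constant field, and L(A) into b ↦ N(b) ∘ C. The factor N(b) is a Fourier
integral of dilations, norm continuous in b and strongly convergent to 0 at infinity, and C is a
convolution on ℝ². If the multiplier has bounded support, C followed by it is compact, so N(b)C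
tends to 0 in norm (`mem_C0K_of_bounded_support`). Multipliers that vanish at infinity follow by
truncation. By the Riemann-Lebesgue lemma the symbol of εR* vanishes at infinity wherever x is
bounded above (`zSymbol_indicator_tendsto`), so the only obstruction lies at x → +∞, in the half
space e^{-x} ≤ δ⁶.

In that half space the R*-component ε e^{-x} of `coad k (ε • Rstar)` is at most δ⁶, and on one box p
may be frozen at a corner with an error at most Dδ²e^{r_δ} in the Q*-component. The frozen
functional is the coadjoint translate of the multiple of Q* used on the box
(`norm_coad_boundaryCoeff_sub_le`). A translation from a bounded set moves a box only into adjacent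
boxes, as long as it stays in the half space (`mul_mem_bigBox_iff`). Hence the sum of the boundary
terms collapses to M_X L(A) M_b, with X the half space and b the frozen symbol
(`boundarySum_indicator`). The difference from σ_{εR*} consists of two terms whose symbols live
where x is bounded above, and of a term whose norm tends to 0 (`nearC0K_sub_boundarySum`).

For arbitrary a, the sum converges because the boxes are disjoint and the enlarged boxes are
disjoint within each of the 27 residue classes of indices modulo 3 (`exists_boundarySum`). The
resulting bound 27‖a‖ is uniform in δ, so the approximation property passes to norm limits
(`BoundaryApprox.of_forall_near`). -/

/-! ### Multiplication operators on `L²` -/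

section MulOp
variable {α : Type*} [MeasurableSpace α] {μ : Measure α}

/-- A bounded measurable function. -/
def BddMeas (g : α → ℂ) : Prop := Measurable g ∧ ∃ C : ℝ, ∀ x, ‖g x‖ ≤ C

lemma BddMeas.mul {g h : α → ℂ} (hg : BddMeas g) (hh : BddMeas h) :
    BddMeas fun x => g x * h x := by
  obtain ⟨C, hC⟩ := hg.2
  obtain ⟨D, hD⟩ := hh.2
  refine ⟨hg.1.mul hh.1, C * D, fun x => ?_⟩
  rw [norm_mul]
  exact mul_le_mul (hC x) (hD x) (norm_nonneg _) ((norm_nonneg _).trans (hC x))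

lemma BddMeas.sub {g h : α → ℂ} (hg : BddMeas g) (hh : BddMeas h) :
    BddMeas fun x => g x - h x := by
  obtain ⟨C, hC⟩ := hg.2
  obtain ⟨D, hD⟩ := hh.2
  exact ⟨hg.1.sub hh.1, C + D, fun x => (norm_sub_le _ _).trans (add_le_add (hC x) (hD x))⟩

lemma BddMeas.indicator {g : α → ℂ} (hg : BddMeas g) {S : Set α} (hS : MeasurableSet S) :
    BddMeas (S.indicator g) := by
  obtain ⟨C, hC⟩ := hg.2
  exact ⟨hg.1.indicator hS, C, fun x => (norm_indicator_le_norm_self _ _).trans (hC x)⟩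

lemma BddMeas.one : BddMeas (1 : α → ℂ) := ⟨measurable_one, 1, fun x => by simp⟩

lemma BddMeas.comp {β : Type*} [MeasurableSpace β] {g : α → ℂ} (hg : BddMeas g) {f : β → α}
    (hf : Measurable f) : BddMeas fun x => g (f x) :=
  ⟨hg.1.comp hf, hg.2.imp fun _ h x => h (f x)⟩

lemma BddMeas.memLp {g : α → ℂ} (hg : BddMeas g) (v : Lp ℂ 2 μ) :
    MemLp (fun x => g x * v x) 2 μ := by
  obtain ⟨C, hC⟩ := hg.2
  refine (Lp.memLp v).of_le_mul (c := C)
    (hg.1.aestronglyMeasurable.mul (Lp.aestronglyMeasurable v)) (.of_forall fun x => ?_)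
  rw [norm_mul]
  exact mul_le_mul_of_nonneg_right (hC x) (norm_nonneg _)

open Classical in
variable (μ) in
/-- Multiplication by a bounded measurable function on `L²`. -/
def mulOp (g : α → ℂ) : Lp ℂ 2 μ →L[ℂ] Lp ℂ 2 μ :=
  if hg : BddMeas g then
    LinearMap.mkContinuousOfExistsBound
      { toFun := fun v => (hg.memLp v).toLp
        map_add' := fun v w => by
          rw [← MemLp.toLp_add]
          refine MemLp.toLp_congr _ _ ?_
          filter_upwards [Lp.coeFn_add v w] with k hk
          rw [hk, Pi.add_apply, Pi.add_apply, mul_add]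
        map_smul' := fun c v => by
          rw [RingHom.id_apply, ← MemLp.toLp_const_smul]
          refine MemLp.toLp_congr _ _ ?_
          filter_upwards [Lp.coeFn_smul c v] with k hk
          rw [hk, Pi.smul_apply, Pi.smul_apply, smul_eq_mul, smul_eq_mul, mul_left_comm] }
      (by
        obtain ⟨C, hC⟩ := hg.2
        refine ⟨C, fun v => Lp.norm_le_mul_norm_of_ae_le_mul ?_⟩
        filter_upwards [(hg.memLp v).coeFn_toLp] with x hx
        refine (congrArg _ hx).trans_le ?_
        rw [norm_mul]
        exact mul_le_mul_of_nonneg_right (hC x) (norm_nonneg _))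
  -- The default value makes the operator depend on g alone, so symbols can be rewritten without
  -- carrying proofs of boundedness.
  else 0

lemma coeFn_mulOp {g : α → ℂ} (hg : BddMeas g) (v : Lp ℂ 2 μ) :
    mulOp μ g v =ᵐ[μ] fun x => g x * v x := by
  rw [mulOp, dif_pos hg]
  exact (hg.memLp v).coeFn_toLp

lemma norm_mulOp_le {g : α → ℂ} (hg : BddMeas g) {C : ℝ} (h0 : 0 ≤ C) (hC : ∀ x, ‖g x‖ ≤ C) :
    ‖mulOp μ g‖ ≤ C := by
  refine ContinuousLinearMap.opNorm_le_bound _ h0 fun v => Lp.norm_le_mul_norm_of_ae_le_mul ?_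
  filter_upwards [coeFn_mulOp hg v] with x hx
  rw [hx, norm_mul]
  exact mul_le_mul_of_nonneg_right (hC x) (norm_nonneg _)

lemma mulOp_mulOp {g h : α → ℂ} (hg : BddMeas g) (hh : BddMeas h) (v : Lp ℂ 2 μ) :
    mulOp μ g (mulOp μ h v) = mulOp μ (fun x => g x * h x) v := by
  refine Lp.ext ?_
  filter_upwards [coeFn_mulOp hg (mulOp μ h v), coeFn_mulOp hh v, coeFn_mulOp (hg.mul hh) v]
    with x h1 h2 h3
  rw [h1, h2, h3, mul_assoc]

lemma mulOp_sub {g h : α → ℂ} (hg : BddMeas g) (hh : BddMeas h) :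
    mulOp μ g - mulOp μ h = mulOp μ (fun x => g x - h x) := by
  ext1 v
  refine Lp.ext ?_
  rw [sub_apply]
  filter_upwards [Lp.coeFn_sub (mulOp μ g v) (mulOp μ h v), coeFn_mulOp hg v, coeFn_mulOp hh v,
    coeFn_mulOp (hg.sub hh) v] with x h0 h1 h2 h3
  rw [h0, Pi.sub_apply, h1, h2, h3, sub_mul]

end MulOp

/-! ### Strong integrals of operator families -/

section StrongInt
variable {α : Type*} [MeasurableSpace α] {E F : Type*}
  [NormedAddCommGroup E] [NormedSpace ℂ E] [NormedAddCommGroup F] [NormedSpace ℂ F]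

/-- A bounded, strongly measurable family of operators over a finite measure space. -/
def StronglyBdd (μ : Measure α) (V : α → E →L[ℂ] F) : Prop :=
  IsFiniteMeasure μ ∧ (∃ C : ℝ, ∀ a, ‖V a‖ ≤ C) ∧ ∀ ξ, AEStronglyMeasurable (fun a => V a ξ) μ

lemma StronglyBdd.integrable {μ : Measure α} {V : α → E →L[ℂ] F}
    (hV : StronglyBdd μ V) (ξ : E) : Integrable (fun a => V a ξ) μ := by
  have := hV.1
  obtain ⟨C, hC⟩ := hV.2.1
  exact Integrable.of_bound (hV.2.2 ξ) (C * ‖ξ‖)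
    (.of_forall fun a => (V a).le_of_opNorm_le (hC a) ξ)

open Classical in
/-- The operator `ξ ↦ ∫ V(a) ξ dμ(a)`. -/
def strongInt [CompleteSpace F] (μ : Measure α) (V : α → E →L[ℂ] F) : E →L[ℂ] F :=
  if hV : StronglyBdd μ V then
    LinearMap.mkContinuousOfExistsBound
      { toFun := fun ξ => ∫ a, V a ξ ∂μ
        map_add' := fun ξ η => by
          simp only [map_add]
          exact integral_add (hV.integrable ξ) (hV.integrable η)
        map_smul' := fun c ξ => by
          simp only [map_smul, RingHom.id_apply]
          exact integral_smul c _ }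
      (by
        have := hV.1
        obtain ⟨C, hC⟩ := hV.2.1
        refine ⟨C * μ.real univ, fun ξ => ?_⟩
        refine (norm_integral_le_of_norm_le_const
          (.of_forall fun a => (V a).le_of_opNorm_le (hC a) ξ)).trans (le_of_eq ?_)
        ring)
  else 0

lemma strongInt_apply [CompleteSpace F] {μ : Measure α} {V : α → E →L[ℂ] F}
    (hV : StronglyBdd μ V) (ξ : E) : strongInt μ V ξ = ∫ a, V a ξ ∂μ := by
  rw [strongInt, dif_pos hV]
  rfl

lemma norm_strongInt_le [CompleteSpace F] {μ : Measure α} {V : α → E →L[ℂ] F}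
    (hV : StronglyBdd μ V) {C : ℝ} (h0 : 0 ≤ C) (hC : ∀ᵐ a ∂μ, ‖V a‖ ≤ C) :
    ‖strongInt μ V‖ ≤ C * μ.real univ := by
  have := hV.1
  refine ContinuousLinearMap.opNorm_le_bound _ (by positivity) fun ξ => ?_
  rw [strongInt_apply hV]
  refine (norm_integral_le_of_norm_le_const
    (hC.mono fun a ha => (V a).le_of_opNorm_le ha ξ)).trans (le_of_eq ?_)
  ring

lemma StronglyBdd.comp_left {G : Type*} [NormedAddCommGroup G] [NormedSpace ℂ G] {μ : Measure α}
    {V : α → E →L[ℂ] F} (hV : StronglyBdd μ V) (L : F →L[ℂ] G) :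
    StronglyBdd μ fun a => L ∘L V a := by
  obtain ⟨C, hC⟩ := hV.2.1
  exact ⟨hV.1, ⟨‖L‖ * C, fun a => (L.opNorm_comp_le _).trans
    (mul_le_mul_of_nonneg_left (hC a) (norm_nonneg _))⟩,
    fun ξ => L.continuous.comp_aestronglyMeasurable (hV.2.2 ξ)⟩

lemma comp_strongInt [CompleteSpace F] {G : Type*} [NormedAddCommGroup G] [NormedSpace ℂ G]
    [CompleteSpace G] {μ : Measure α} {V : α → E →L[ℂ] F} (hV : StronglyBdd μ V)
    (L : F →L[ℂ] G) : L ∘L strongInt μ V = strongInt μ fun a => L ∘L V a := by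
  ext1 ξ
  rw [strongInt_apply (hV.comp_left L), ContinuousLinearMap.comp_apply, strongInt_apply hV,
    ← L.integral_comp_comm (hV.integrable ξ)]
  rfl

end StrongInt

/-! ### Vector valued integrals in `L²` are computed pointwise -/

section Pointwise
variable {α Z E : Type*} [MeasurableSpace α] [MeasurableSpace Z] [NormedAddCommGroup E]

/-- Hölder's inequality on a set of finite measure; it provides the local integrability that Fubini
needs in `coeFn_integral_Lp`. -/
lemma setIntegral_norm_le {ν : Measure Z} (v : Lp E 2 ν) {s : Set Z} (hs : ν s < ∞) :
    IntegrableOn v s ν ∧ ∫ z in s, ‖v z‖ ∂ν ≤ ‖v‖ * (ν s ^ (1 / 2 : ℝ)).toReal := by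
  have : IsFiniteMeasure (ν.restrict s) := ⟨by simpa using hs⟩
  have h2 : MemLp v 2 (ν.restrict s) := (Lp.memLp v).restrict s
  have h1 : MemLp v 1 (ν.restrict s) := h2.mono_exponent (by norm_num)
  refine ⟨memLp_one_iff_integrable.1 h1, ?_⟩
  rw [integral_norm_eq_lintegral_enorm h1.1, ← eLpNorm_one_eq_lintegral_enorm, Lp.norm_def,
    ← ENNReal.toReal_mul]
  refine ENNReal.toReal_mono
    (ENNReal.mul_ne_top (Lp.memLp v).2.ne (ENNReal.rpow_ne_top_of_nonneg (by norm_num) hs.ne)) ?_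
  refine (eLpNorm_le_eLpNorm_mul_rpow_measure_univ (p := 1) (q := 2) (by norm_num) h1.1).trans ?_
  rw [Measure.restrict_apply_univ]
  refine mul_le_mul' (eLpNorm_mono_measure _ Measure.restrict_le_self) (le_of_eq ?_)
  norm_num

/-- Both sides have the same integral over every set of finite measure: paired with a vector e, the
integral over s is the inner product with 1_s e, which commutes with the Bochner integral, and
Fubini handles the other side. The real structures `iE` and `iL` are arbitrary, so that the
statement fits whichever one the integrals carry. -/
theorem coeFn_integral_Lp [InnerProductSpace ℂ E] [CompleteSpace E] {μ : Measure α}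
    {ν : Measure Z} [SFinite μ] [SigmaFinite ν] {iE : NormedSpace ℝ E}
    {iL : NormedSpace ℝ (Lp E 2 ν)} {Φ : α → Lp E 2 ν} (hΦ : Integrable Φ μ) {Ψ : α → Z → E}
    (hΨ : AEStronglyMeasurable (Function.uncurry Ψ) (μ.prod ν))
    (h : ∀ᵐ a ∂μ, Φ a =ᵐ[ν] Ψ a) :
    (∫ a, Φ a ∂μ : Lp E 2 ν) =ᵐ[ν] fun z => ∫ a, Ψ a z ∂μ := by
  have key (s : Set Z) (hs' : ν s < ∞) :
      Integrable (Function.uncurry Ψ) (μ.prod (ν.restrict s)) := by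
    have hm : AEStronglyMeasurable (Function.uncurry Ψ) (μ.prod (ν.restrict s)) :=
      hΨ.mono_measure (Measure.prod_mono le_rfl Measure.restrict_le_self)
    rw [integrable_prod_iff hm]
    constructor
    · filter_upwards [h] with a ha
      exact (setIntegral_norm_le (Φ a) hs').1.congr (ae_restrict_of_ae ha)
    · refine (hΦ.norm.mul_const ((ν s ^ (1 / 2 : ℝ)).toReal)).mono' hm.norm.integral_prod_right' ?_
      filter_upwards [h] with a ha
      rw [Real.norm_of_nonneg (integral_nonneg fun z => norm_nonneg _)]
      refine le_trans (le_of_eq ?_) (setIntegral_norm_le (Φ a) hs').2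
      refine integral_congr_ae ?_
      filter_upwards [ae_restrict_of_ae ha] with z hz
      rw [hz]
      rfl
  refine ae_eq_of_forall_setIntegral_eq_of_sigmaFinite
    (fun s _ hs' => (setIntegral_norm_le _ hs').1)
    (fun s _ hs' => (key s hs').integral_prod_right) fun s hs hs' => ?_
  rw [← integral_integral_swap (key s hs')]
  refine ext_inner_left ℂ fun e => ?_
  rw [← L2.inner_indicatorConstLp_eq_inner_setIntegral ℂ hs hs'.ne e, ← integral_inner hΦ,
    ← integral_inner (f := fun a => ∫ z in s, Ψ a z ∂ν) (key s hs').integral_prod_left]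
  refine integral_congr_ae ?_
  filter_upwards [h] with a ha
  rw [L2.inner_indicatorConstLp_eq_inner_setIntegral ℂ hs hs'.ne e]
  congr 1
  exact integral_congr_ae (ae_restrict_of_ae ha)

theorem coeFn_strongInt [InnerProductSpace ℂ E] [CompleteSpace E] {μ : Measure α} {ν : Measure Z}
    [SigmaFinite ν] {iE : NormedSpace ℝ E} {H : Type*} [NormedAddCommGroup H] [NormedSpace ℂ H]
    {V : α → H →L[ℂ] Lp E 2 ν} (hV : StronglyBdd μ V) (ξ : H) {Ψ : α → Z → E}
    (hΨ : AEStronglyMeasurable (Function.uncurry Ψ) (μ.prod ν))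
    (h : ∀ᵐ a ∂μ, V a ξ =ᵐ[ν] Ψ a) :
    strongInt μ V ξ =ᵐ[ν] fun z => ∫ a, Ψ a z ∂μ := by
  have := hV.1
  rw [strongInt_apply hV]
  exact coeFn_integral_Lp (hV.integrable ξ) hΨ h

end Pointwise

/-! ### Compactness -/

section Compact

/-- The operator `η ↦ ∫ η(z) W(z) dz` of a square integrable vector valued kernel is compact. -/
theorem isCompactOperator_lpPairing {Z E : Type*} [MeasurableSpace Z] [NormedAddCommGroup E]
    [NormedSpace ℂ E] [CompleteSpace E] {ν : Measure Z} (W : Lp E 2 ν) :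
    IsCompactOperator
      (((ContinuousLinearMap.lsmul ℂ ℂ : ℂ →L[ℂ] E →L[ℂ] E).lpPairing ν 2 2).flip W) := by
  set B := ((ContinuousLinearMap.lsmul ℂ ℂ : ℂ →L[ℂ] E →L[ℂ] E).lpPairing ν 2 2).flip with hB
  refine Lp.induction (by norm_num) (fun W => IsCompactOperator (B W)) ?_ ?_ ?_ W
  -- For W = 1_s c the operator has rank one: it is η ↦ (∫_s η) c. Sums and limits of such operators
  -- stay compact.
  · intro c s hs hμs
    set ℓ := ((ContinuousLinearMap.lsmul ℂ ℂ : ℂ →L[ℂ] ℂ →L[ℂ] ℂ).lpPairing ν 2 2).flip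
      (indicatorConstLp 2 hs hμs.ne (1 : ℂ)) with hℓ
    have : B (Lp.simpleFunc.indicatorConst 2 hs hμs.ne c) =
        (ContinuousLinearMap.toSpanSingleton ℂ c).comp ℓ := by
      ext1 η
      rw [ContinuousLinearMap.comp_apply, ContinuousLinearMap.toSpanSingleton_apply, hB, hℓ,
        ContinuousLinearMap.flip_apply, ContinuousLinearMap.flip_apply,
        ContinuousLinearMap.lpPairing_eq_integral, ContinuousLinearMap.lpPairing_eq_integral,
        Lp.simpleFunc.coe_indicatorConst, ← integral_smul_const]
      refine integral_congr_ae ?_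
      filter_upwards [indicatorConstLp_coeFn (p := 2) (hs := hs) (hμs := hμs.ne) (c := c),
        indicatorConstLp_coeFn (p := 2) (hs := hs) (hμs := hμs.ne) (c := (1 : ℂ))] with z h1 h2
      rw [h1, h2]
      by_cases hz : z ∈ s <;> simp [hz]
    rw [this]
    have h1 : IsCompactOperator (ContinuousLinearMap.id ℂ ℂ) := by
      exact (isCompactOperator_id_iff_finiteDimensional (𝕜 := ℂ)).2 inferInstance
    exact (h1.comp_clm ℓ).clm_comp (ContinuousLinearMap.toSpanSingleton ℂ c)
  · intro f g hf hg _ h1 h2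
    rw [map_add]
    exact h1.add h2
  · exact isClosed_setOfPred_isCompactOperator.preimage B.continuous

/-- A bounded net of operators that converges strongly converges uniformly on compact sets, in
particular on the closure of the image of the unit ball under C. This converts the strong
Riemann-Lebesgue lemma into decay in norm. -/
theorem tendsto_norm_comp_of_isCompactOperator {ι E F H : Type*} [NormedAddCommGroup E]
    [NormedSpace ℂ E] [NormedAddCommGroup F] [NormedSpace ℂ F] [NormedAddCommGroup H]
    [NormedSpace ℂ H] {l : Filter ι} {N : ι → F →L[ℂ] H} {M : ℝ} (hN : ∀ i, ‖N i‖ ≤ M)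
    (h : ∀ x, Tendsto (fun i => N i x) l (𝓝 0)) {C : E →L[ℂ] F} (hC : IsCompactOperator C) :
    Tendsto (fun i => N i ∘L C) l (𝓝 0) := by
  -- The bound M could be 0, or negative when there is no index, so |M| + 1 is used for the radius
  -- of the cover.
  have hM : 0 < |M| + 1 := by positivity
  obtain ⟨K, hK, hsub⟩ := hC.image_closedBall_subset_compact 1
  rw [Metric.tendsto_nhds]
  intro η hη
  have hη' : 0 < η / 4 / (|M| + 1) := by positivity
  obtain ⟨t, -, ht, hcov⟩ := hK.finite_cover_balls hη'
  have h1 : ∀ᶠ i in l, ∀ x ∈ t, ‖N i x‖ < η / 4 := by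
    rw [ht.eventually_all]
    intro x _
    simpa using (Metric.tendsto_nhds.1 (h x)) (η / 4) (by positivity)
  filter_upwards [h1] with i hi
  rw [dist_zero_right]
  refine lt_of_le_of_lt (ContinuousLinearMap.opNorm_le_of_unit_norm (C := η / 2) (by positivity)
    fun x hx => ?_) (by linarith)
  have hx' : C x ∈ K := hsub ⟨x, by simp [hx], rfl⟩
  obtain ⟨y, hy, hxy⟩ := mem_iUnion₂.1 (hcov hx')
  rw [Metric.mem_ball, dist_eq_norm] at hxy
  have h2 : (N i ∘L C) x = N i (C x - y) + N i y := by simp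
  rw [h2]
  refine (norm_add_le _ _).trans ?_
  have h3 : ‖N i (C x - y)‖ ≤ (|M| + 1) * (η / 4 / (|M| + 1)) :=
    ((N i).le_of_opNorm_le ((hN i).trans ((le_abs_self M).trans (by linarith))) _).trans
      (mul_le_mul_of_nonneg_left hxy.le hM.le)
  rw [mul_div_cancel₀ _ hM.ne'] at h3
  linarith [hi y hy]

end Compact

/-! ### Orthogonal sums -/

section Orthogonal
variable {ι H : Type*} [NormedAddCommGroup H] [InnerProductSpace ℂ H]

lemma norm_sq_sum_of_orthogonal {w : ι → H} (ho : Pairwise fun i j => inner ℂ (w i) (w j) = 0)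
    (s : Finset ι) : ‖∑ i ∈ s, w i‖ ^ 2 = ∑ i ∈ s, ‖w i‖ ^ 2 := by
  classical
  induction s using Finset.induction_on with
  | empty => simp
  | insert a s ha ih =>
    rw [Finset.sum_insert ha, Finset.sum_insert ha, ← ih, sq, sq, sq]
    refine norm_add_sq_eq_norm_sq_add_norm_sq_of_inner_eq_zero (𝕜 := ℂ) _ _ ?_
    rw [inner_sum]
    exact Finset.sum_eq_zero fun i hi => ho (by rintro rfl; exact ha hi)

/-- By Pythagoras the Cauchy criterion for w is the one for the series of the squared norms. -/
lemma summable_of_orthogonal [CompleteSpace H] {w : ι → H}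
    (ho : Pairwise fun i j => inner ℂ (w i) (w j) = 0) (hs : Summable fun i => ‖w i‖ ^ 2) :
    Summable w := by
  rw [summable_iff_vanishing_norm] at hs ⊢
  intro ε hε
  obtain ⟨s, hs⟩ := hs (ε ^ 2) (by positivity)
  refine ⟨s, fun t ht => ?_⟩
  have := hs t ht
  rw [← norm_sq_sum_of_orthogonal ho, Real.norm_of_nonneg (by positivity)] at this
  exact lt_of_pow_lt_pow_left₀ 2 hε.le this

lemma norm_tsum_le_of_orthogonal [CompleteSpace H] {w : ι → H}
    (ho : Pairwise fun i j => inner ℂ (w i) (w j) = 0) (hs : Summable fun i => ‖w i‖ ^ 2) {B : ℝ}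
    (hB : 0 ≤ B) (hle : ∑' i, ‖w i‖ ^ 2 ≤ B ^ 2) : ‖∑' i, w i‖ ≤ B := by
  refine le_of_tendsto (summable_of_orthogonal ho hs).hasSum.norm (.of_forall fun s => ?_)
  refine le_of_sq_le_sq ?_ hB
  rw [norm_sq_sum_of_orthogonal ho]
  exact (hs.sum_le_tsum s fun i _ => by positivity).trans hle

end Orthogonal

/-! ### The Fourier transform on `L²(ℝ; L²(ℝ²))` -/

section Fourier
open FourierTransform SchwartzMap
variable {F : Type*} [NormedAddCommGroup F] [InnerProductSpace ℂ F]

/-- Translation by `u` on `L²(ℝ; F)`. -/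
def shiftLp (u : ℝ) : Lp F 2 (volume : Measure ℝ) →ₗᵢ[ℂ] Lp F 2 (volume : Measure ℝ) :=
  Lp.compMeasurePreservingₗᵢ ℂ (fun y => y - u) (measurePreserving_sub_right volume u)

lemma coeFn_shiftLp (u : ℝ) (f : Lp F 2 (volume : Measure ℝ)) :
    shiftLp u f =ᵐ[volume] fun y => f (y - u) :=
  Lp.coeFn_compMeasurePreserving f (measurePreserving_sub_right volume u)

/-- Multiplication by the character `b ↦ e^{-2πi b u}` on `L²(ℝ; F)`. -/
def modLp (u : ℝ) : Lp F 2 (volume : Measure ℝ) →L[ℂ] Lp F 2 (volume : Measure ℝ) :=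
  (ContinuousLinearMap.lsmul ℂ ℂ : ℂ →L[ℂ] F →L[ℂ] F).holderL volume ∞ 2 2
    (MemLp.toLp (fun b : ℝ => (Real.fourierChar (-(b * u)) : ℂ))
      (memLp_top_of_bound (Continuous.aestronglyMeasurable (by fun_prop)) 1
        (.of_forall fun b => (Circle.norm_coe _).le)))

lemma coeFn_modLp (u : ℝ) (f : Lp F 2 (volume : Measure ℝ)) :
    modLp u f =ᵐ[volume] fun b => (Real.fourierChar (-(b * u)) : ℂ) • f b := by
  have hm : MemLp (fun b : ℝ => (Real.fourierChar (-(b * u)) : ℂ)) ∞ volume :=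
    memLp_top_of_bound (Continuous.aestronglyMeasurable (by fun_prop)) 1
        (.of_forall fun b => (Circle.norm_coe _).le)
  have h := (ContinuousLinearMap.lsmul ℂ ℂ : ℂ →L[ℂ] F →L[ℂ] F).coeFn_holder (r := 2)
    hm.toLp f
  filter_upwards [h, hm.coeFn_toLp] with b h1 h2
  refine h1.trans ?_
  rw [h2]
  rfl

/-- Both sides are continuous in f, and for Schwartz functions A commutes with the Fourier integral.
This makes operators on the fibre L²(ℝ²) commute with the Fourier transform in y. -/
lemma fourier_compLpL [CompleteSpace F] (A : F →L[ℂ] F) (f : Lp F 2 (volume : Measure ℝ)) :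
    Lp.fourierTransformₗᵢ ℝ F (A.compLpL 2 volume f) =
      A.compLpL 2 volume (Lp.fourierTransformₗᵢ ℝ F f) := by
  refine DenseRange.induction_on (p := fun f : Lp F 2 (volume : Measure ℝ) =>
    Lp.fourierTransformₗᵢ ℝ F (A.compLpL 2 volume f) =
      A.compLpL 2 volume (Lp.fourierTransformₗᵢ ℝ F f))
    (SchwartzMap.denseRange_toLpCLM (p := 2) ENNReal.ofNat_ne_top) f
    (isClosed_eq (by fun_prop) (by fun_prop)) fun φ => ?_
  have h1 : A.compLpL 2 volume (φ.toLp 2) = (SchwartzMap.postcompCLM A φ).toLp 2 := by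
    refine Lp.ext ?_
    filter_upwards [A.coeFn_compLpL (φ.toLp 2 volume), φ.coeFn_toLp 2,
      (SchwartzMap.postcompCLM A φ).coeFn_toLp 2] with x k1 k2 k3
    rw [k1, k2, k3]
    rfl
  have h2 (ψ : 𝓢(ℝ, F)) : Lp.fourierTransformₗᵢ ℝ F (ψ.toLp 2) = (𝓕 ψ : 𝓢(ℝ, F)).toLp 2 :=
    SchwartzMap.toLp_fourier_eq ψ
  change Lp.fourierTransformₗᵢ ℝ F (A.compLpL 2 volume (φ.toLp 2)) =
    A.compLpL 2 volume (Lp.fourierTransformₗᵢ ℝ F (φ.toLp 2))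
  rw [h1, h2, h2]
  refine Lp.ext ?_
  filter_upwards [A.coeFn_compLpL ((𝓕 φ : 𝓢(ℝ, F)).toLp 2 volume), (𝓕 φ : 𝓢(ℝ, F)).coeFn_toLp 2,
      (𝓕 (SchwartzMap.postcompCLM A φ) : 𝓢(ℝ, F)).coeFn_toLp 2] with x k1 k2 k3
  rw [k1, k2, k3, SchwartzMap.fourier_coe, SchwartzMap.fourier_coe, Real.fourier_eq,
    Real.fourier_eq, ← ContinuousLinearMap.integral_comp_comm A]
  · refine integral_congr_ae (.of_forall fun v => ?_)
    change _ • A (φ v) = A (_ • φ v)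
    rw [Circle.smul_def, Circle.smul_def, map_smul]
  · exact (Real.fourierIntegral_convergent_iff x).2 φ.integrable

/-- Again by density of the Schwartz functions, where the substitution v ↦ v + u produces the
character. -/
lemma fourier_shift [CompleteSpace F] (u : ℝ) (f : Lp F 2 (volume : Measure ℝ)) :
    Lp.fourierTransformₗᵢ ℝ F (shiftLp u f) =
      modLp u (Lp.fourierTransformₗᵢ ℝ F f) := by
  refine DenseRange.induction_on (p := fun f : Lp F 2 (volume : Measure ℝ) =>
    Lp.fourierTransformₗᵢ ℝ F (shiftLp u f) = modLp u (Lp.fourierTransformₗᵢ ℝ F f))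
    (SchwartzMap.denseRange_toLpCLM (p := 2) ENNReal.ofNat_ne_top) f
    (isClosed_eq (by fun_prop) (by fun_prop)) fun φ => ?_
  have h1 : shiftLp u (φ.toLp 2) = (φ.compSubConstCLM ℂ u).toLp 2 := by
    refine Lp.ext ?_
    filter_upwards [coeFn_shiftLp u (φ.toLp 2 volume),
      (measurePreserving_sub_right volume u).quasiMeasurePreserving.ae
        (φ.coeFn_toLp 2 volume),
      (φ.compSubConstCLM ℂ u).coeFn_toLp 2] with x k1 k2 k3
    rw [k1, k2, k3]
    rfl
  have h2 (ψ : 𝓢(ℝ, F)) : Lp.fourierTransformₗᵢ ℝ F (ψ.toLp 2) = (𝓕 ψ : 𝓢(ℝ, F)).toLp 2 :=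
    SchwartzMap.toLp_fourier_eq ψ
  change Lp.fourierTransformₗᵢ ℝ F (shiftLp u (φ.toLp 2)) =
    modLp u (Lp.fourierTransformₗᵢ ℝ F (φ.toLp 2))
  rw [h1, h2, h2]
  refine Lp.ext ?_
  filter_upwards [coeFn_modLp u ((𝓕 φ : 𝓢(ℝ, F)).toLp 2 volume), (𝓕 φ : 𝓢(ℝ, F)).coeFn_toLp 2,
      (𝓕 (φ.compSubConstCLM ℂ u) : 𝓢(ℝ, F)).coeFn_toLp 2] with b k1 k2 k3
  rw [k1, k2, k3, SchwartzMap.fourier_coe, SchwartzMap.fourier_coe, Real.fourier_real_eq,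
    Real.fourier_real_eq, ← integral_smul,
    ← integral_add_right_eq_self (fun v => _ • (φ.compSubConstCLM ℂ u) v) u]
  refine integral_congr_ae (.of_forall fun v => ?_)
  change Real.fourierChar (-((v + u) * b)) • φ (v + u - u) = _ • Real.fourierChar (-(v * b)) • φ v
  rw [add_sub_cancel_right, Circle.smul_def, Circle.smul_def, smul_smul,
    show -((v + u) * b) = -(b * u) + -(v * b) by ring, AddChar.map_add_eq_mul]
  rfl

end Fourier

/-! ### The transformations of `L²(ℝ²)` -/

/-- `η ↦ η(· - a)` on `L²(ℝ²)`. -/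
def shiftZ (a : ℝ × ℝ) : L2Z →ₗᵢ[ℂ] L2Z :=
  Lp.compMeasurePreservingₗᵢ ℂ (fun z => z - a) (measurePreserving_sub_right volume a)

lemma coeFn_shiftZ (a : ℝ × ℝ) (f : L2Z) : shiftZ a f =ᵐ[volume] fun y => f (y - a) :=
  Lp.coeFn_compMeasurePreserving f (measurePreserving_sub_right volume a)

lemma continuous_shiftZ : Continuous fun w : (ℝ × ℝ) × L2Z => shiftZ w.1 w.2 := by
  have : ((volume : Measure (ℝ × ℝ))).InnerRegularCompactLTTop := inferInstance
  let c : (ℝ × ℝ) × L2Z → C(ℝ × ℝ, ℝ × ℝ) := fun w => ⟨fun z => z - w.1, by fun_prop⟩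
  have hc : Continuous c :=
    ContinuousMap.continuous_of_continuous_uncurry _ (by
      change Continuous fun z : ((ℝ × ℝ) × L2Z) × (ℝ × ℝ) => z.2 - z.1.1
      fun_prop)
  exact continuous_snd.compMeasurePreservingLp hc
    (fun w => measurePreserving_sub_right volume w.1) (by norm_num)

lemma map_dil (u : ℝ) : Measure.map (fun z : ℝ × ℝ => (z.1, Real.exp (-u) * z.2)) volume =
    ENNReal.ofReal (Real.exp u) • (volume : Measure (ℝ × ℝ)) := by
  have h := Measure.map_prod_map (volume : Measure ℝ) (volume : Measure ℝ) measurable_id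
    (measurable_const_mul (Real.exp (-u)))
  have hu : |(Real.exp (-u))⁻¹| = Real.exp u := by
    rw [abs_of_pos (inv_pos.2 (Real.exp_pos _)), Real.exp_neg, inv_inv]
  rw [Real.map_volume_mul_left (Real.exp_ne_zero _), Measure.map_id, Measure.prod_smul_right,
    hu] at h
  exact h.symm.trans rfl

lemma quasiMeasurePreserving_dil (u : ℝ) :
    Measure.QuasiMeasurePreserving (fun z : ℝ × ℝ => (z.1, Real.exp (-u) * z.2)) := by
  refine ⟨by fun_prop, ?_⟩
  rw [map_dil]
  exact Measure.smul_absolutelyContinuous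

lemma eLpNorm_dil (u : ℝ) (η : L2Z) :
    eLpNorm (fun z : ℝ × ℝ => ((Real.exp (-(u / 2)) : ℝ) : ℂ) * η (z.1, Real.exp (-u) * z.2)) 2
      volume = eLpNorm η 2 volume := by
  have h1 : eLpNorm (fun z : ℝ × ℝ => η (z.1, Real.exp (-u) * z.2)) 2 volume =
      ENNReal.ofReal (Real.exp (u / 2)) * eLpNorm η 2 volume := by
    have h2 := eLpNorm_map_measure (p := 2) (f := fun z : ℝ × ℝ => (z.1, Real.exp (-u) * z.2))
      (μ := volume) (g := η)
      (by rw [map_dil]; exact (Lp.aestronglyMeasurable η).smul_measure _) (by fun_prop)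
    rw [map_dil, eLpNorm_smul_measure_of_ne_top (by norm_num)] at h2
    refine h2.symm.trans ?_
    rw [smul_eq_mul, ENNReal.ofReal_rpow_of_pos (Real.exp_pos _), ← Real.exp_mul]
    norm_num
    congr 3
    ring
  have h3 := eLpNorm_const_smul ((Real.exp (-(u / 2)) : ℝ) : ℂ)
    (fun z : ℝ × ℝ => η (z.1, Real.exp (-u) * z.2)) 2 volume
  refine h3.trans ?_
  rw [h1, ← mul_assoc, ← ofReal_norm, Complex.norm_real, Real.norm_of_nonneg (Real.exp_nonneg _),
    ← ENNReal.ofReal_mul (Real.exp_nonneg _), ← Real.exp_add]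
  simp

lemma memLp_dil (u : ℝ) (η : L2Z) :
    MemLp (fun z : ℝ × ℝ => ((Real.exp (-(u / 2)) : ℝ) : ℂ) * η (z.1, Real.exp (-u) * z.2)) 2
      volume :=
  ⟨aestronglyMeasurable_const.mul
    ((Lp.aestronglyMeasurable η).comp_quasiMeasurePreserving (quasiMeasurePreserving_dil u)),
    by rw [eLpNorm_dil]; exact (Lp.memLp η).2⟩

/-- The unitary dilation `η ↦ ((x, p) ↦ e^{-u/2} η(x, e^{-u} p))` of `L²(ℝ²)`. -/
def dil (u : ℝ) : L2Z →ₗᵢ[ℂ] L2Z where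
  toFun η := (memLp_dil u η).toLp
  map_add' ξ η := by
    rw [← MemLp.toLp_add]
    refine MemLp.toLp_congr _ _ ?_
    filter_upwards [(quasiMeasurePreserving_dil u).ae (Lp.coeFn_add ξ η)] with w hw
    rw [hw, Pi.add_apply, Pi.add_apply, mul_add]
  map_smul' c ξ := by
    rw [RingHom.id_apply, ← MemLp.toLp_const_smul]
    refine MemLp.toLp_congr _ _ ?_
    filter_upwards [(quasiMeasurePreserving_dil u).ae (Lp.coeFn_smul c ξ)] with w hw
    rw [hw, Pi.smul_apply, Pi.smul_apply, smul_eq_mul, smul_eq_mul, mul_left_comm]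
  norm_map' ξ := by
    change ‖(memLp_dil u ξ).toLp‖ = _
    rw [Lp.norm_toLp, Lp.norm_def, eLpNorm_dil]

lemma coeFn_dil (u : ℝ) (η : L2Z) : dil u η =ᵐ[volume] fun z : ℝ × ℝ =>
    ((Real.exp (-(u / 2)) : ℝ) : ℂ) * η (z.1, Real.exp (-u) * z.2) :=
  (memLp_dil u η).coeFn_toLp

/-! ### Left translations of `G₀` -/

/-- Left translation by `h ∈ G₀` on `L²(G₀)`. -/
def trans (h : G0) : L2G0 →ₗᵢ[ℂ] L2G0 := indOp 0 (G6.mk h 0)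

lemma coeFn_trans (h : G0) (ξ : L2G0) : trans h ξ =ᵐ[volume] fun k => ξ (h⁻¹ * k) := by
  filter_upwards [coeFn_indOp 0 (G6.mk h 0) ξ] with k hk
  refine hk.trans ?_
  simp [equivariantExt, chi, pairing]

/-- The translations are the operators of the representation induced from the trivial character, so
strong continuity comes from `continuous_indOp`. -/
lemma continuous_trans (ξ : L2G0) : Continuous fun h => trans h ξ :=
  (continuous_indOp 0 ξ).comp (show Continuous fun h : G0 => G6.mk h 0 from
    Continuous.prodMk (X := G0) (Y := ℝ × ℝ × ℝ) continuous_id continuous_const)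

/-! ### Coordinates on G₀/exp(ℝY) and surjectivity of the intertwiner. -/

/-- `(x, e^y p)`, the coordinates of `k exp(ℝY)` in `G₀ / exp(ℝY)`. -/
def zpol (k : G0) : ℝ × ℝ := (k.x, Real.exp k.y * k.p)

lemma continuous_zpol : Continuous zpol := by unfold zpol; fun_prop

@[simp] lemma zpol_polar (w : ℝ × (ℝ × ℝ)) : zpol (polar w) = w.2 := by
  ext
  · simp [zpol, polar]
  · simp [zpol, polar, ← mul_assoc, ← Real.exp_add]

lemma coeFn_polarL2 (ξ : L2G0) : polarL2 ξ =ᵐ[volume] polarFun ξ :=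
  (memLp_polarFun ξ).coeFn_toLp

lemma coeFn_curryL2 (f : Lp ℂ 2 (volume : Measure (ℝ × (ℝ × ℝ)))) :
    ∀ᵐ y : ℝ, curryL2 f y =ᵐ[volume] fun z => f (y, z) := by
  have h : curryL2 f =ᵐ[volume] slice f := (memLp_slice (Lp.memLp f)).coeFn_toLp
  filter_upwards [h, coeFn_slice (Lp.memLp f)] with y h1 h2
  rw [h1]
  exact h2

lemma ae_curryL2_congr {f : Lp ℂ 2 (volume : Measure (ℝ × (ℝ × ℝ)))} {F : ℝ × (ℝ × ℝ) → ℂ}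
    (h : f =ᵐ[volume] F) : ∀ᵐ y : ℝ, curryL2 f y =ᵐ[volume] fun z => F (y, z) := by
  have h' : ∀ᵐ y : ℝ, ∀ᵐ z : ℝ × ℝ, f (y, z) = F (y, z) := Measure.ae_ae_of_ae_prod h
  filter_upwards [coeFn_curryL2 f, h'] with y h1 h2
  exact h1.trans h2

/-- The range of an isometry is closed, and it contains every 1_s c as the image of the function
1_s(y) c(z); these span a dense subspace. -/
lemma surjective_curryL2 : Function.Surjective curryL2 := by
  have hcl : IsClosed (range curryL2) := curryL2.isometry.isClosedEmbedding.isClosed_range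
  intro ζ
  refine Lp.induction (by norm_num) (fun ζ : Htau => ζ ∈ range curryL2) ?_ ?_ hcl ζ
  · intro c s hs hμs
    have hm : MemLp (fun w : ℝ × (ℝ × ℝ) => s.indicator (1 : ℝ → ℂ) w.1 * c w.2) 2
        (volume : Measure (ℝ × (ℝ × ℝ))) := by
      have h1 : AEStronglyMeasurable
          (fun w : ℝ × (ℝ × ℝ) => s.indicator (1 : ℝ → ℂ) w.1 * c w.2) volume := by
        refine AEStronglyMeasurable.mul ?_ ?_
        · exact ((measurable_one.indicator hs).comp measurable_fst).aestronglyMeasurable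
        · exact ((Lp.stronglyMeasurable c).comp_measurable measurable_snd).aestronglyMeasurable
      refine ⟨h1, ?_⟩
      rw [eLpNorm_lt_top_iff_lintegral_rpow_enorm_lt_top (by norm_num) (by norm_num)]
      have h2 : ∫⁻ w : ℝ × (ℝ × ℝ), ‖s.indicator (1 : ℝ → ℂ) w.1 * c w.2‖ₑ ^ (2 : ℝ≥0∞).toReal =
          (∫⁻ y : ℝ, ‖s.indicator (1 : ℝ → ℂ) y‖ₑ ^ (2 : ℝ≥0∞).toReal) *
            ∫⁻ z : ℝ × ℝ, ‖c z‖ₑ ^ (2 : ℝ≥0∞).toReal := by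
        rw [← lintegral_prod_mul]
        · refine lintegral_congr fun w => ?_
          rw [enorm_mul, ENNReal.mul_rpow_of_nonneg _ _ (by norm_num)]
        · exact ((measurable_one.indicator hs).enorm.pow_const _).aemeasurable
        · exact ((Lp.stronglyMeasurable c).enorm.pow_const _).aemeasurable
      rw [h2]
      refine ENNReal.mul_lt_top ?_ ?_
      · have := (memLp_indicator_const 2 hs (1 : ℂ) (μ := volume) (Or.inr hμs.ne)).2
        rw [eLpNorm_lt_top_iff_lintegral_rpow_enorm_lt_top (by norm_num) (by norm_num)] at this
        exact this
      · have := (Lp.memLp c).2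
        rwa [eLpNorm_lt_top_iff_lintegral_rpow_enorm_lt_top (by norm_num) (by norm_num)] at this
    refine ⟨hm.toLp, Lp.ext ?_⟩
    rw [Lp.simpleFunc.coe_indicatorConst]
    filter_upwards [ae_curryL2_congr hm.coeFn_toLp,
      indicatorConstLp_coeFn (p := 2) (hs := hs) (hμs := hμs.ne) (c := c)] with y h1 h2
    rw [h2]
    refine Lp.ext ?_
    by_cases hy : y ∈ s
    · rw [indicator_of_mem hy]
      filter_upwards [h1] with z hz
      rw [hz, indicator_of_mem hy, Pi.one_apply, one_mul]
    · rw [indicator_of_notMem hy]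
      filter_upwards [h1, Lp.coeFn_zero ℂ 2 (volume : Measure (ℝ × ℝ))] with z hz h0
      rw [hz, h0, indicator_of_notMem hy, zero_mul, Pi.zero_apply]
  · rintro f g hf hg - ⟨f', hf'⟩ ⟨g', hg'⟩
    exact ⟨f' + g', by rw [map_add, hf', hg']⟩

lemma surjective_polarL2 : Function.Surjective polarL2 := by
  intro f
  -- The preimage inverts `polarFun`: the y-coordinate of `polar w` is the first component of w,
  -- `zpol` recovers the remaining ones, and e^{y/2} cancels the weight.
  set f₀ := fun k : G0 => ((Real.exp (k.y / 2) : ℝ) : ℂ) * f (k.y, zpol k) with hf₀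
  have hm : StronglyMeasurable f₀ := by
    refine StronglyMeasurable.mul (Continuous.stronglyMeasurable (by fun_prop)) ?_
    have hc : Continuous fun k : G0 => (k.y, zpol k) :=
      G0.continuous_y.prodMk continuous_zpol
    exact (Lp.stronglyMeasurable f).comp_measurable hc.measurable
  have he (w : ℝ × (ℝ × ℝ)) : ((Real.exp (-(w.1 / 2)) : ℝ) : ℂ) * f₀ (polar w) = f w := by
    have hy : (polar w).y = w.1 := by simp [polar]
    rw [hf₀]
    simp only [zpol_polar, hy]
    rw [← mul_assoc, ← Complex.ofReal_mul, ← Real.exp_add]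
    simp
  clear_value f₀
  have hL : MemLp f₀ 2 volume := by
    refine ⟨hm.aestronglyMeasurable, ?_⟩
    have := (Lp.memLp f).2
    rw [eLpNorm_lt_top_iff_lintegral_rpow_enorm_lt_top (by norm_num) (by norm_num)] at this ⊢
    rw [← lintegral_polar _ (hm.enorm.pow_const _)]
    refine lt_of_le_of_lt (le_of_eq (lintegral_congr fun w => ?_)) this
    rw [← he w, enorm_mul, ENNReal.mul_rpow_of_nonneg _ _ (by norm_num)]
    congr 1
    rw [← ofReal_norm, Complex.norm_real, Real.norm_of_nonneg (Real.exp_nonneg _),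
      ENNReal.ofReal_rpow_of_pos (Real.exp_pos _), ← Real.exp_mul]
    congr 2
    norm_num
  refine ⟨hL.toLp, Lp.ext ?_⟩
  filter_upwards [coeFn_polarL2 hL.toLp, quasiMeasurePreserving_polar.ae hL.coeFn_toLp]
    with w h1 h2
  rw [h1, polarFun, h2, he]

lemma surjective_intertwiner : Function.Surjective intertwiner :=
  (Lp.fourierTransformₗᵢ ℝ L2Z).surjective.comp (surjective_curryL2.comp surjective_polarL2)

/-! ### Translations and multipliers of G₀ on the fibres. -/

/-- U is an isometry, so U*U = 1. As U is also surjective, `rho T` can be studied entirely through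
this identity, without computing U*. -/
lemma rho_intertwiner (T : L2G0 →L[ℂ] L2G0) (ξ : L2G0) :
    rho T (intertwiner ξ) = intertwiner (T ξ) := by
  have h := (ContinuousLinearMap.norm_map_iff_adjoint_comp_self
    intertwiner.toContinuousLinearMap).1 intertwiner.norm_map
  have h2 := DFunLike.congr_fun h ξ
  change intertwiner (T ((ContinuousLinearMap.adjoint intertwiner.toContinuousLinearMap ∘L
    intertwiner.toContinuousLinearMap) ξ)) = _
  rw [h2]
  rfl

lemma norm_rho_le (T : L2G0 →L[ℂ] L2G0) : ‖rho T‖ ≤ ‖T‖ := by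
  refine ContinuousLinearMap.opNorm_le_bound _ (norm_nonneg _) fun ζ => ?_
  obtain ⟨ξ, rfl⟩ := surjective_intertwiner ζ
  rw [rho_intertwiner, intertwiner.norm_map, intertwiner.norm_map]
  exact T.le_opNorm ξ

lemma rho_add (S T : L2G0 →L[ℂ] L2G0) : rho (S + T) = rho S + rho T := by
  simp [rho, ContinuousLinearMap.comp_add, ContinuousLinearMap.add_comp]

lemma rho_smul (c : ℂ) (T : L2G0 →L[ℂ] L2G0) : rho (c • T) = c • rho T := by
  simp [rho, ContinuousLinearMap.smul_comp]

/-- The action of `h ∈ G₀` on the fibres `L²(ℝ²)`, up to the character `e^{-2πi b y}`. -/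
def fibAct (h : G0) : L2Z →ₗᵢ[ℂ] L2Z := (dil h.y).comp (shiftZ (h.x, h.p))

/-- Left multiplication by h⁻¹ shifts the fibre coordinate y by h.y and acts on z = (x, e^y p) by p
↦ e^{-h.y} p followed by the translation by (h.x, h.p). The weight e^{-y/2} splits into the unitary
factor of the dilation and the weight at y - h.y. -/
lemma curryL2_polarL2_trans (h : G0) (ξ : L2G0) :
    curryL2 (polarL2 (trans h ξ)) =
      (fibAct h).toContinuousLinearMap.compLpL 2 volume
        (shiftLp h.y (curryL2 (polarL2 ξ))) := by
  refine Lp.ext ?_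
  have h1 : polarL2 (trans h ξ) =ᵐ[volume] fun w => ((Real.exp (-(w.1 / 2)) : ℝ) : ℂ) *
      ξ (h⁻¹ * polar w) := by
    filter_upwards [coeFn_polarL2 (trans h ξ), quasiMeasurePreserving_polar.ae (coeFn_trans h ξ)]
      with w h1 h2
    rw [h1, polarFun, h2]
  have h2 := (measurePreserving_sub_right volume h.y).quasiMeasurePreserving.ae
    (ae_curryL2_congr (coeFn_polarL2 ξ))
  filter_upwards [ae_curryL2_congr h1, h2,
    (fibAct h).toContinuousLinearMap.coeFn_compLpL (shiftLp h.y (curryL2 (polarL2 ξ))),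
    coeFn_shiftLp h.y (curryL2 (polarL2 ξ))] with y k1 k2 k3 k4
  rw [k3, k4]
  refine Lp.ext ?_
  set η := curryL2 (polarL2 ξ) (y - h.y) with hη
  have q1 := (quasiMeasurePreserving_dil h.y).ae (coeFn_shiftZ (h.x, h.p) η)
  have q2 := (quasiMeasurePreserving_dil h.y).ae
    ((measurePreserving_sub_right volume (h.x, h.p)).quasiMeasurePreserving.ae k2)
  filter_upwards [k1, coeFn_dil h.y (shiftZ (h.x, h.p) η), q1, q2] with z e1 e2 e3 e4
  rw [e1]
  refine Eq.trans ?_ e2.symm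
  rw [e3, e4, polarFun, ← mul_assoc, ← Complex.ofReal_mul, ← Real.exp_add]
  congr 2
  · congr 2
    ring
  · have : h⁻¹ * polar (y, z) =
        polar (y - h.y, (z.1, Real.exp (-h.y) * z.2) - (h.x, h.p)) := by
      ext
      · simp [polar]; ring
      · simp [polar]; ring
      · simp only [polar, G0.p_mul, G0.p_inv, G0.y_mul, G0.y_mk, G0.p_mk, zero_add, add_zero,
          Prod.snd_sub, neg_sub, Real.exp_sub, Real.exp_neg]
        field_simp
        ring
    rw [this]

lemma intertwiner_trans (h : G0) (ξ : L2G0) :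
    intertwiner (trans h ξ) =ᵐ[volume]
      fun b => (Real.fourierChar (-(b * h.y)) : ℂ) • fibAct h (intertwiner ξ b) := by
  have h1 : intertwiner (trans h ξ) = (fibAct h).toContinuousLinearMap.compLpL 2 volume
      (modLp h.y (intertwiner ξ)) := by
    change Lp.fourierTransformₗᵢ ℝ L2Z (curryL2 (polarL2 (trans h ξ))) = _
    rw [curryL2_polarL2_trans, fourier_compLpL, fourier_shift]
    rfl
  rw [h1]
  filter_upwards [(fibAct h).toContinuousLinearMap.coeFn_compLpL (modLp h.y (intertwiner ξ)),
    coeFn_modLp h.y (intertwiner ξ)] with b k1 k2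
  rw [k1, k2, map_smul]
  rfl

/-- A multiplier that is constant along the fibres exp(ℝY) acts by the same operator for every y,
and therefore commutes with the Fourier transform in y. -/
lemma intertwiner_mulOp {g : ℝ × ℝ → ℂ} (hg : BddMeas g) (ξ : L2G0) :
    intertwiner (mulOp volume (fun k => g (zpol k)) ξ) =ᵐ[volume]
      fun b => mulOp volume g (intertwiner ξ b) := by
  have hg' : BddMeas fun k => g (zpol k) := hg.comp continuous_zpol.measurable
  have h0 : curryL2 (polarL2 (mulOp volume (fun k => g (zpol k)) ξ)) =
      (mulOp volume g).compLpL 2 volume (curryL2 (polarL2 ξ)) := by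
    refine Lp.ext ?_
    have h1 : polarL2 (mulOp volume (fun k => g (zpol k)) ξ) =ᵐ[volume]
        fun w => g w.2 * polarFun ξ w := by
      filter_upwards [coeFn_polarL2 (mulOp volume (fun k => g (zpol k)) ξ),
        quasiMeasurePreserving_polar.ae (coeFn_mulOp hg' ξ)] with w h1 h2
      rw [h1, polarFun, h2, polarFun, zpol_polar, mul_left_comm]
    filter_upwards [ae_curryL2_congr h1, ae_curryL2_congr (coeFn_polarL2 ξ),
      (mulOp volume g).coeFn_compLpL (curryL2 (polarL2 ξ))] with y k1 k2 k3
    rw [k3]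
    refine Lp.ext ?_
    filter_upwards [k1, k2, coeFn_mulOp hg (curryL2 (polarL2 ξ) y)] with z e1 e2 e3
    rw [e1, e3, e2]
  have h1 : intertwiner (mulOp volume (fun k => g (zpol k)) ξ) =
      (mulOp volume g).compLpL 2 volume (intertwiner ξ) := by
    change Lp.fourierTransformₗᵢ ℝ L2Z (curryL2 (polarL2 _)) = _
    rw [h0, fourier_compLpL]
    rfl
  rw [h1]
  exact (mulOp volume g).coeFn_compLpL (intertwiner ξ)

/-! ### Strong continuity of the dilations -/

lemma continuous_shiftLp {F : Type*} [NormedAddCommGroup F] [InnerProductSpace ℂ F]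
    (ζ : Lp F 2 (volume : Measure ℝ)) : Continuous fun u => shiftLp u ζ := by
  let c : ℝ → C(ℝ, ℝ) := fun u => ⟨fun z => z - u, by fun_prop⟩
  have hc : Continuous c :=
    ContinuousMap.continuous_of_continuous_uncurry _ (by
      change Continuous fun z : ℝ × ℝ => z.2 - z.1
      fun_prop)
  exact continuous_const.compMeasurePreservingLp hc
    (fun u => measurePreserving_sub_right volume u) (by norm_num)

/-- Strong continuity is joint continuity here, because the operators are equicontinuous. -/
lemma continuous_isometry_apply {X E F : Type*} [TopologicalSpace X] [NormedAddCommGroup E]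
    [NormedSpace ℂ E] [NormedAddCommGroup F] [NormedSpace ℂ F] {V : X → E →ₗᵢ[ℂ] F}
    (hV : ∀ ξ, Continuous fun x => V x ξ) :
    Continuous fun w : X × E => V w.1 w.2 := by
  rw [continuous_iff_continuousAt]
  rintro ⟨x₀, ξ₀⟩
  have h1 : Tendsto (fun w : X × E => V w.1 (w.2 - ξ₀)) (𝓝 (x₀, ξ₀)) (𝓝 0) := by
    rw [tendsto_zero_iff_norm_tendsto_zero]
    simp only [LinearIsometry.norm_map]
    have : Continuous fun w : X × E => ‖w.2 - ξ₀‖ := by fun_prop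
    simpa using this.tendsto (x₀, ξ₀)
  have h2 : Tendsto (fun w : X × E => V w.1 ξ₀) (𝓝 (x₀, ξ₀)) (𝓝 (V x₀ ξ₀)) :=
    ((hV ξ₀).comp continuous_fst).tendsto (x₀, ξ₀)
  have := h1.add h2
  simp only [map_sub, sub_add_cancel, zero_add] at this
  exact this

/-- `L²(G₀)` as `L²(ℝ; L²(ℝ²))`, in the coordinates given by `polar`. -/
def fibration : L2G0 ≃ₗᵢ[ℂ] Htau :=
  LinearIsometryEquiv.ofSurjective (curryL2.comp polarL2)
    (surjective_curryL2.comp surjective_polarL2)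

lemma fibration_apply (ξ : L2G0) : fibration ξ = curryL2 (polarL2 ξ) := rfl

/-- Left translation by `exp(uY)` on `L²(ℝ; L²(ℝ²))`. -/
def fibShift (u : ℝ) : Htau →ₗᵢ[ℂ] Htau :=
  fibration.toLinearIsometry.comp ((trans (G0.mk 0 u 0)).comp fibration.symm.toLinearIsometry)

lemma fibShift_apply (u : ℝ) (ζ : Htau) : fibShift u ζ =
    (fibAct (G0.mk 0 u 0)).toContinuousLinearMap.compLpL 2 volume (shiftLp u ζ) := by
  change fibration (trans (G0.mk 0 u 0) (fibration.symm ζ)) = _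
  rw [fibration_apply, curryL2_polarL2_trans, ← fibration_apply,
    LinearIsometryEquiv.apply_symm_apply]
  rfl

/-- The interval has length one, so that c ↦ 1_{[0,1]} c preserves norms. This embeds the fibre
L²(ℝ²) into L²(ℝ; L²(ℝ²)). -/
lemma isometry_indicatorConstLp_Icc {F : Type*} [NormedAddCommGroup F] :
    Isometry fun c : F => indicatorConstLp 2 (measurableSet_Icc (a := (0 : ℝ)) (b := 1))
      (measure_Icc_lt_top (μ := volume)).ne c := by
  refine Isometry.of_dist_eq fun c d => ?_
  have h : indicatorConstLp 2 (measurableSet_Icc (a := (0 : ℝ)) (b := 1))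
      (measure_Icc_lt_top (μ := volume)).ne c - indicatorConstLp 2 (measurableSet_Icc (a := (0 : ℝ))
      (b := 1)) (measure_Icc_lt_top (μ := volume)).ne d =
      indicatorConstLp 2 (measurableSet_Icc (a := (0 : ℝ)) (b := 1))
      (measure_Icc_lt_top (μ := volume)).ne (c - d) := by
    rw [indicatorConstLp, indicatorConstLp, indicatorConstLp, ← MemLp.toLp_sub]
    exact MemLp.toLp_congr _ _ (.of_forall fun x => by
      by_cases hx : x ∈ Icc (0 : ℝ) 1 <;> simp [hx])
  rw [dist_eq_norm, dist_eq_norm, h, norm_indicatorConstLp (by norm_num) (by norm_num)]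
  simp

lemma compLpL_indicatorConstLp {α F : Type*} [MeasurableSpace α] {μ : Measure α}
    [NormedAddCommGroup F] [NormedSpace ℂ F] {s : Set α} (hs : MeasurableSet s) (hμ : μ s ≠ ∞)
    (A : F →L[ℂ] F) (c : F) :
    A.compLpL 2 μ (indicatorConstLp 2 hs hμ c) = indicatorConstLp 2 hs hμ (A c) := by
  refine Lp.ext ?_
  filter_upwards [A.coeFn_compLpL (indicatorConstLp 2 hs hμ c),
    indicatorConstLp_coeFn (p := 2) (hs := hs) (hμs := hμ) (c := c),
    indicatorConstLp_coeFn (p := 2) (hs := hs) (hμs := hμ) (c := A c)] with y h1 h2 h3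
  rw [h1, h2, h3]
  by_cases hy : y ∈ s <;> simp [hy]

lemma shiftLp_shiftLp_neg {F : Type*} [NormedAddCommGroup F] [InnerProductSpace ℂ F] (u : ℝ)
    (ζ : Lp F 2 (volume : Measure ℝ)) : shiftLp u (shiftLp (-u) ζ) = ζ := by
  refine Lp.ext ?_
  filter_upwards [coeFn_shiftLp u (shiftLp (-u) ζ),
    (measurePreserving_sub_right volume u).quasiMeasurePreserving.ae
      (coeFn_shiftLp (-u) ζ)] with y k1 k2
  rw [k1, k2]
  simp

lemma fibAct_mk_zero (u : ℝ) (c : L2Z) : fibAct (G0.mk 0 u 0) c = dil u c := by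
  change dil u (shiftZ (0, 0) c) = dil u c
  congr 1
  refine Lp.ext ?_
  filter_upwards [coeFn_shiftZ (0, 0) c] with z hz
  rw [hz, Prod.mk_zero_zero, sub_zero]

lemma continuous_fibShift : Continuous fun w : ℝ × Htau => fibShift w.1 w.2 :=
  continuous_isometry_apply (V := fibShift) fun ζ =>
    fibration.continuous.comp ((continuous_trans (fibration.symm ζ)).comp
      (f := fun u : ℝ => G0.mk 0 u 0) (by fun_prop))

/-- The dilation is extracted from the translation by exp(uY) on L²(G₀), whose strong continuity is
known. That translation is the shift by u combined with `dil u` on the fibres, so undoing the shift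
on 1_{[0,1]} η leaves 1_{[0,1]} `dil u η`. -/
lemma continuous_dil_apply (η : L2Z) : Continuous fun u => dil u η := by
  rw [← isometry_indicatorConstLp_Icc.comp_continuous_iff]
  refine (continuous_fibShift.comp (continuous_id.prodMk
    ((continuous_shiftLp (indicatorConstLp 2 (measurableSet_Icc (a := (0 : ℝ)) (b := 1))
      (measure_Icc_lt_top (μ := volume)).ne η)).comp continuous_neg))).congr fun u => ?_
  change fibShift u (shiftLp (-u) _) = _
  rw [fibShift_apply, shiftLp_shiftLp_neg, compLpL_indicatorConstLp]
  exact congrArg _ (fibAct_mk_zero u η)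

lemma continuous_fibAct : Continuous fun w : G0 × L2Z => fibAct w.1 w.2 := by
  have h1 := continuous_isometry_apply (V := dil) continuous_dil_apply
  have h2 : Continuous fun w : G0 × L2Z => shiftZ (w.1.x, w.1.p) w.2 :=
    continuous_shiftZ.comp (f := fun w : G0 × L2Z => ((w.1.x, w.1.p), w.2)) (by fun_prop)
  exact h1.comp (f := fun w : G0 × L2Z => (w.1.y, shiftZ (w.1.x, w.1.p) w.2))
    ((G0.continuous_y.comp continuous_fst).prodMk h2)

/-! ### Fourier integrals of strongly continuous families -/

section CharInt
variable {F : Type*} [NormedAddCommGroup F] [NormedSpace ℂ F]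

lemma norm_le_one_of_isometry {E : Type*} [NormedAddCommGroup E] [NormedSpace ℂ E]
    (V : E →ₗᵢ[ℂ] F) : ‖V.toContinuousLinearMap‖ ≤ 1 :=
  V.norm_toContinuousLinearMap_le

lemma stronglyBdd_isometry {X E : Type*} [MeasurableSpace X] [TopologicalSpace X]
    [OpensMeasurableSpace X] [SecondCountableTopology X] [NormedAddCommGroup E] [NormedSpace ℂ E]
    {μ : Measure X} [IsFiniteMeasure μ] {V : X → E →ₗᵢ[ℂ] F} (hV : ∀ ξ, Continuous fun x => V x ξ) :
    StronglyBdd μ fun x => (V x).toContinuousLinearMap :=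
  ⟨inferInstance, ⟨1, fun x => norm_le_one_of_isometry (V x)⟩,
    fun ξ => (hV ξ).aestronglyMeasurable⟩

/-- Supplies the joint measurability under which an integral of operators on L²(ℝ; F) can be
evaluated pointwise by `coeFn_strongInt`. -/
lemma stronglyMeasurable_smul_isometry {X Y : Type*} [TopologicalSpace X]
    [TopologicalSpace.MetrizableSpace X] [SecondCountableTopology X] [MeasurableSpace X]
    [BorelSpace X] [TopologicalSpace Y] [SecondCountableTopology Y] [MeasurableSpace Y]
    [BorelSpace Y] {c : X × Y → ℂ} (hc : Continuous c) {V : X → F →ₗᵢ[ℂ] F}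
    (hV : Continuous fun w : X × F => V w.1 w.2) {ζ : Y → F} (hζ : StronglyMeasurable ζ) :
    StronglyMeasurable fun w : X × Y => c w • V w.1 (ζ w.2) := by
  have hp : StronglyMeasurable fun w : X × Y => (w.1, ζ w.2) :=
    measurable_fst.stronglyMeasurable.prodMk (hζ.comp_measurable measurable_snd)
  exact hc.stronglyMeasurable.smul (hV.comp_stronglyMeasurable hp)

/-- The operator `∫_A e^{-2πi b u} D(u) du`. -/
def charInt [CompleteSpace F] (D : ℝ → F →ₗᵢ[ℂ] F) (A : Set ℝ) (b : ℝ) : F →L[ℂ] F :=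
  strongInt (volume.restrict A)
    fun u => (Real.fourierChar (-(b * u)) : ℂ) • (D u).toContinuousLinearMap

variable {D : ℝ → F →ₗᵢ[ℂ] F} {A : Set ℝ}

lemma stronglyBdd_char (hD : ∀ η, Continuous fun u => D u η) (hA : volume A < ∞) (b : ℝ) :
    StronglyBdd (volume.restrict A)
      fun u => (Real.fourierChar (-(b * u)) : ℂ) • (D u).toContinuousLinearMap := by
  refine ⟨⟨by simpa using hA⟩, ⟨1, fun u => ?_⟩, fun ξ => ?_⟩
  · rw [norm_smul, Circle.norm_coe, one_mul]
    exact norm_le_one_of_isometry _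
  · refine Continuous.aestronglyMeasurable (Continuous.smul ?_ (hD ξ))
    fun_prop

variable [CompleteSpace F]

lemma norm_charInt_le (hD : ∀ η, Continuous fun u => D u η) (hA : volume A < ∞) (b : ℝ) :
    ‖charInt D A b‖ ≤ volume.real A := by
  refine (norm_strongInt_le (stronglyBdd_char hD hA b) zero_le_one
    (.of_forall fun u => ?_)).trans (le_of_eq ?_)
  · rw [norm_smul, Circle.norm_coe, one_mul]
    exact norm_le_one_of_isometry _
  · simp

/-- Since every D(u) is isometric, the operator norm of a difference is at most the L¹(A) distance
of the two characters, which tends to 0 by dominated convergence. No norm continuity of D is needed.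
-/
lemma continuous_charInt (hD : ∀ η, Continuous fun u => D u η) (hA : volume A < ∞) :
    Continuous (charInt D A) := by
  have : IsFiniteMeasure (volume.restrict A) := ⟨by simpa using hA⟩
  have hle (b b₀ : ℝ) : dist (charInt D A b) (charInt D A b₀) ≤
      ∫ u in A, ‖(Real.fourierChar (-(b * u)) : ℂ) - Real.fourierChar (-(b₀ * u))‖ := by
    rw [dist_eq_norm]
    refine ContinuousLinearMap.opNorm_le_bound _ (integral_nonneg fun u => norm_nonneg _)
      fun ξ => ?_
    rw [sub_apply, charInt, charInt, strongInt_apply (stronglyBdd_char hD hA b),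
      strongInt_apply (stronglyBdd_char hD hA b₀),
      ← integral_sub ((stronglyBdd_char hD hA b).integrable ξ)
        ((stronglyBdd_char hD hA b₀).integrable ξ), ← integral_mul_const]
    refine (norm_integral_le_integral_norm _).trans (le_of_eq (integral_congr_ae
      (.of_forall fun u => ?_)))
    change ‖(Real.fourierChar (-(b * u)) : ℂ) • D u ξ -
      (Real.fourierChar (-(b₀ * u)) : ℂ) • D u ξ‖ = _
    rw [← sub_smul, norm_smul, (D u).norm_map]
  rw [continuous_iff_continuousAt]
  intro b₀
  rw [ContinuousAt, tendsto_iff_dist_tendsto_zero]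
  refine squeeze_zero (fun _ => dist_nonneg) (fun b => hle b b₀) ?_
  have h0 : Tendsto (fun b : ℝ => ∫ u in A,
      ‖(Real.fourierChar (-(b * u)) : ℂ) - Real.fourierChar (-(b₀ * u))‖) (𝓝 b₀)
      (𝓝 (∫ u in A, (0 : ℝ))) := by
    refine tendsto_integral_filter_of_dominated_convergence (fun _ => 2)
      (.of_forall fun b => Continuous.aestronglyMeasurable (by fun_prop))
      (.of_forall fun b => .of_forall fun u => ?_) (integrable_const _) (.of_forall fun u => ?_)
    · rw [norm_norm]
      refine (norm_sub_le _ _).trans ?_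
      rw [Circle.norm_coe, Circle.norm_coe]
      norm_num
    · have hc : Continuous fun b : ℝ =>
          ‖(Real.fourierChar (-(b * u)) : ℂ) - Real.fourierChar (-(b₀ * u))‖ := by fun_prop
      simpa using hc.tendsto b₀
  simpa using h0

/-- The Riemann-Lebesgue lemma for the vector valued function 1_A(u) D(u)η. The convergence is only
strong; a compact factor upgrades it to norm convergence. -/
lemma tendsto_charInt (hD : ∀ η, Continuous fun u => D u η) (hA : volume A < ∞)
    (hAm : MeasurableSet A) (η : F) :
    Tendsto (fun b => charInt D A b η) (cocompact ℝ) (𝓝 0) := by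
  refine (Real.tendsto_integral_exp_smul_cocompact (A.indicator fun u => D u η)).congr fun b => ?_
  rw [charInt, strongInt_apply (stronglyBdd_char hD hA b), ← integral_indicator hAm]
  refine integral_congr_ae (.of_forall fun u => ?_)
  by_cases hu : u ∈ A
  · simp [hu, Circle.smul_def, mul_comm]
  · simp [hu]

lemma setIntegral_char_prod {S : ℝ × ℝ → F →ₗᵢ[ℂ] F} (hD : ∀ η, Continuous fun u => D u η)
    (hS : ∀ η, Continuous fun a => S a η) {A₂ : Set (ℝ × ℝ)} (hA : volume A < ∞)
    (hA₂ : volume A₂ < ∞) (b : ℝ) (η : F) :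
    ∫ w in A ×ˢ A₂, (Real.fourierChar (-(b * w.1)) : ℂ) • D w.1 (S w.2 η) =
      charInt D A b (strongInt (volume.restrict A₂) (fun a => (S a).toContinuousLinearMap) η) := by
  have : IsFiniteMeasure (volume.restrict A) := ⟨by simpa using hA⟩
  have : IsFiniteMeasure (volume.restrict A₂) := ⟨by simpa using hA₂⟩
  have hSb := stronglyBdd_isometry (μ := volume.restrict A₂) hS
  have hc : Continuous fun w : ℝ × (ℝ × ℝ) =>
      (Real.fourierChar (-(b * w.1)) : ℂ) • D w.1 (S w.2 η) := by
    refine Continuous.smul (by fun_prop) ?_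
    exact (continuous_isometry_apply hD).comp
      (continuous_fst.prodMk ((hS η).comp continuous_snd))
  have hI : Integrable (fun w : ℝ × (ℝ × ℝ) =>
      (Real.fourierChar (-(b * w.1)) : ℂ) • D w.1 (S w.2 η))
      ((volume.restrict A).prod (volume.restrict A₂)) := by
    refine Integrable.of_bound hc.aestronglyMeasurable ‖η‖ (.of_forall fun w => ?_)
    rw [norm_smul, Circle.norm_coe, one_mul, (D _).norm_map, (S _).norm_map]
  rw [Measure.volume_eq_prod, ← Measure.prod_restrict, integral_prod _ hI, charInt,
    strongInt_apply (stronglyBdd_char hD hA b)]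
  refine integral_congr_ae (.of_forall fun u => ?_)
  change ∫ a in A₂, (Real.fourierChar (-(b * u)) : ℂ) • D u (S a η) =
    ((Real.fourierChar (-(b * u)) : ℂ) • (D u).toContinuousLinearMap) _
  rw [strongInt_apply hSb, ← ContinuousLinearMap.integral_comp_comm _ (hSb.integrable η)]
  rfl

end CharInt

/-! ### Integrated left translations -/

/-- The coordinates `(y, (x, p))` on `G₀`. -/
def yxp : G0 ≃ₜ ℝ × (ℝ × ℝ) where
  toFun h := (h.y, (h.x, h.p))
  invFun w := G0.mk w.2.1 w.1 w.2.2
  left_inv _ := rfl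
  right_inv _ := rfl
  continuous_toFun := by fun_prop
  continuous_invFun := by fun_prop

lemma measurePreserving_yxp : MeasurePreserving yxp := by
  have h1 : MeasurePreserving (fun w : ℝ × (ℝ × ℝ) => ((w.1, w.2.1), w.2.2)) :=
    (volume_preserving_prodAssoc (α₁ := ℝ) (β₁ := ℝ) (γ₁ := ℝ)).symm
  have h2 : MeasurePreserving (Prod.map Prod.swap id : (ℝ × ℝ) × ℝ → (ℝ × ℝ) × ℝ) :=
    (Measure.measurePreserving_swap (μ := (volume : Measure ℝ)) (ν := (volume : Measure ℝ))).prod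
      (MeasurePreserving.id (volume : Measure ℝ))
  have h3 : MeasurePreserving (fun w : (ℝ × ℝ) × ℝ => (w.1.1, (w.1.2, w.2))) :=
    volume_preserving_prodAssoc (α₁ := ℝ) (β₁ := ℝ) (γ₁ := ℝ)
  exact h3.comp (h2.comp h1)

lemma volume_yxp_preimage (A : Set (ℝ × (ℝ × ℝ))) : volume (yxp ⁻¹' A) = volume A :=
  measurePreserving_yxp.measure_preimage_equiv (f := yxp.toMeasurableEquiv) A

/-- The operator `∫_A L(h) dh` of integrated left translations. -/
def transInt (A : Set G0) : L2G0 →L[ℂ] L2G0 :=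
  strongInt (volume.restrict A) fun h => (trans h).toContinuousLinearMap

lemma stronglyBdd_trans {A : Set G0} (hA : volume A < ∞) :
    StronglyBdd (volume.restrict A) fun h => (trans h).toContinuousLinearMap := by
  have : IsFiniteMeasure (volume.restrict A) := ⟨by simpa using hA⟩
  exact stronglyBdd_isometry continuous_trans

lemma norm_transInt_le {A : Set G0} (hA : volume A < ∞) : ‖transInt A‖ ≤ volume.real A := by
  refine (norm_strongInt_le (stronglyBdd_trans hA) zero_le_one
    (.of_forall fun u => norm_le_one_of_isometry _)).trans (le_of_eq ?_)
  simp

lemma continuous_shiftZ_apply (η : L2Z) : Continuous fun a => shiftZ a η :=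
  continuous_shiftZ.comp (f := fun a => (a, η)) (by fun_prop)

/-- The operator `∫_A (translation by a) da` on `L²(ℝ²)`. -/
def convZ (A : Set (ℝ × ℝ)) : L2Z →L[ℂ] L2Z :=
  strongInt (volume.restrict A) fun a => (shiftZ a).toContinuousLinearMap

lemma stronglyBdd_shiftZ {A : Set (ℝ × ℝ)} (hA : volume A < ∞) :
    StronglyBdd (volume.restrict A) fun a => (shiftZ a).toContinuousLinearMap := by
  have : IsFiniteMeasure (volume.restrict A) := ⟨by simpa using hA⟩
  exact stronglyBdd_isometry continuous_shiftZ_apply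

instance : TopologicalSpace.MetrizableSpace G0 :=
  inferInstanceAs (TopologicalSpace.MetrizableSpace (ℝ × ℝ × ℝ))

/-- The translation by h acts at b as e^{-2πi b h.y} times a dilation by h.y after a shift by (h.x,
h.p). Over a product set in the coordinates (y, (x, p)) the integral therefore factors, and only the
first factor depends on b. -/
lemma intertwiner_transInt {A₁ : Set ℝ} {A₂ : Set (ℝ × ℝ)} (hA₁ : volume A₁ < ∞)
    (hA₂ : volume A₂ < ∞) (ξ : L2G0) :
    intertwiner (transInt (yxp ⁻¹' (A₁ ×ˢ A₂)) ξ) =ᵐ[volume]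
      fun b => charInt dil A₁ b (convZ A₂ (intertwiner ξ b)) := by
  have hA : volume (yxp ⁻¹' (A₁ ×ˢ A₂)) < ∞ := by
    rw [volume_yxp_preimage, Measure.volume_eq_prod, Measure.prod_prod]
    exact ENNReal.mul_lt_top hA₁ hA₂
  have h1 : intertwiner (transInt (yxp ⁻¹' (A₁ ×ˢ A₂)) ξ) =
      strongInt (volume.restrict (yxp ⁻¹' (A₁ ×ˢ A₂)))
        (fun h => intertwiner.toContinuousLinearMap ∘L (trans h).toContinuousLinearMap) ξ := by
    rw [← comp_strongInt (stronglyBdd_trans hA)]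
    rfl
  have hm : AEStronglyMeasurable (Function.uncurry fun (h : G0) (b : ℝ) =>
      (Real.fourierChar (-(b * h.y)) : ℂ) • fibAct h (intertwiner ξ b))
      ((volume.restrict (yxp ⁻¹' (A₁ ×ˢ A₂))).prod volume) := by
    exact (stronglyMeasurable_smul_isometry (c := fun w : G0 × ℝ =>
      (Real.fourierChar (-(w.2 * w.1.y)) : ℂ)) (by fun_prop) continuous_fibAct
      (Lp.stronglyMeasurable (intertwiner ξ))).aestronglyMeasurable
  have h2 := coeFn_strongInt (iE := NormedSpace.complexToReal)
    ((stronglyBdd_trans hA).comp_left intertwiner.toContinuousLinearMap) ξ hm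
    (.of_forall fun h => intertwiner_trans h ξ)
  rw [h1]
  filter_upwards [h2] with b hb
  rw [hb]
  refine Eq.trans ?_ (setIntegral_char_prod continuous_dil_apply continuous_shiftZ_apply hA₁ hA₂ b
    (intertwiner ξ b))
  exact measurePreserving_yxp.setIntegral_preimage_emb yxp.measurableEmbedding
    (fun w : ℝ × (ℝ × ℝ) => (Real.fourierChar (-(b * w.1)) : ℂ) •
      dil w.1 (shiftZ w.2 (intertwiner ξ b))) _

/-! ### Membership in `C₀(ℝ, 𝒦)` -/

/-- The operator has the kernel 1_A(z - z') g(z'), which is square integrable since A has finite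
measure and g is bounded with support of finite measure. -/
lemma isCompactOperator_convZ_mulOp {A : Set (ℝ × ℝ)} (hA : volume A < ∞) (hAm : MeasurableSet A)
    {g : ℝ × ℝ → ℂ} (hg : BddMeas g) {S : Set (ℝ × ℝ)} (hS : volume S < ∞) (hSm : MeasurableSet S)
    (hgS : ∀ z ∉ S, g z = 0) : IsCompactOperator (convZ A ∘L mulOp volume g) := by
  set χ : L2Z := indicatorConstLp 2 hAm hA.ne (1 : ℂ) with hχ
  obtain ⟨C, hC⟩ := hg.2
  -- The kernel as a square integrable map into L²(ℝ²): its value at z' is g(z') times the translate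
  -- of 1_A by z'.
  have hW : MemLp (fun z => g z • shiftZ z χ) 2 volume := by
    have h1 : MemLp (S.indicator fun _ => C * ‖χ‖) 2 (volume : Measure (ℝ × ℝ)) :=
      memLp_indicator_const 2 hSm _ (Or.inr hS.ne)
    refine h1.mono (hg.1.aestronglyMeasurable.smul
      (continuous_shiftZ_apply χ).aestronglyMeasurable) (.of_forall fun z => ?_)
    rw [norm_smul, LinearIsometry.norm_map]
    by_cases hz : z ∈ S
    · rw [indicator_of_mem hz]
      exact (mul_le_mul_of_nonneg_right (hC z) (norm_nonneg _)).trans (le_abs_self _)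
    · rw [hgS z hz, norm_zero, zero_mul]
      exact norm_nonneg _
  have key : convZ A ∘L mulOp volume g =
      ((ContinuousLinearMap.lsmul ℂ ℂ : ℂ →L[ℂ] L2Z →L[ℂ] L2Z).lpPairing volume 2 2).flip
        hW.toLp := by
    ext1 η
    refine Lp.ext ?_
    rw [ContinuousLinearMap.comp_apply, ContinuousLinearMap.flip_apply,
      ContinuousLinearMap.lpPairing_eq_integral]
    set v := mulOp volume g η
    have hv0 : v =ᵐ[volume] fun z => g z * η z := coeFn_mulOp hg η
    have hm1 : StronglyMeasurable fun w : (ℝ × ℝ) × (ℝ × ℝ) => v (w.2 - w.1) :=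
      (Lp.stronglyMeasurable v).comp_measurable (by fun_prop)
    have h1 := coeFn_strongInt (iE := NormedSpace.complexToReal) (stronglyBdd_shiftZ hA) v
      (Ψ := fun a z => v (z - a)) (ν := volume) hm1.aestronglyMeasurable
      (.of_forall fun a => coeFn_shiftZ a v)
    have hI : Integrable fun z => (ContinuousLinearMap.lsmul ℂ ℂ : ℂ →L[ℂ] L2Z →L[ℂ] L2Z) (η z)
        ((hW.toLp _ : Lp L2Z 2 (volume : Measure (ℝ × ℝ))) z) := by
      rw [← memLp_one_iff_integrable]
      exact (Lp.memLp hW.toLp).smul (Lp.memLp η)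
    have hm2 : StronglyMeasurable fun w : (ℝ × ℝ) × (ℝ × ℝ) =>
        A.indicator (1 : ℝ × ℝ → ℂ) (w.2 - w.1) * (g w.1 * η w.1) := by
      refine StronglyMeasurable.mul ?_ (StronglyMeasurable.mul ?_ ?_)
      · exact ((measurable_one.indicator hAm).comp
          (measurable_snd.sub measurable_fst)).stronglyMeasurable
      · exact (hg.1.comp measurable_fst).stronglyMeasurable
      · exact (Lp.stronglyMeasurable η).comp_measurable measurable_fst
    have h2 := coeFn_integral_Lp (iE := NormedSpace.complexToReal) (iL := inferInstance) hI
      (Ψ := fun z' z => A.indicator (1 : ℝ × ℝ → ℂ) (z - z') * (g z' * η z')) (ν := volume)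
      hm2.aestronglyMeasurable (by
        filter_upwards [hW.coeFn_toLp] with z' hz'
        rw [hz']
        change (η z' • g z' • shiftZ z' χ : L2Z) =ᵐ[volume] _
        rw [smul_smul]
        filter_upwards [Lp.coeFn_smul (η z' * g z') (shiftZ z' χ), coeFn_shiftZ z' χ,
          (measurePreserving_sub_right volume z').quasiMeasurePreserving.ae
            (indicatorConstLp_coeFn (p := 2) (hs := hAm) (hμs := hA.ne) (c := (1 : ℂ)))]
          with z k1 k2 k3
        rw [k1, Pi.smul_apply, k2, k3, smul_eq_mul, mul_comm (η z'), mul_comm]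
        rfl)
    filter_upwards [h1, h2] with z k1 k2
    refine k1.trans (Eq.trans ?_ k2.symm)
    -- The substitution a = z - z' turns the average of translations over A into the kernel integral
    -- in z'.
    rw [← integral_indicator hAm,
      ← integral_sub_left_eq_self (fun a => A.indicator (fun a => v (z - a)) a) volume z]
    refine integral_congr_ae ?_
    filter_upwards [hv0] with z' hz'
    by_cases h : z - z' ∈ A
    · simp [h, hz']
    · simp [h]
  rw [key]
  exact isCompactOperator_lpPairing _

/-- `M_{g'} L(f) M_g` lies in `C₀(ℝ, 𝒦)` if `g` has bounded support. -/
lemma mem_C0K_of_bounded_support {A₁ : Set ℝ} {A₂ : Set (ℝ × ℝ)} (hA₁ : volume A₁ < ∞)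
    (hA₁m : MeasurableSet A₁) (hA₂ : volume A₂ < ∞) (hA₂m : MeasurableSet A₂)
    {g g' : ℝ × ℝ → ℂ} (hg : BddMeas g) (hg' : BddMeas g') {S : Set (ℝ × ℝ)} (hS : volume S < ∞)
    (hSm : MeasurableSet S) (hgS : ∀ z ∉ S, g z = 0) :
    rho (mulOp volume (fun k => g' (zpol k)) ∘L transInt (yxp ⁻¹' (A₁ ×ˢ A₂)) ∘L
      mulOp volume (fun k => g (zpol k))) ∈ C0K := by
  set C := convZ A₂ ∘L mulOp volume g with hC
  have hCc : IsCompactOperator C := isCompactOperator_convZ_mulOp hA₂ hA₂m hg hS hSm hgS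
  have hN := continuous_charInt continuous_dil_apply hA₁
  -- The field is b ↦ M_{g'} N(b) C with N(b) = `charInt dil A₁ b` and C compact and independent of
  -- b.
  refine ⟨⟨⟨fun b => mulOp volume g' ∘L (charInt dil A₁ b ∘L C), ?_⟩, ?_⟩, fun b => ?_, fun ζ => ?_⟩
  · exact continuous_const.clm_comp (hN.clm_comp continuous_const)
  · have h0 := tendsto_norm_comp_of_isCompactOperator (N := charInt dil A₁)
      (norm_charInt_le continuous_dil_apply hA₁)
      (fun η => tendsto_charInt continuous_dil_apply hA₁ hA₁m η) hCc
    have hc : Continuous fun T : L2Z →L[ℂ] L2Z => mulOp volume g' ∘L T :=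
      continuous_const.clm_comp continuous_id
    have := (hc.tendsto 0).comp h0
    rw [ContinuousLinearMap.comp_zero] at this
    exact this
  · exact (hCc.clm_comp (charInt dil A₁ b)).clm_comp (mulOp volume g')
  · obtain ⟨ξ, rfl⟩ := surjective_intertwiner ζ
    rw [rho_intertwiner]
    filter_upwards [intertwiner_mulOp hg' (transInt (yxp ⁻¹' (A₁ ×ˢ A₂))
      (mulOp volume (fun k => g (zpol k)) ξ)),
      intertwiner_transInt hA₁ hA₂ (mulOp volume (fun k => g (zpol k)) ξ),
      intertwiner_mulOp hg ξ] with b h1 h2 h3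
    refine h1.trans ?_
    rw [h2, h3]
    rfl

lemma zero_mem_C0K : (0 : Htau →L[ℂ] Htau) ∈ C0K := by
  refine ⟨0, fun b => ?_, fun ξ => ?_⟩
  · exact isCompactOperator_zero
  · filter_upwards [Lp.coeFn_zero L2Z 2 (volume : Measure ℝ)] with b hb
    rw [zero_apply, hb]
    rfl

lemma add_mem_C0K {S T : Htau →L[ℂ] Htau} (hS : S ∈ C0K) (hT : T ∈ C0K) : S + T ∈ C0K := by
  obtain ⟨φ, h1, h2⟩ := hS
  obtain ⟨ψ, h3, h4⟩ := hT
  refine ⟨φ + ψ, fun b => (h1 b).add (h3 b), fun ξ => ?_⟩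
  filter_upwards [h2 ξ, h4 ξ, Lp.coeFn_add (S ξ) (T ξ)] with b k1 k2 k3
  rw [add_apply, k3, Pi.add_apply, k1, k2]
  rfl

lemma smul_mem_C0K (c : ℂ) {T : Htau →L[ℂ] Htau} (hT : T ∈ C0K) : c • T ∈ C0K := by
  obtain ⟨ψ, h3, h4⟩ := hT
  refine ⟨c • ψ, fun b => (h3 b).smul c, fun ξ => ?_⟩
  filter_upwards [h4 ξ, Lp.coeFn_smul c (T ξ)] with b k2 k3
  rw [smul_apply, k3, Pi.smul_apply, k2]
  rfl

/-- `M_{g'} L(f) M_g` can be approximated by elements of `C₀(ℝ, 𝒦)` if `g` vanishes at infinity. -/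
lemma exists_mem_C0K_norm_sub_le {A₁ : Set ℝ} {A₂ : Set (ℝ × ℝ)} (hA₁ : volume A₁ < ∞)
    (hA₁m : MeasurableSet A₁) (hA₂ : volume A₂ < ∞) (hA₂m : MeasurableSet A₂)
    {g g' : ℝ × ℝ → ℂ} (hg : BddMeas g) (hg' : BddMeas g') (hg'1 : ∀ z, ‖g' z‖ ≤ 1)
    (hg0 : ∀ η > 0, ∃ R : ℝ, ∀ z, R < ‖z‖ → ‖g z‖ ≤ η) {η : ℝ} (hη : 0 < η) :
    ∃ c ∈ C0K, ‖rho (mulOp volume (fun k => g' (zpol k)) ∘L transInt (yxp ⁻¹' (A₁ ×ˢ A₂)) ∘L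
      mulOp volume (fun k => g (zpol k))) - c‖ ≤ η := by
  have hA : volume (yxp ⁻¹' (A₁ ×ˢ A₂)) < ∞ := by
    rw [volume_yxp_preimage, Measure.volume_eq_prod, Measure.prod_prod]
    exact ENNReal.mul_lt_top hA₁ hA₂
  set m := volume.real (yxp ⁻¹' (A₁ ×ˢ A₂)) with hm
  have hm0 : 0 ≤ m := measureReal_nonneg
  -- Truncating g to a ball costs at most η/(m + 1), and the integrated translation has norm at most
  -- m; the summand 1 covers m = 0.
  obtain ⟨R, hR⟩ := hg0 (η / (m + 1)) (by positivity)
  set S := Metric.closedBall (0 : ℝ × ℝ) R with hS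
  have hSm : MeasurableSet S := Metric.isClosed_closedBall.measurableSet
  have hgS : BddMeas (S.indicator g) := hg.indicator hSm
  have hz := continuous_zpol.measurable
  refine ⟨_, mem_C0K_of_bounded_support hA₁ hA₁m hA₂ hA₂m hgS hg'
    (isCompact_closedBall (0 : ℝ × ℝ) R).measure_lt_top hSm
    (fun z hz => indicator_of_notMem hz g), ?_⟩
  rw [sub_eq_add_neg, ← neg_one_smul ℂ, ← rho_smul, ← rho_add, neg_one_smul, ← sub_eq_add_neg,
    ← ContinuousLinearMap.comp_sub, ← ContinuousLinearMap.comp_sub,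
    mulOp_sub (hg.comp hz) (hgS.comp hz)]
  refine (norm_rho_le _).trans ?_
  have h1 := norm_mulOp_le (μ := volume) (hg'.comp hz) zero_le_one fun k => hg'1 (zpol k)
  have h2 := norm_transInt_le hA
  have h3 := norm_mulOp_le (μ := volume) ((hg.comp hz).sub (hgS.comp hz))
    (C := η / (m + 1)) (by positivity) fun k => by
      by_cases hk : zpol k ∈ S
      · rw [indicator_of_mem hk, sub_self, norm_zero]
        positivity
      · rw [indicator_of_notMem hk, sub_zero]
        refine hR _ ?_
        simpa [hS] using hk
  refine (ContinuousLinearMap.opNorm_comp_le _ _).trans ?_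
  refine (mul_le_mul h1 ((ContinuousLinearMap.opNorm_comp_le _ _).trans
    (mul_le_mul h2 h3 (norm_nonneg _) hm0)) (norm_nonneg _) zero_le_one).trans ?_
  rw [one_mul, ← mul_div_assoc, div_le_iff₀ (by positivity)]
  nlinarith

/-! ### Fourier transforms of sets in `𝔥` -/

/-- The function `λ ↦ ∫_B e^{i λ(W)} dW` on `𝔥*`. -/
def hat (B : Set (ℝ × ℝ × ℝ)) (l : ℝ × ℝ × ℝ) : ℂ := ∫ W in B, chi l W

lemma norm_hat_le {B : Set (ℝ × ℝ × ℝ)} (hB : volume B < ∞) (l : ℝ × ℝ × ℝ) :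
    ‖hat B l‖ ≤ volume.real B := by
  have := norm_setIntegral_le_of_norm_le_const (f := chi l) (C := 1) hB
    fun W _ => (norm_chi l W).le
  rwa [one_mul] at this

lemma integrableOn_chi {B : Set (ℝ × ℝ × ℝ)} (hB : volume B < ∞) (l : ℝ × ℝ × ℝ) :
    IntegrableOn (chi l) B := by
  have : IsFiniteMeasure (volume.restrict B) := ⟨by simpa using hB⟩
  exact Integrable.of_bound (continuous_chi l continuous_id).aestronglyMeasurable 1
    (.of_forall fun W => (norm_chi l W).le)

/-- From |e^{it} - 1| ≤ |t|; the factor 3 counts the coordinates of the pairing, each estimated by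
the maximum norms. -/
lemma norm_chi_sub_chi_le (l m W : ℝ × ℝ × ℝ) :
    ‖chi l W - chi m W‖ ≤ 3 * ‖l - m‖ * ‖W‖ := by
  have h0 : pairing l W = pairing m W + pairing (l - m) W := by
    simp only [pairing, Prod.fst_sub, Prod.snd_sub]; ring
  have h1 : chi l W - chi m W =
      chi m W * (Complex.exp (Complex.I * (pairing (l - m) W : ℝ)) - 1) := by
    rw [chi, chi, h0, Complex.ofReal_add, mul_add, Complex.exp_add]
    ring
  rw [h1, norm_mul, norm_chi, one_mul]
  refine Real.norm_exp_I_mul_ofReal_sub_one_le.trans ?_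
  have hb (a : ℝ × ℝ × ℝ) : ‖a.1‖ ≤ ‖a‖ ∧ ‖a.2.1‖ ≤ ‖a‖ ∧ ‖a.2.2‖ ≤ ‖a‖ :=
    ⟨norm_fst_le a, (norm_fst_le a.2).trans (norm_snd_le a),
      (norm_snd_le a.2).trans (norm_snd_le a)⟩
  obtain ⟨a1, a2, a3⟩ := hb (l - m)
  obtain ⟨b1, b2, b3⟩ := hb W
  rw [pairing]
  refine (norm_add₃_le).trans ?_
  rw [norm_mul, norm_mul, norm_mul]
  have k1 := mul_le_mul a1 b1 (norm_nonneg _) (norm_nonneg _)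
  have k2 := mul_le_mul a2 b2 (norm_nonneg _) (norm_nonneg _)
  have k3 := mul_le_mul a3 b3 (norm_nonneg _) (norm_nonneg _)
  linarith

/-- The Fourier transform of a bounded set is Lipschitz. This is what makes closeness of functionals
imply closeness of symbols, uniformly on G₀. -/
lemma norm_hat_sub_hat_le {B : Set (ℝ × ℝ × ℝ)} (hB : volume B < ∞) {c : ℝ}
    (hc : ∀ W ∈ B, ‖W‖ ≤ c) (l m : ℝ × ℝ × ℝ) :
    ‖hat B l - hat B m‖ ≤ 3 * ‖l - m‖ * c * volume.real B := by
  rw [hat, hat, ← integral_sub (integrableOn_chi hB l) (integrableOn_chi hB m)]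
  refine norm_setIntegral_le_of_norm_le_const hB fun W hW => ?_
  exact (norm_chi_sub_chi_le l m W).trans (mul_le_mul_of_nonneg_left (hc W hW) (by positivity))

lemma continuous_hat {B : Set (ℝ × ℝ × ℝ)} (hB : volume B < ∞) {c : ℝ}
    (hc : ∀ W ∈ B, ‖W‖ ≤ c) : Continuous (hat B) := by
  rw [continuous_iff_continuousAt]
  intro m
  rw [ContinuousAt, tendsto_iff_norm_sub_tendsto_zero]
  refine squeeze_zero (fun _ => norm_nonneg _) (fun l => norm_hat_sub_hat_le hB hc l m) ?_
  have : Continuous fun l : ℝ × ℝ × ℝ => 3 * ‖l - m‖ * c * volume.real B := by fun_prop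
  simpa using this.tendsto m

/-- The functional `W ↦ -λ(W) / 2π`, linear in `λ`. -/
def pairingDual : (ℝ × ℝ × ℝ) →ₗ[ℝ] StrongDual ℝ (ℝ × ℝ × ℝ) where
  toFun l := (-(2 * Real.pi)⁻¹) • (l.1 • ContinuousLinearMap.fst ℝ ℝ (ℝ × ℝ) +
    l.2.1 • (ContinuousLinearMap.fst ℝ ℝ ℝ ∘L ContinuousLinearMap.snd ℝ ℝ (ℝ × ℝ)) +
    l.2.2 • (ContinuousLinearMap.snd ℝ ℝ ℝ ∘L ContinuousLinearMap.snd ℝ ℝ (ℝ × ℝ)))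
  map_add' l m := by ext <;> simp <;> ring
  map_smul' c l := by ext <;> simp <;> ring

lemma pairingDual_apply (l W : ℝ × ℝ × ℝ) :
    pairingDual l W = -(2 * Real.pi)⁻¹ * pairing l W := by
  simp [pairingDual, pairing]
  ring

lemma pairingDual_injective : Function.Injective pairingDual := by
  rw [← LinearMap.ker_eq_bot, LinearMap.ker_eq_bot']
  intro l hl
  have h (W : ℝ × ℝ × ℝ) : pairing l W = 0 := by
    have := DFunLike.congr_fun hl W
    rw [pairingDual_apply] at this
    simpa [Real.pi_ne_zero] using this
  have h1 := h (1, 0, 0)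
  have h2 := h (0, 1, 0)
  have h3 := h (0, 0, 1)
  simp only [pairing, mul_one, mul_zero, add_zero, zero_add] at h1 h2 h3
  exact Prod.ext h1 (Prod.ext h2 h3)

/-- The Riemann-Lebesgue lemma for `hat`. -/
lemma exists_norm_hat_le {B : Set (ℝ × ℝ × ℝ)} (hB : MeasurableSet B) {η : ℝ} (hη : 0 < η) :
    ∃ R : ℝ, 0 ≤ R ∧ ∀ l, R < ‖l‖ → ‖hat B l‖ ≤ η := by
  -- An injective linear map between finite-dimensional spaces is a closed embedding, so l → ∞
  -- forces the dual functional to infinity.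
  have h0 : Tendsto pairingDual (cocompact _) (cocompact _) :=
    (LinearMap.isClosedEmbedding_of_injective
      (LinearMap.ker_eq_bot.2 pairingDual_injective)).tendsto_cocompact
  have : (volume : Measure (ℝ × ℝ × ℝ)).IsAddHaarMeasure := by
    have : (volume : Measure (ℝ × ℝ)).IsAddHaarMeasure :=
      inferInstanceAs (((volume : Measure ℝ).prod volume).IsAddHaarMeasure)
    exact inferInstanceAs
      (((volume : Measure ℝ).prod (volume : Measure (ℝ × ℝ))).IsAddHaarMeasure)
  have h1 := (tendsto_integral_exp_smul_cocompact (B.indicator (1 : ℝ × ℝ × ℝ → ℂ)) volume).comp h0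
  have h2 : Tendsto (hat B) (cocompact _) (𝓝 0) := by
    refine h1.congr fun l => ?_
    rw [Function.comp_apply, hat, ← integral_indicator hB]
    refine integral_congr_ae (.of_forall fun W => ?_)
    by_cases hW : W ∈ B
    · simp only [hW, indicator_of_mem, Pi.one_apply, Circle.smul_def, smul_eq_mul, mul_one,
        Real.fourierChar_apply, chi, pairingDual_apply]
      congr 1
      push_cast
      field_simp
    · simp [hW]
  have h3 := Metric.tendsto_nhds.1 h2 η hη
  rw [← Metric.cobounded_eq_cocompact, ← comap_norm_atTop, eventually_comap] at h3
  obtain ⟨R, hR⟩ := eventually_atTop.1 h3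
  refine ⟨max R 0, le_max_right _ _, fun l hl => ?_⟩
  have := hR ‖l‖ ((le_max_left _ _).trans hl.le) l rfl
  rw [dist_zero_right] at this
  exact this.le

/-! ### The coadjoint action and the resulting symbols. -/

/-- The coadjoint action on `𝔥*`: `coad k l = l ∘ Ad(k⁻¹)`. -/
def coad (k : G0) (l : ℝ × ℝ × ℝ) : ℝ × ℝ × ℝ :=
  (Real.exp (-k.x + k.y) * (l.1 - k.p * l.2.1 + k.p ^ 2 / 2 * l.2.2),
   Real.exp (-k.x) * (l.2.1 - k.p * l.2.2), Real.exp (-k.x - k.y) * l.2.2)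

lemma pairing_adInv (k : G0) (l W : ℝ × ℝ × ℝ) :
    pairing l (adInv k W) = pairing (coad k l) W := by
  simp only [pairing, adInv, coad]; ring

lemma chi_adInv (k : G0) (l W : ℝ × ℝ × ℝ) : chi l (adInv k W) = chi (coad k l) W := by
  rw [chi, chi, pairing_adInv]

lemma continuous_coad (l : ℝ × ℝ × ℝ) : Continuous fun k => coad k l := by
  unfold coad; fun_prop

lemma bddMeas_hat_coad {B : Set (ℝ × ℝ × ℝ)} (hB : volume B < ∞) {c : ℝ}
    (hc : ∀ W ∈ B, ‖W‖ ≤ c) (l : ℝ × ℝ × ℝ) : BddMeas fun k => hat B (coad k l) :=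
  ⟨((continuous_hat hB hc).comp (continuous_coad l)).measurable, _, fun _ => norm_hat_le hB _⟩

/-! ### The representations `σ_l` on product sets -/

/-- The set of all `k exp(W)` with `k ∈ A`, `W ∈ B`. -/
def prodSet (A : Set G0) (B : Set (ℝ × ℝ × ℝ)) : Set G6 := {g | g.base ∈ A ∧ g.fib ∈ B}

lemma measurableSet_prodSet {A : Set G0} {B : Set (ℝ × ℝ × ℝ)} (hA : MeasurableSet A)
    (hB : MeasurableSet B) : MeasurableSet (prodSet A B) :=
  (G6.continuous_base.measurable hA).inter (G6.continuous_fib.measurable hB)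

lemma volume_prodSet (A : Set G0) (B : Set (ℝ × ℝ × ℝ)) :
    volume (prodSet A B) = volume A * volume B :=
  Measure.prod_prod (μ := (volume : Measure G0)) (ν := (volume : Measure (ℝ × ℝ × ℝ))) A B

lemma restrict_prodSet (A : Set G0) (B : Set (ℝ × ℝ × ℝ)) :
    (volume : Measure G6).restrict (prodSet A B) =
      ((volume : Measure G0).restrict A).prod ((volume : Measure (ℝ × ℝ × ℝ)).restrict B) :=
  (Measure.prod_restrict A B).symm

namespace UnitaryRep

/-- The operator `π(g)`. -/
def op (π : UnitaryRep) (g : G6) : π.H →ₗᵢ[ℂ] π.H := (π.toHom g).toLinearIsometry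

lemma op_mul (π : UnitaryRep) (g h : G6) (ξ : π.H) : π.op (g * h) ξ = π.op g (π.op h ξ) := by
  simp [op]

lemma continuous_op (π : UnitaryRep) (ξ : π.H) : Continuous fun g => π.op g ξ :=
  π.continuous_apply ξ

/-- The measure of G is the product measure in the coordinates k exp W and π(k exp W) = π(k) π(exp
W), so Fubini factors the integral. -/
lemma integrated_indicator (π : UnitaryRep) {A : Set G0} {B : Set (ℝ × ℝ × ℝ)}
    (hA : MeasurableSet A) (hB : MeasurableSet B) (hA' : volume A < ∞) (hB' : volume B < ∞)
    (hAB : volume (prodSet A B) ≠ ∞) :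
    π.integrated (indicatorConstLp 1 (measurableSet_prodSet hA hB) hAB (1 : ℂ)) =
      strongInt (volume.restrict A) (fun k => (π.op (G6.mk k 0)).toContinuousLinearMap) ∘L
        strongInt (volume.restrict B) (fun W => (π.op (G6.mk 1 W)).toContinuousLinearMap) := by
  have : IsFiniteMeasure (volume.restrict A) := ⟨by simpa using hA'⟩
  have : IsFiniteMeasure (volume.restrict B) := ⟨by simpa using hB'⟩
  have hc1 : Continuous fun k : G0 => G6.mk k 0 :=
    Continuous.prodMk (X := G0) (Y := ℝ × ℝ × ℝ) continuous_id continuous_const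
  have hc2 : Continuous fun W : ℝ × ℝ × ℝ => G6.mk 1 W :=
    Continuous.prodMk (X := G0) (Y := ℝ × ℝ × ℝ) continuous_const continuous_id
  have h1 : StronglyBdd (volume.restrict A)
      fun k => (π.op (G6.mk k 0)).toContinuousLinearMap :=
    stronglyBdd_isometry fun ξ => (π.continuous_op ξ).comp hc1
  have h2 : StronglyBdd (volume.restrict B)
      fun W => (π.op (G6.mk 1 W)).toContinuousLinearMap :=
    stronglyBdd_isometry fun ξ => (π.continuous_op ξ).comp hc2
  ext1 ξ
  have hmk (k : G0) (W : ℝ × ℝ × ℝ) : G6.mk k W = G6.mk k 0 * G6.mk 1 W := by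
    ext1 <;> simp
  have e1 : π.integrated (indicatorConstLp 1 (measurableSet_prodSet hA hB) hAB (1 : ℂ)) ξ =
      ∫ g in prodSet A B, π.op g ξ := by
    rw [integrated_apply, ← integral_indicator (measurableSet_prodSet hA hB)]
    refine integral_congr_ae ?_
    filter_upwards [indicatorConstLp_coeFn (p := 1) (hs := measurableSet_prodSet hA hB)
      (hμs := hAB) (c := (1 : ℂ))] with g hg
    rw [hg]
    by_cases h : g ∈ prodSet A B
    · rw [indicator_of_mem h, indicator_of_mem h, one_smul]
      rfl
    · rw [indicator_of_notMem h, indicator_of_notMem h, zero_smul]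
  have hI : Integrable (fun g : G0 × (ℝ × ℝ × ℝ) => π.op (G6.mk g.1 g.2) ξ)
      ((volume.restrict A).prod (volume.restrict B)) := by
    refine Integrable.of_bound (Continuous.aestronglyMeasurable ?_) ‖ξ‖ (.of_forall fun w => ?_)
    · exact (π.continuous_op ξ).comp
        (Continuous.prodMk (X := G0) (Y := ℝ × ℝ × ℝ) continuous_fst continuous_snd)
    · rw [LinearIsometry.norm_map]
  rw [e1, restrict_prodSet]
  refine (integral_prod _ hI).trans ?_
  rw [ContinuousLinearMap.comp_apply, strongInt_apply h1]
  refine integral_congr_ae (.of_forall fun k => ?_)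
  change ∫ W in B, π.op (G6.mk k W) ξ = (π.op (G6.mk k 0)).toContinuousLinearMap _
  rw [strongInt_apply h2, ← ContinuousLinearMap.integral_comp_comm _ (h2.integrable ξ)]
  refine integral_congr_ae (.of_forall fun W => ?_)
  change π.op (G6.mk k W) ξ = π.op (G6.mk k 0) (π.op (G6.mk 1 W) ξ)
  rw [hmk, op_mul]

end UnitaryRep

lemma indOp_mk_zero (l : ℝ × ℝ × ℝ) (k : G0) : indOp l (G6.mk k 0) = trans k := by
  ext1 ξ
  refine Lp.ext ?_
  filter_upwards [coeFn_indOp l (G6.mk k 0) ξ, coeFn_trans k ξ] with m h1 h2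
  rw [h1, h2]
  simp [equivariantExt, adInv, chi, pairing]

/-- H is normal and abelian, hence exp W acts in the induced representation as multiplication by
χ_l(Ad(k⁻¹)W), the character of `coad k l`. Integration over B gives the Fourier transform of B
along the coadjoint orbit. -/
lemma strongInt_indOp (l : ℝ × ℝ × ℝ) {B : Set (ℝ × ℝ × ℝ)} (hB' : volume B < ∞) {c : ℝ}
    (hc : ∀ W ∈ B, ‖W‖ ≤ c) :
    strongInt (volume.restrict B) (fun W => (indOp l (G6.mk 1 W)).toContinuousLinearMap) =
      mulOp volume fun k => hat B (coad k l) := by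
  have : IsFiniteMeasure (volume.restrict B) := ⟨by simpa using hB'⟩
  have hc2 : Continuous fun W : ℝ × ℝ × ℝ => G6.mk 1 W :=
    Continuous.prodMk (X := G0) (Y := ℝ × ℝ × ℝ) continuous_const continuous_id
  have h2 : StronglyBdd (volume.restrict B)
      fun W => (indOp l (G6.mk 1 W)).toContinuousLinearMap :=
    stronglyBdd_isometry fun ξ => (continuous_indOp l ξ).comp hc2
  ext1 ξ
  refine Lp.ext ?_
  have hm : StronglyMeasurable fun w : (ℝ × ℝ × ℝ) × G0 => chi (coad w.2 l) w.1 * ξ w.2 := by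
    refine StronglyMeasurable.mul (Continuous.stronglyMeasurable ?_)
      ((Lp.stronglyMeasurable ξ).comp_measurable measurable_snd)
    unfold chi pairing coad
    fun_prop
  have h3 := coeFn_strongInt (iE := NormedSpace.complexToReal) h2 ξ
    (Ψ := fun W k => chi (coad k l) W * ξ k) (ν := volume) hm.aestronglyMeasurable
    (.of_forall fun W => by
      filter_upwards [coeFn_indOp l (G6.mk 1 W) ξ] with k hk
      refine hk.trans ?_
      have e1 : ((G6.mk 1 W)⁻¹ * G6.mk k 0).fib = -adInv k W := by simp [adInv_neg]
      have e2 : ((G6.mk 1 W)⁻¹ * G6.mk k 0).base = k := by simp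
      have e3 : (chi l (-adInv k W))⁻¹ = chi l (adInv k W) := by
        rw [inv_eq_iff_eq_inv, ← mul_eq_one_iff_eq_inv₀ (chi_ne_zero _ _), ← chi_add]
        simp
      rw [equivariantExt, e1, e2, e3, chi_adInv])
  filter_upwards [h3, coeFn_mulOp (bddMeas_hat_coad hB' hc l) ξ] with k k1 k2
  rw [k1, k2, integral_mul_const]
  rfl

/-- The translation part is the same for all l, so that representations with different l can be
compared through their symbols. -/
lemma sigma_universalRep_indicator (l : ℝ × ℝ × ℝ) {A : Set G0} {B : Set (ℝ × ℝ × ℝ)}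
    (hA : MeasurableSet A) (hB : MeasurableSet B) (hA' : volume A < ∞) (hB' : volume B < ∞) {c : ℝ}
    (hc : ∀ W ∈ B, ‖W‖ ≤ c) (hAB : volume (prodSet A B) ≠ ∞) :
    sigma l (universalRep (indicatorConstLp 1 (measurableSet_prodSet hA hB) hAB (1 : ℂ))) =
      transInt A ∘L mulOp volume fun k => hat B (coad k l) := by
  refine ((indRep l).integrated_indicator hA hB hA' hB' hAB).trans ?_
  rw [← strongInt_indOp l hB' hc, transInt]
  simp only [← indOp_mk_zero l]
  rfl

/-! ### Almost orthogonal sums of operators -/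

section AlmostOrthogonal
variable {ι γ H : Type*} [NormedAddCommGroup H] [InnerProductSpace ℂ H]

/-- Bessel's inequality when w i is an orthogonal projection of ξ: Cauchy-Schwarz bounds ‖Σ w‖² = ⟨Σ
w, ξ⟩ by ‖Σ w‖ ‖ξ‖. -/
lemma sum_norm_sq_le_of_orthogonal {w : ι → H}
    (ho : Pairwise fun i j => inner ℂ (w i) (w j) = 0) {ξ : H}
    (hw : ∀ i, inner ℂ (w i) ξ = ((‖w i‖ ^ 2 : ℝ) : ℂ)) (s : Finset ι) :
    ∑ i ∈ s, ‖w i‖ ^ 2 ≤ ‖ξ‖ ^ 2 := by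
  have h1 : inner ℂ (∑ i ∈ s, w i) ξ = ((∑ i ∈ s, ‖w i‖ ^ 2 : ℝ) : ℂ) := by
    rw [sum_inner, Complex.ofReal_sum]
    exact Finset.sum_congr rfl fun i _ => hw i
  have h2 := norm_inner_le_norm (𝕜 := ℂ) (∑ i ∈ s, w i) ξ
  rw [h1, Complex.norm_real, ← norm_sq_sum_of_orthogonal ho, Real.norm_of_nonneg (by positivity),
    sq] at h2
  rw [← norm_sq_sum_of_orthogonal ho]
  refine pow_le_pow_left₀ (norm_nonneg _) ?_ 2
  rcases (norm_nonneg (∑ i ∈ s, w i)).eq_or_lt with h | h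
  · rw [← h]
    exact norm_nonneg _
  · exact le_of_mul_le_mul_left h2 h

/-- Within one colour the vectors V i ξ are orthogonal and their squared norms sum to at most
(C‖ξ‖)², by the Bessel inequality for M. Adding the finitely many colours costs a factor equal to
their number. -/
theorem exists_hasSum_of_colouring [CompleteSpace H] [Fintype γ] (col : ι → γ) {V M : ι → H →L[ℂ] H}
    {C : ℝ} (hC : 0 ≤ C) (hV : ∀ i ξ, ‖V i ξ‖ ≤ C * ‖M i ξ‖)
    (hM : ∀ (ξ : H) (s : Finset ι), ∑ i ∈ s, ‖M i ξ‖ ^ 2 ≤ ‖ξ‖ ^ 2)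
    (ho : ∀ ξ i j, i ≠ j → col i = col j → inner ℂ (V i ξ) (V j ξ) = 0) :
    ∃ T : H →L[ℂ] H, (∀ ξ, HasSum (fun i => V i ξ) (T ξ)) ∧ ‖T‖ ≤ Fintype.card γ * C := by
  classical
  have key (ξ : H) : ∃ v, HasSum (fun i => V i ξ) v ∧ ‖v‖ ≤ Fintype.card γ * C * ‖ξ‖ := by
    -- Each colour class is extended by zero to the whole index set, so that the classes add up over
    -- the same indices.
    set w : γ → ι → H := fun c i => if col i = c then V i ξ else 0 with hw
    have hsw (c : γ) : Pairwise fun i j => inner ℂ (w c i) (w c j) = 0 := by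
      intro i j hij
      by_cases hi : col i = c
      · by_cases hj : col j = c
        · simp only [hw, hi, hj, if_true]
          exact ho ξ i j hij (hi.trans hj.symm)
        · simp [hw, hj]
      · simp [hw, hi]
    have hle (c : γ) (s : Finset ι) : ∑ i ∈ s, ‖w c i‖ ^ 2 ≤ (C * ‖ξ‖) ^ 2 := by
      calc ∑ i ∈ s, ‖w c i‖ ^ 2 ≤ ∑ i ∈ s, C ^ 2 * ‖M i ξ‖ ^ 2 := by
            refine Finset.sum_le_sum fun i _ => ?_
            rw [← mul_pow]
            refine pow_le_pow_left₀ (norm_nonneg _) ?_ 2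
            by_cases hi : col i = c
            · simpa only [hw, hi, if_true] using hV i ξ
            · simp only [hw, hi, if_false, norm_zero]
              positivity
        _ ≤ (C * ‖ξ‖) ^ 2 := by
            rw [← Finset.mul_sum, mul_pow]
            exact mul_le_mul_of_nonneg_left (hM ξ s) (by positivity)
    have hsum (c : γ) : Summable fun i => ‖w c i‖ ^ 2 :=
      summable_of_sum_le (fun i => by positivity) (hle c)
    refine ⟨∑ c, ∑' i, w c i, ?_, ?_⟩
    · have h := hasSum_sum (s := Finset.univ)
        fun (c : γ) _ => (summable_of_orthogonal (hsw c) (hsum c)).hasSum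
      refine h.congr_fun fun i => ?_
      simp [hw]
    · refine (norm_sum_le _ _).trans ((Finset.sum_le_sum fun c _ =>
        norm_tsum_le_of_orthogonal (hsw c) (hsum c) (B := C * ‖ξ‖) (by positivity)
          ((hsum c).tsum_le_of_sum_le (hle c))).trans (le_of_eq ?_))
      rw [Finset.sum_const, Finset.card_univ, nsmul_eq_mul, mul_assoc]
  choose T hT hTn using key
  refine ⟨LinearMap.mkContinuous
    { toFun := T
      map_add' := fun ξ η => (hT (ξ + η)).unique (by simpa using (hT ξ).add (hT η))
      map_smul' := fun c ξ => (hT (c • ξ)).unique (by simpa using (hT ξ).const_smul c) }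
    (Fintype.card γ * C) hTn, hT, LinearMap.mkContinuous_norm_le _ (by positivity) _⟩

end AlmostOrthogonal

/-! ### The boxes -/

lemma mulInd_eq_mulOp {S : Set G0} (hS : MeasurableSet S) :
    mulInd S hS = mulOp volume (S.indicator 1) := by
  ext1 ξ
  refine Lp.ext ?_
  filter_upwards [(memLp_indicator hS ξ).coeFn_toLp, coeFn_mulOp (BddMeas.one.indicator hS) ξ]
    with k h1 h2
  refine h1.trans (Eq.trans ?_ h2.symm)
  by_cases hk : k ∈ S <;> simp [hk]

lemma coeFn_mulInd {S : Set G0} (hS : MeasurableSet S) (ξ : L2G0) :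
    mulInd S hS ξ =ᵐ[volume] S.indicator ξ := (memLp_indicator hS ξ).coeFn_toLp

lemma norm_mulInd_le {S : Set G0} (hS : MeasurableSet S) : ‖mulInd S hS‖ ≤ 1 :=
  LinearMap.mkContinuous_norm_le _ zero_le_one _

lemma inner_mulInd_of_disjoint {S S' : Set G0} (hS : MeasurableSet S) (hS' : MeasurableSet S')
    (h : Disjoint S S') (ξ η : L2G0) : inner ℂ (mulInd S hS ξ) (mulInd S' hS' η) = 0 := by
  rw [L2.inner_def]
  refine integral_eq_zero_of_ae ?_
  filter_upwards [coeFn_mulInd hS ξ, coeFn_mulInd hS' η] with k h1 h2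
  rw [h1, h2]
  by_cases hk : k ∈ S
  · simp [disjoint_left.1 h hk]
  · simp [hk]

lemma inner_mulInd_self {S : Set G0} (hS : MeasurableSet S) (ξ : L2G0) :
    inner ℂ (mulInd S hS ξ) ξ = ((‖mulInd S hS ξ‖ ^ 2 : ℝ) : ℂ) := by
  rw [Complex.ofReal_pow, ← Complex.coe_algebraMap, ← inner_self_eq_norm_sq_to_K (𝕜 := ℂ),
    L2.inner_def, L2.inner_def]
  refine integral_congr_ae ?_
  filter_upwards [coeFn_mulInd hS ξ] with k h1
  rw [h1]
  by_cases hk : k ∈ S <;> simp [hk]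

lemma mem_cell_iff {c : ℝ} (hc : 0 < c) {l : ℤ} {t : ℝ} : t ∈ cell c l ↔ ⌊t / c⌋ = l := by
  rw [cell, mem_Ico, Int.floor_eq_iff, le_div_iff₀ hc, div_lt_iff₀ hc, add_mul, one_mul,
    mul_comm c]

/-- The width of the boxes with the index `k` in the direction of `p`. -/
def pWidth (r δ D : ℝ) (k : ℤ × ℤ × ℤ) : ℝ := D * δ ^ 2 * Real.exp (r * (k.1 - k.2.1))

lemma pWidth_pos {r δ D : ℝ} (hδ : 0 < δ) (hD : 0 < D) (k : ℤ × ℤ × ℤ) : 0 < pWidth r δ D k := by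
  unfold pWidth
  positivity

lemma mem_box_iff {r δ D : ℝ} (hr : 0 < r) (hδ : 0 < δ) (hD : 0 < D) {k : ℤ × ℤ × ℤ} {g : G0} :
    g ∈ box r δ D k ↔ Real.exp (-g.x) ≤ δ ^ 6 ∧ ⌊g.x / r⌋ = k.1 ∧ ⌊g.y / r⌋ = k.2.1 ∧
      ⌊g.p / pWidth r δ D k⌋ = k.2.2 := by
  rw [← mem_cell_iff hr, ← mem_cell_iff hr, ← mem_cell_iff (pWidth_pos hδ hD k)]
  rfl

/-- The factor e^{r(-j₁+j₂)} in the definition cancels the change of k₁ - k₂, so all 27 pieces have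
the p-width of the box k. The enlarged box is a block of 3 × 3 × 3 cells of one grid. -/
lemma mem_bigBox_iff {r δ D : ℝ} (hr : 0 < r) (hδ : 0 < δ) (hD : 0 < D) {k : ℤ × ℤ × ℤ} {g : G0} :
    g ∈ bigBox r δ D k ↔ Real.exp (-g.x) ≤ δ ^ 6 ∧ |⌊g.x / r⌋ - k.1| ≤ 1 ∧
      |⌊g.y / r⌋ - k.2.1| ≤ 1 ∧ |⌊g.p / pWidth r δ D k⌋ - k.2.2| ≤ 1 := by
  have hw (j : ℤ × ℤ × ℤ) :
      pWidth r δ (D * Real.exp (r * (-j.1 + j.2.1))) (k + j) = pWidth r δ D k := by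
    have : Real.exp (r * (k.1 - k.2.1)) = Real.exp (r * (-j.1 + j.2.1)) *
        Real.exp (r * ((k + j).1 - (k + j).2.1 : ℤ)) := by
      rw [← Real.exp_add, Prod.fst_add, Prod.snd_add, Prod.fst_add]
      push_cast
      ring_nf
    unfold pWidth
    rw [this]
    push_cast
    ring
  have hbox (j : ℤ × ℤ × ℤ) := mem_box_iff (D := D * Real.exp (r * (-j.1 + j.2.1))) hr hδ
    (by positivity) (k := k + j) (g := g)
  simp only [hw, Prod.fst_add, Prod.snd_add] at hbox
  simp only [bigBox, mem_iUnion, hbox, nbrs, Finset.mem_product, Finset.mem_Icc, exists_prop,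
    abs_le]
  constructor
  · rintro ⟨j, ⟨⟨h1, h1'⟩, ⟨h2, h2'⟩, ⟨h3, h3'⟩⟩, h4, h5, h6, h7⟩
    refine ⟨h4, ?_⟩
    omega
  · rintro ⟨h, h1, h2, h3⟩
    refine ⟨(⌊g.x / r⌋ - k.1, ⌊g.y / r⌋ - k.2.1, ⌊g.p / pWidth r δ D k⌋ - k.2.2), ⟨h1, h2, h3⟩, h,
      ?_⟩
    dsimp only
    omega

lemma disjoint_box {r δ D : ℝ} (hr : 0 < r) (hδ : 0 < δ) (hD : 0 < D) {k k' : ℤ × ℤ × ℤ}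
    (h : k ≠ k') : Disjoint (box r δ D k) (box r δ D k') := by
  rw [disjoint_left]
  intro g h1 h2
  rw [mem_box_iff hr hδ hD] at h1 h2
  obtain ⟨-, a1, a2, a3⟩ := h1
  obtain ⟨-, b1, b2, b3⟩ := h2
  have e1 : k.1 = k'.1 := a1.symm.trans b1
  have e2 : k.2.1 = k'.2.1 := a2.symm.trans b2
  have hw : pWidth r δ D k = pWidth r δ D k' := by unfold pWidth; rw [e1, e2]
  rw [hw] at a3
  exact h (Prod.ext e1 (Prod.ext e2 (a3.symm.trans b3)))

/-- The residue of an index modulo three. -/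
def residue (k : ℤ × ℤ × ℤ) : ZMod 3 × ZMod 3 × ZMod 3 := (k.1, k.2.1, k.2.2)

/-- If two such blocks met, the corresponding indices would differ by at most 2 and be congruent
modulo 3, hence agree. The third coordinate comes last, because the p-grids agree only once the
first two indices do. -/
lemma disjoint_bigBox {r δ D : ℝ} (hr : 0 < r) (hδ : 0 < δ) (hD : 0 < D) {k k' : ℤ × ℤ × ℤ}
    (h : k ≠ k') (hk : residue k = residue k') : Disjoint (bigBox r δ D k) (bigBox r δ D k') := by
  simp only [residue, Prod.mk.injEq, ZMod.intCast_eq_intCast_iff, Int.ModEq] at hk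
  obtain ⟨c1, c2, c3⟩ := hk
  rw [disjoint_left]
  intro g h1 h2
  rw [mem_bigBox_iff hr hδ hD] at h1 h2
  obtain ⟨-, a1, a2, a3⟩ := h1
  obtain ⟨-, b1, b2, b3⟩ := h2
  rw [abs_le] at a1 a2 a3 b1 b2 b3
  have e1 : k.1 = k'.1 := by omega
  have e2 : k.2.1 = k'.2.1 := by omega
  have hw : pWidth r δ D k = pWidth r δ D k' := by unfold pWidth; rw [e1, e2]
  rw [hw] at a3
  exact h (Prod.ext e1 (Prod.ext e2 (by omega)))

lemma norm_sigma_apply_le (l : ℝ × ℝ × ℝ) (a : OperatorField) : ‖sigma l a‖ ≤ ‖a‖ :=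
  lp.norm_apply_le_norm (by simp) a _

/-- The colouring by residues modulo 3 has 27 classes. That the bound does not depend on δ is
essential for passing to limits in a. -/
theorem exists_boundarySum (ε : ℝ) {r δ D : ℝ} (hr : 0 < r) (hδ : 0 < δ) (hD : 0 < D)
    (a : OperatorField) :
    ∃ T : L2G0 →L[ℂ] L2G0, (∀ ξ, HasSum (fun k => boundaryTerm ε r δ D a k ξ) (T ξ)) ∧
      ‖T‖ ≤ 27 * ‖a‖ := by
  have h := exists_hasSum_of_colouring (H := L2G0) residue (V := boundaryTerm ε r δ D a)
    (M := fun k => mulInd (box r δ D k) (measurableSet_box r δ D k)) (norm_nonneg a)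
    (fun k ξ => ?_) (fun ξ s => ?_) (fun ξ i j hij hc => ?_)
  · simpa [Fintype.card_prod, ZMod.card] using h
  · refine ((ContinuousLinearMap.le_of_opNorm_le _
      (norm_mulInd_le (measurableSet_bigBox r δ D k)) _).trans_eq
      (one_mul _)).trans ?_
    exact ContinuousLinearMap.le_of_opNorm_le _ (norm_sigma_apply_le _ a) _
  · exact sum_norm_sq_le_of_orthogonal
      (fun i j hij => inner_mulInd_of_disjoint _ _ (disjoint_box hr hδ hD hij) ξ ξ)
      (fun i => inner_mulInd_self _ ξ) s
  · exact inner_mulInd_of_disjoint (measurableSet_bigBox r δ D i) (measurableSet_bigBox r δ D j)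
      (disjoint_bigBox hr hδ hD hij hc) _ _

/-- The half space in which the boxes lie. -/
def halfSpace (δ : ℝ) : Set G0 := {g | Real.exp (-g.x) ≤ δ ^ 6}

lemma measurableSet_halfSpace (δ : ℝ) : MeasurableSet (halfSpace δ) :=
  measurableSet_le (f := fun g : G0 => Real.exp (-g.x))
    (Continuous.measurable (by fun_prop)) measurable_const

/-- The index of the box that contains `g`. -/
def boxIndex (r δ D : ℝ) (g : G0) : ℤ × ℤ × ℤ :=
  (⌊g.x / r⌋, ⌊g.y / r⌋, ⌊g.p / pWidth r δ D (⌊g.x / r⌋, ⌊g.y / r⌋, 0)⌋)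

lemma mem_box_iff_boxIndex {r δ D : ℝ} (hr : 0 < r) (hδ : 0 < δ) (hD : 0 < D) {k : ℤ × ℤ × ℤ}
    {g : G0} : g ∈ box r δ D k ↔ g ∈ halfSpace δ ∧ boxIndex r δ D g = k := by
  rw [mem_box_iff hr hδ hD, boxIndex, Prod.ext_iff, Prod.ext_iff]
  refine and_congr_right fun _ => and_congr_right fun h1 => and_congr_right fun h2 => ?_
  have : pWidth r δ D (⌊g.x / r⌋, ⌊g.y / r⌋, 0) = pWidth r δ D k := by
    unfold pWidth
    rw [← h1, ← h2]
  rw [this]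

lemma measurable_boxIndex (r δ D : ℝ) : Measurable (boxIndex r δ D) := by
  have h1 : Measurable fun g : G0 => ⌊g.x / r⌋ :=
    (G0.continuous_x.measurable.div_const r).floor
  have h2 : Measurable fun g : G0 => ⌊g.y / r⌋ :=
    (G0.continuous_y.measurable.div_const r).floor
  refine h1.prodMk (h2.prodMk (Measurable.floor (G0.continuous_p.measurable.div ?_)))
  unfold pWidth
  have h3 : Measurable fun n : ℤ => (n : ℝ) := measurable_from_top
  exact ((((h3.comp h1).sub (h3.comp h2)).const_mul r).exp).const_mul _

lemma mulInd_mulInd_of_subset {S S' : Set G0} (hS : MeasurableSet S) (hS' : MeasurableSet S')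
    (h : S' ⊆ S) (ξ : L2G0) : mulInd S hS (mulInd S' hS' ξ) = mulInd S' hS' ξ := by
  refine Lp.ext ?_
  filter_upwards [coeFn_mulInd hS (mulInd S' hS' ξ), coeFn_mulInd hS' ξ] with k h1 h2
  rw [h1]
  by_cases hk : k ∈ S
  · rw [indicator_of_mem hk]
  · rw [indicator_of_notMem hk, h2, indicator_of_notMem fun hk' => hk (h hk')]

lemma mulInd_mulInd_of_disjoint {S S' : Set G0} (hS : MeasurableSet S) (hS' : MeasurableSet S')
    (h : Disjoint S S') (ξ : L2G0) : mulInd S hS (mulInd S' hS' ξ) = 0 := by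
  refine Lp.ext ?_
  filter_upwards [coeFn_mulInd hS (mulInd S' hS' ξ), coeFn_mulInd hS' ξ,
    Lp.coeFn_zero ℂ 2 (volume : Measure G0)] with k h1 h2 h3
  rw [h1, h3, Pi.zero_apply]
  by_cases hk : k ∈ S
  · rw [indicator_of_mem hk, h2, indicator_of_notMem (disjoint_left.1 h hk)]
  · rw [indicator_of_notMem hk]

/-- The boxes tile the half space. Orthogonality gives convergence in L², and the limit is
identified through its restrictions to the boxes. -/
theorem hasSum_mulInd_box {r δ D : ℝ} (hr : 0 < r) (hδ : 0 < δ) (hD : 0 < D) (ξ : L2G0) :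
    HasSum (fun k => mulInd (box r δ D k) (measurableSet_box r δ D k) ξ)
      (mulInd (halfSpace δ) (measurableSet_halfSpace δ) ξ) := by
  have ho : Pairwise fun i j => inner ℂ (mulInd (box r δ D i) (measurableSet_box r δ D i) ξ)
      (mulInd (box r δ D j) (measurableSet_box r δ D j) ξ) = 0 :=
    fun i j hij => inner_mulInd_of_disjoint _ _ (disjoint_box hr hδ hD hij) ξ ξ
  have hs := (summable_of_orthogonal ho (summable_of_sum_le (fun i => by positivity)
    (sum_norm_sq_le_of_orthogonal ho fun i => inner_mulInd_self _ ξ))).hasSum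
  set v := ∑' k, mulInd (box r δ D k) (measurableSet_box r δ D k) ξ with hv
  have h1 : mulInd (halfSpace δ) (measurableSet_halfSpace δ) v = v := by
    refine HasSum.unique (((mulInd (halfSpace δ) (measurableSet_halfSpace δ)).hasSum hs).congr_fun
      fun k => ?_) hs
    exact (mulInd_mulInd_of_subset _ _ (fun g hg => hg.1) ξ).symm
  have h2 (k : ℤ × ℤ × ℤ) : mulInd (box r δ D k) (measurableSet_box r δ D k) v =
      mulInd (box r δ D k) (measurableSet_box r δ D k) ξ := by
    refine HasSum.unique ((mulInd (box r δ D k) (measurableSet_box r δ D k)).hasSum hs) ?_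
    have := hasSum_single (f := fun j => mulInd (box r δ D k) (measurableSet_box r δ D k)
      (mulInd (box r δ D j) (measurableSet_box r δ D j) ξ)) k fun j hj =>
        mulInd_mulInd_of_disjoint _ _ (disjoint_box hr hδ hD hj.symm) ξ
    rwa [mulInd_mulInd_of_subset _ _ subset_rfl] at this
  convert hs using 1
  rw [← h1]
  symm
  refine Lp.ext ?_
  -- There are countably many boxes, so one null set serves all of them.
  have h3 : ∀ᵐ g : G0, ∀ k, (box r δ D k).indicator v g = (box r δ D k).indicator ξ g := by
    rw [ae_all_iff]
    intro k
    have h4 := coeFn_mulInd (measurableSet_box r δ D k) v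
    rw [h2 k] at h4
    filter_upwards [h4, coeFn_mulInd (measurableSet_box r δ D k) ξ] with g h5 h6
    rw [← h5, h6]
  filter_upwards [h3, coeFn_mulInd (measurableSet_halfSpace δ) v,
    coeFn_mulInd (measurableSet_halfSpace δ) ξ] with g h5 h6 h7
  rw [h6, h7]
  by_cases hg : g ∈ halfSpace δ
  · have hk : g ∈ box r δ D (boxIndex r δ D g) := (mem_box_iff_boxIndex hr hδ hD).2 ⟨hg, rfl⟩
    have := h5 (boxIndex r δ D g)
    rwa [indicator_of_mem hk, indicator_of_mem hk, ← indicator_of_mem hg v,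
      ← indicator_of_mem hg ξ] at this
  · rw [indicator_of_notMem hg, indicator_of_notMem hg]

/-! ### Distance to `C₀(ℝ, 𝒦)` -/

/-- `ρ(T)` has at most the distance `η` from an element of `C₀(ℝ, 𝒦)`. -/
def NearC0K (T : L2G0 →L[ℂ] L2G0) (η : ℝ) : Prop := ∃ c ∈ C0K, ‖rho T - c‖ ≤ η

lemma NearC0K.add {S T : L2G0 →L[ℂ] L2G0} {η η' : ℝ} (hS : NearC0K S η) (hT : NearC0K T η') :
    NearC0K (S + T) (η + η') := by
  obtain ⟨c, hc, h⟩ := hS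
  obtain ⟨c', hc', h'⟩ := hT
  refine ⟨c + c', add_mem_C0K hc hc', ?_⟩
  rw [rho_add, add_sub_add_comm]
  exact (norm_add_le _ _).trans (add_le_add h h')

lemma NearC0K.smul {T : L2G0 →L[ℂ] L2G0} {η : ℝ} (z : ℂ) (hT : NearC0K T η) :
    NearC0K (z • T) (‖z‖ * η) := by
  obtain ⟨c, hc, h⟩ := hT
  refine ⟨z • c, smul_mem_C0K z hc, ?_⟩
  rw [rho_smul, ← smul_sub, norm_smul]
  exact mul_le_mul_of_nonneg_left h (norm_nonneg z)

lemma NearC0K.of_norm_le {T : L2G0 →L[ℂ] L2G0} {η : ℝ} (h : ‖T‖ ≤ η) : NearC0K T η :=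
  ⟨0, zero_mem_C0K, by rw [sub_zero]; exact (norm_rho_le T).trans h⟩

lemma NearC0K.mono {T : L2G0 →L[ℂ] L2G0} {η η' : ℝ} (hT : NearC0K T η) (h : η ≤ η') :
    NearC0K T η' := by
  obtain ⟨c, hc, h1⟩ := hT
  exact ⟨c, hc, h1.trans h⟩

/-! ### Supports of integrated translations -/

/-- The translate of a function supported in S is supported in hS, so a cut-off matters only through
its trace on hS. -/
lemma mulInd_trans_mulInd_congr {S S₁ S₂ : Set G0} (hS : MeasurableSet S) (hS₁ : MeasurableSet S₁)
    (hS₂ : MeasurableSet S₂) {h : G0} (hS₁₂ : ∀ k ∈ S, h * k ∈ S₁ ↔ h * k ∈ S₂) (ξ : L2G0) :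
    mulInd S₁ hS₁ (trans h (mulInd S hS ξ)) = mulInd S₂ hS₂ (trans h (mulInd S hS ξ)) := by
  refine Lp.ext ?_
  filter_upwards [coeFn_mulInd hS₁ (trans h (mulInd S hS ξ)),
    coeFn_mulInd hS₂ (trans h (mulInd S hS ξ)), coeFn_trans h (mulInd S hS ξ),
    (G0.measurePreserving_mul_left h⁻¹).quasiMeasurePreserving.ae (coeFn_mulInd hS ξ)]
    with k h1 h2 h3 h4
  rw [h1, h2]
  by_cases hk : h⁻¹ * k ∈ S
  · have := hS₁₂ _ hk
    rw [mul_inv_cancel_left] at this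
    by_cases hk1 : k ∈ S₁
    · rw [indicator_of_mem hk1, indicator_of_mem (this.1 hk1)]
    · rw [indicator_of_notMem hk1, indicator_of_notMem (mt this.2 hk1)]
  · have h0 : trans h (mulInd S hS ξ) k = 0 := by rw [h3, h4, indicator_of_notMem hk]
    by_cases hk1 : k ∈ S₁ <;> by_cases hk2 : k ∈ S₂ <;> simp [hk1, hk2, h0]

lemma mulInd_transInt_mulInd_congr {A S S₁ S₂ : Set G0} (hA : volume A < ∞)
    (hAm : MeasurableSet A) (hS : MeasurableSet S) (hS₁ : MeasurableSet S₁)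
    (hS₂ : MeasurableSet S₂) (hS₁₂ : ∀ h ∈ A, ∀ k ∈ S, h * k ∈ S₁ ↔ h * k ∈ S₂) (ξ : L2G0) :
    mulInd S₁ hS₁ (transInt A (mulInd S hS ξ)) = mulInd S₂ hS₂ (transInt A (mulInd S hS ξ)) := by
  have hb := stronglyBdd_trans hA
  change (mulInd S₁ hS₁ ∘L transInt A) _ = (mulInd S₂ hS₂ ∘L transInt A) _
  rw [transInt, comp_strongInt hb, comp_strongInt hb, strongInt_apply (hb.comp_left _),
    strongInt_apply (hb.comp_left _)]
  exact setIntegral_congr_fun hAm fun h hh =>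
    mulInd_trans_mulInd_congr hS hS₁ hS₂ (hS₁₂ h hh) ξ

lemma abs_floor_sub_floor_le {s t : ℝ} (h : |s| ≤ 1) : |⌊s + t⌋ - ⌊t⌋| ≤ 1 := by
  rw [abs_le] at h ⊢
  have h1 : ⌊s + t⌋ ≤ ⌊t⌋ + 1 := by
    rw [← Int.floor_add_one]
    exact Int.floor_le_floor (by linarith)
  have h2 : ⌊t⌋ - 1 ≤ ⌊s + t⌋ := by
    rw [← Int.floor_sub_one]
    exact Int.floor_le_floor (by linarith)
  constructor <;> omega

/-- In x and y the shift is at most c ≤ r, one cell. In p it is e^{-g.y} h.p, where e^{-g.y} ≤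
e^{-rk₂}, and the condition e^{-g.x} ≤ δ⁶ makes the width large enough to absorb it. Leaving the
half space is therefore the only way to leave the enlarged box. -/
lemma mul_mem_bigBox_iff {r δ D c : ℝ} (hr : 0 < r) (hδ : 0 < δ) (hD : 0 < D) (hcr : c ≤ r)
    (hcD : c * δ ^ 4 * Real.exp r ≤ D) {h g : G0} (hx : |h.x| ≤ c) (hy : |h.y| ≤ c)
    (hp : |h.p| ≤ c) {k : ℤ × ℤ × ℤ} (hg : g ∈ box r δ D k) :
    h * g ∈ bigBox r δ D k ↔ h * g ∈ halfSpace δ := by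
  rw [mem_bigBox_iff hr hδ hD]
  refine ⟨fun h => h.1, fun h1 => ⟨h1, ?_⟩⟩
  have hg' := (mem_box_iff hr hδ hD).1 hg
  obtain ⟨hX, hgx, hgy, -⟩ := hg
  obtain ⟨-, e1, e2, e3⟩ := hg'
  have hw := pWidth_pos (r := r) hδ hD k
  rw [← e1, ← e2, ← e3, G0.x_mul, G0.y_mul, G0.p_mul, add_div, add_div, add_div]
  have hr' (t : ℝ) (ht : |t| ≤ c) : |t / r| ≤ 1 := by
    rw [abs_div, abs_of_pos hr, div_le_one hr]
    exact ht.trans hcr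
  refine ⟨abs_floor_sub_floor_le (hr' _ hx), abs_floor_sub_floor_le (hr' _ hy),
    abs_floor_sub_floor_le ?_⟩
  rw [abs_div, abs_of_pos hw, div_le_one hw, abs_mul, abs_of_pos (Real.exp_pos _)]
  have h2 : Real.exp (-g.y) ≤ Real.exp (-(r * k.2.1)) := Real.exp_le_exp.2 (by linarith [hgy.1])
  -- The factor e^r is the loss in replacing g.x by the left end of its cell.
  have h3 : Real.exp (-(r * k.1)) ≤ Real.exp r * δ ^ 6 := by
    refine le_trans ?_ (mul_le_mul_of_nonneg_left hX (Real.exp_nonneg r))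
    rw [← Real.exp_add]
    exact Real.exp_le_exp.2 (by linarith [hgx.2])
  have h4 : c ≤ D * δ ^ 2 * Real.exp (r * k.1) := by
    have h5 : Real.exp (r * k.1) * Real.exp (-(r * k.1)) = 1 := by rw [← Real.exp_add]; simp
    have hc0 : 0 ≤ c := (abs_nonneg _).trans hx
    have h6 : c * Real.exp (-(r * k.1)) ≤ D * δ ^ 2 := by
      calc c * Real.exp (-(r * k.1)) ≤ c * (Real.exp r * δ ^ 6) :=
            mul_le_mul_of_nonneg_left h3 hc0
        _ = c * δ ^ 4 * Real.exp r * δ ^ 2 := by ring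
        _ ≤ D * δ ^ 2 := mul_le_mul_of_nonneg_right hcD (by positivity)
    calc c = c * Real.exp (-(r * k.1)) * Real.exp (r * k.1) := by
          rw [mul_assoc, mul_comm (Real.exp (-(r * k.1))), h5, mul_one]
      _ ≤ D * δ ^ 2 * Real.exp (r * k.1) := mul_le_mul_of_nonneg_right h6 (Real.exp_nonneg _)
  calc Real.exp (-g.y) * |h.p| ≤ Real.exp (-(r * k.2.1)) * (D * δ ^ 2 * Real.exp (r * k.1)) :=
        mul_le_mul h2 (hp.trans h4) (abs_nonneg _) (Real.exp_nonneg _)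
    _ = pWidth r δ D k := by
        rw [pWidth, mul_sub, sub_eq_neg_add, Real.exp_add]
        ring

/-! ### The approximating operators of elementary elements -/

/-- The multiple of `Q*` that is used on the box with the index `k`. -/
def boundaryCoeff (ε r δ D : ℝ) (k : ℤ × ℤ × ℤ) : ℝ :=
  -(ε * δ ^ 2 * k.2.2 * D * Real.exp (r * (k.1 - k.2.1)))

/-- The multiple of Q* is -ε times the left end of the p-cell, so the Q*-components differ by at
most e^{-x+y} times the width Dδ²e^{r(k₁-k₂)}. The position of x and y in their cells bounds this by
Dδ²e^r. The R*-component is ±e^{-x}, at most δ⁶ in the half space. -/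
lemma norm_coad_boundaryCoeff_sub_le {ε r δ D : ℝ} (hε : |ε| = 1) (hδ : 0 < δ) (hD : 0 < D)
    {k : ℤ × ℤ × ℤ} {g : G0} (hg : g ∈ box r δ D k) :
    ‖coad g (boundaryCoeff ε r δ D k • Qstar) - coad g (ε • Rstar)‖ ≤
      D * δ ^ 2 * Real.exp r + δ ^ 6 := by
  obtain ⟨hX, hgx, hgy, hgp⟩ := hg
  set w := D * δ ^ 2 * Real.exp (r * (k.1 - k.2.1)) with hw
  have e : coad g (boundaryCoeff ε r δ D k • Qstar) - coad g (ε • Rstar) =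
      (Real.exp (-g.x + g.y) * (ε * (g.p - w * k.2.2)), -(Real.exp (-g.x) * ε), 0) := by
    ext <;> simp [coad, Qstar, Rstar, boundaryCoeff, hw]
    ring
  rw [e, Prod.norm_def, Prod.norm_def]
  simp only [Real.norm_eq_abs, abs_mul, abs_neg, hε, one_mul, mul_one, abs_zero, Real.abs_exp]
  have h0 : 0 < D * δ ^ 2 * Real.exp r := by positivity
  have h0' : 0 < δ ^ 6 := by positivity
  refine max_le ?_ (max_le (by linarith) (by linarith))
  have h1 : |g.p - w * k.2.2| ≤ w := by
    rw [abs_le]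
    constructor <;> linarith [hgp.1, hgp.2]
  have h2 : Real.exp (-g.x + g.y) ≤ Real.exp (-(r * k.1) + (r * k.2.1 + r)) :=
    Real.exp_le_exp.2 (by linarith [hgx.1, hgy.2])
  calc Real.exp (-g.x + g.y) * |g.p - w * k.2.2|
      ≤ Real.exp (-(r * k.1) + (r * k.2.1 + r)) * w :=
        mul_le_mul h2 h1 (abs_nonneg _) (Real.exp_nonneg _)
    _ = D * δ ^ 2 * Real.exp r := by
        rw [hw, mul_left_comm, ← Real.exp_add]
        ring_nf
    _ ≤ _ := by linarith

/-- The symbol of the approximating operator. -/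
def boundarySymbol (B : Set (ℝ × ℝ × ℝ)) (ε r δ D : ℝ) : G0 → ℂ :=
  (halfSpace δ).indicator
    fun g => hat B (coad g (boundaryCoeff ε r δ D (boxIndex r δ D g) • Qstar))

section Elementary
variable {B : Set (ℝ × ℝ × ℝ)} {c : ℝ}

lemma measurable_boundaryCoeff_boxIndex (ε r δ D : ℝ) :
    Measurable fun g : G0 => boundaryCoeff ε r δ D (boxIndex r δ D g) :=
  (measurable_of_countable (boundaryCoeff ε r δ D)).comp (measurable_boxIndex r δ D)

lemma measurable_coad_smul (m : ℝ × ℝ × ℝ) {f : G0 → ℝ} (hf : Measurable f) :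
    Measurable fun g : G0 => coad g (f g • m) := by
  have h1 : Continuous fun w : G0 × ℝ => coad w.1 (w.2 • m) := by
    unfold coad
    fun_prop
  have h2 : Measurable fun g : G0 => (g, f g) := measurable_id'.prodMk hf
  exact h1.measurable.comp h2

lemma measurable_hat_comp (hB : volume B < ∞) (hc : ∀ W ∈ B, ‖W‖ ≤ c) {f : G0 → ℝ × ℝ × ℝ}
    (hf : Measurable f) : Measurable fun g => hat B (f g) :=
  (continuous_hat hB hc).measurable.comp hf

lemma bddMeas_boundarySymbol (hB : volume B < ∞) (hc : ∀ W ∈ B, ‖W‖ ≤ c) (ε r δ D : ℝ) :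
    BddMeas (boundarySymbol B ε r δ D) := by
  have h : BddMeas fun g => hat B (coad g (boundaryCoeff ε r δ D (boxIndex r δ D g) • Qstar)) :=
    ⟨measurable_hat_comp hB hc (measurable_coad_smul _
      (measurable_boundaryCoeff_boxIndex ε r δ D)), volume.real B, fun _ => norm_hat_le hB _⟩
  exact h.indicator (measurableSet_halfSpace δ)

lemma mulOp_mulInd_box {ε r δ D : ℝ} (hr : 0 < r) (hδ : 0 < δ) (hD : 0 < D) (hB : volume B < ∞)
    (hc : ∀ W ∈ B, ‖W‖ ≤ c) (k : ℤ × ℤ × ℤ) (ξ : L2G0) :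
    mulOp volume (fun g => hat B (coad g (boundaryCoeff ε r δ D k • Qstar)))
      (mulInd (box r δ D k) (measurableSet_box r δ D k) ξ) =
    mulInd (box r δ D k) (measurableSet_box r δ D k)
      (mulOp volume (boundarySymbol B ε r δ D) ξ) := by
  refine Lp.ext ?_
  filter_upwards [coeFn_mulOp (bddMeas_hat_coad hB hc (boundaryCoeff ε r δ D k • Qstar))
      (mulInd (box r δ D k) (measurableSet_box r δ D k) ξ),
    coeFn_mulInd (measurableSet_box r δ D k) ξ,
    coeFn_mulInd (measurableSet_box r δ D k) (mulOp volume (boundarySymbol B ε r δ D) ξ),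
    coeFn_mulOp (bddMeas_boundarySymbol hB hc ε r δ D) ξ] with g h1 h2 h3 h4
  rw [h1, h2, h3]
  by_cases hg : g ∈ box r δ D k
  · rw [indicator_of_mem hg, indicator_of_mem hg, h4, boundarySymbol]
    have := (mem_box_iff_boxIndex hr hδ hD).1 hg
    rw [indicator_of_mem this.1, this.2]
  · rw [indicator_of_notMem hg, indicator_of_notMem hg, mul_zero]

variable {A : Set G0}

/-- After restriction to a box, the cut-off by the enlarged box equals the cut-off by the half
space, which no longer depends on k. The common operator can be pulled out of the sum, and the boxes
reassemble the frozen symbol. -/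
theorem boundarySum_indicator {ε r δ D : ℝ} (hr : 0 < r) (hδ : 0 < δ) (hD : 0 < D)
    (hA : MeasurableSet A) (hB : MeasurableSet B) (hA' : volume A < ∞) (hB' : volume B < ∞)
    (hAc : ∀ h ∈ A, |h.x| ≤ c ∧ |h.y| ≤ c ∧ |h.p| ≤ c) (hBc : ∀ W ∈ B, ‖W‖ ≤ c)
    (hAB : volume (prodSet A B) ≠ ∞) (hcr : c ≤ r) (hcD : c * δ ^ 4 * Real.exp r ≤ D)
    {T : L2G0 →L[ℂ] L2G0} (hT : ∀ ξ, HasSum (fun k => boundaryTerm ε r δ D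
      (universalRep (indicatorConstLp 1 (measurableSet_prodSet hA hB) hAB (1 : ℂ))) k ξ) (T ξ)) :
    T = mulInd (halfSpace δ) (measurableSet_halfSpace δ) ∘L transInt A ∘L
      mulOp volume (boundarySymbol B ε r δ D) := by
  ext1 ξ
  refine (hT ξ).unique ?_
  set L := mulInd (halfSpace δ) (measurableSet_halfSpace δ) ∘L transInt A with hL
  have h1 := L.hasSum (hasSum_mulInd_box hr hδ hD (mulOp volume (boundarySymbol B ε r δ D) ξ))
  have h2 : mulInd (halfSpace δ) (measurableSet_halfSpace δ)
      (mulOp volume (boundarySymbol B ε r δ D) ξ) = mulOp volume (boundarySymbol B ε r δ D) ξ := by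
    refine Lp.ext ?_
    filter_upwards [coeFn_mulInd (measurableSet_halfSpace δ)
      (mulOp volume (boundarySymbol B ε r δ D) ξ),
      coeFn_mulOp (bddMeas_boundarySymbol hB' hBc ε r δ D) ξ] with g k1 k2
    rw [k1]
    by_cases hg : g ∈ halfSpace δ
    · rw [indicator_of_mem hg]
    · rw [indicator_of_notMem hg, k2, boundarySymbol, indicator_of_notMem hg, zero_mul]
  rw [h2] at h1
  refine h1.congr_fun fun k => ?_
  rw [hL, ContinuousLinearMap.comp_apply, ← mulInd_transInt_mulInd_congr hA' hA _
    (measurableSet_bigBox r δ D k) _ fun h hh g hg => mul_mem_bigBox_iff hr hδ hD hcr hcD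
      (hAc h hh).1 (hAc h hh).2.1 (hAc h hh).2.2 hg, ← mulOp_mulInd_box hr hδ hD hB' hBc,
    boundaryTerm,
    sigma_universalRep_indicator _ hA hB hA' hB' hBc hAB]
  rfl

lemma norm_boundarySymbol_sub_le {ε r δ D : ℝ} (hε : |ε| = 1) (hr : 0 < r) (hδ : 0 < δ)
    (hD : 0 < D) (hB : volume B < ∞) (hc0 : 0 ≤ c) (hc : ∀ W ∈ B, ‖W‖ ≤ c) (g : G0) :
    ‖(halfSpace δ).indicator (fun g => hat B (coad g (ε • Rstar))) g -
      boundarySymbol B ε r δ D g‖ ≤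
      3 * (D * δ ^ 2 * Real.exp r + δ ^ 6) * c * volume.real B := by
  by_cases hg : g ∈ halfSpace δ
  · rw [boundarySymbol, indicator_of_mem hg, indicator_of_mem hg, norm_sub_rev]
    refine (norm_hat_sub_hat_le hB hc _ _).trans ?_
    have := norm_coad_boundaryCoeff_sub_le hε hδ hD ((mem_box_iff_boxIndex hr hδ hD).2 ⟨hg, rfl⟩)
    gcongr
  · rw [boundarySymbol, indicator_of_notMem hg, indicator_of_notMem hg, sub_zero, norm_zero]
    positivity

/-! ### The symbol at εR* as a function on G₀/exp(ℝY). -/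

/-- The symbol of `σ_{εR*}` in the coordinates `zpol`. -/
def zSymbol (B : Set (ℝ × ℝ × ℝ)) (ε : ℝ) (z : ℝ × ℝ) : ℂ :=
  hat B (-(ε * z.2 * Real.exp (-z.1)), ε * Real.exp (-z.1), 0)

/-- Since ad Y maps 𝔥 into the span of Q and S, exp(ℝY) fixes R*, and the coadjoint translate of εR*
depends only on the coset k exp(ℝY). -/
lemma zSymbol_zpol (B : Set (ℝ × ℝ × ℝ)) (ε : ℝ) (g : G0) :
    zSymbol B ε (zpol g) = hat B (coad g (ε • Rstar)) := by
  rw [zSymbol]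
  congr 1
  ext <;> simp [coad, Rstar, zpol, Real.exp_add] <;> ring

lemma bddMeas_zSymbol (hB : volume B < ∞) (hc : ∀ W ∈ B, ‖W‖ ≤ c) (ε : ℝ) :
    BddMeas (zSymbol B ε) :=
  ⟨((continuous_hat hB hc).comp (by fun_prop)).measurable, _, fun _ => norm_hat_le hB _⟩

/-- By the Riemann-Lebesgue lemma only functionals of norm at most R matter. Then e^{-x} ≤ R bounds
x below, κ ≤ e^{-x} bounds x above, and |p| e^{-x} ≤ R bounds p by R/κ. Without κ the symbol need
not decay as x → +∞. -/
lemma zSymbol_indicator_tendsto (hB : MeasurableSet B) {ε : ℝ} (hε : |ε| = 1) {κ : ℝ} (hκ : 0 < κ)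
    {Z : Set (ℝ × ℝ)} (hZ : ∀ z ∈ Z, κ ≤ Real.exp (-z.1)) {η : ℝ} (hη : 0 < η) :
    ∃ R : ℝ, ∀ z, R < ‖z‖ → ‖Z.indicator (zSymbol B ε) z‖ ≤ η := by
  obtain ⟨R, hR0, hR⟩ := exists_norm_hat_le hB hη
  refine ⟨|Real.log R| + |Real.log κ| + R / κ, fun z hz => ?_⟩
  by_cases hzZ : z ∈ Z
  swap
  · rw [indicator_of_notMem hzZ, norm_zero]
    exact hη.le
  rw [indicator_of_mem hzZ]
  refine hR _ ?_
  by_contra! hle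
  rw [Prod.norm_def, Prod.norm_def] at hle
  simp only [Real.norm_eq_abs, abs_mul, abs_neg, hε, one_mul, Real.abs_exp, max_le_iff] at hle
  obtain ⟨h1, h2, -⟩ := hle
  have h3 := hZ z hzZ
  have h4 : -z.1 ≤ Real.log R := by
    rw [← Real.log_exp (-z.1)]
    exact Real.log_le_log (Real.exp_pos _) h2
  have h5 : Real.log κ ≤ -z.1 := by
    rw [← Real.log_exp (-z.1)]
    exact Real.log_le_log hκ h3
  have h6 : |z.2| ≤ R / κ := by
    rw [le_div_iff₀ hκ]
    exact (mul_le_mul_of_nonneg_left h3 (abs_nonneg _)).trans h1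
  have h7 : 0 ≤ R / κ := by positivity
  refine hz.not_ge ?_
  rw [Prod.norm_def, Real.norm_eq_abs, Real.norm_eq_abs]
  refine max_le ?_ ?_
  · rw [abs_le]
    constructor
    · linarith [le_abs_self (Real.log R), abs_nonneg (Real.log κ)]
    · linarith [neg_abs_le (Real.log κ), abs_nonneg (Real.log R)]
  · linarith [abs_nonneg (Real.log κ), abs_nonneg (Real.log R)]

end Elementary

/-! ### The difference of the two operators modulo C₀(ℝ, 𝒦). -/

section Elementary
variable {B : Set (ℝ × ℝ × ℝ)} {c : ℝ}

lemma mulOp_one {α : Type*} [MeasurableSpace α] {μ : Measure α} (v : Lp ℂ 2 μ) :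
    mulOp μ (fun _ => (1 : ℂ)) v = v := by
  refine Lp.ext ?_
  filter_upwards [coeFn_mulOp (BddMeas.one (α := α)) v] with x hx
  refine hx.trans ?_
  simp

lemma sub_mulInd {S : Set G0} (hS : MeasurableSet S) (ξ : L2G0) :
    ξ - mulInd S hS ξ = mulInd Sᶜ hS.compl ξ := by
  refine Lp.ext ?_
  filter_upwards [Lp.coeFn_sub ξ (mulInd S hS ξ), coeFn_mulInd hS ξ, coeFn_mulInd hS.compl ξ]
    with k h1 h2 h3
  rw [h1, Pi.sub_apply, h2, h3]
  by_cases hk : k ∈ S <;> simp [hk]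

lemma mulInd_empty (ξ : L2G0) : mulInd ∅ MeasurableSet.empty ξ = 0 := by
  refine Lp.ext ?_
  filter_upwards [coeFn_mulInd MeasurableSet.empty ξ, Lp.coeFn_zero ℂ 2 (volume : Measure G0)]
    with k h1 h2
  rw [h1, h2]
  simp

lemma mulInd_mulOp {S : Set G0} (hS : MeasurableSet S) {g : G0 → ℂ} (hg : BddMeas g) (ξ : L2G0) :
    mulInd S hS (mulOp volume g ξ) = mulOp volume (S.indicator g) ξ := by
  rw [mulInd_eq_mulOp, mulOp_mulOp (BddMeas.one.indicator hS) hg]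
  congr 2
  ext k
  by_cases hk : k ∈ S <;> simp [hk]

/-- With s the symbol of εR*, b the frozen one and X the half space, L M_s - M_X L M_b is the sum of
L M_{s 1_{Xᶜ}}, M_{Xᶜ} L M_{s 1_X} and M_X L M_{s 1_X - b}. The first two are near C₀(ℝ, 𝒦), and the
last is small in norm by the Lipschitz estimate. -/
theorem nearC0K_sub_boundarySum {ε r δ D : ℝ} (hε : |ε| = 1) (hr : 0 < r) (hδ : 0 < δ) (hD : 0 < D)
    {A₁ : Set ℝ} {A₂ : Set (ℝ × ℝ)} (hA₁ : MeasurableSet A₁) (hA₂ : MeasurableSet A₂)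
    (hB : MeasurableSet B) (hA₁' : volume A₁ < ∞) (hA₂' : volume A₂ < ∞) (hB' : volume B < ∞)
    (hc0 : 0 ≤ c) (hA₁c : ∀ y ∈ A₁, |y| ≤ c) (hA₂c : ∀ z ∈ A₂, ‖z‖ ≤ c) (hBc : ∀ W ∈ B, ‖W‖ ≤ c)
    (hA : MeasurableSet (yxp ⁻¹' (A₁ ×ˢ A₂)))
    (hAB : volume (prodSet (yxp ⁻¹' (A₁ ×ˢ A₂)) B) ≠ ∞) (hcr : c ≤ r)
    (hcD : c * δ ^ 4 * Real.exp r ≤ D) {T : L2G0 →L[ℂ] L2G0}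
    (hT : ∀ ξ, HasSum (fun k => boundaryTerm ε r δ D
      (universalRep (indicatorConstLp 1 (measurableSet_prodSet hA hB) hAB (1 : ℂ))) k ξ) (T ξ))
    {η : ℝ} (hη : 0 < η) :
    NearC0K (sigma (ε • Rstar)
        (universalRep (indicatorConstLp 1 (measurableSet_prodSet hA hB) hAB (1 : ℂ))) - T)
      (η + volume.real (yxp ⁻¹' (A₁ ×ˢ A₂)) *
        (3 * (D * δ ^ 2 * Real.exp r + δ ^ 6) * c * volume.real B)) := by
  have hA' : volume (yxp ⁻¹' (A₁ ×ˢ A₂)) < ∞ := by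
    rw [volume_yxp_preimage, Measure.volume_eq_prod, Measure.prod_prod]
    exact ENNReal.mul_lt_top hA₁' hA₂'
  have hAc : ∀ h ∈ yxp ⁻¹' (A₁ ×ˢ A₂), |h.x| ≤ c ∧ |h.y| ≤ c ∧ |h.p| ≤ c := by
    intro h hh
    have h2 := hA₂c _ hh.2
    rw [Prod.norm_def] at h2
    exact ⟨(le_max_left _ _).trans h2, hA₁c _ hh.1, (le_max_right _ _).trans h2⟩
  rw [boundarySum_indicator hr hδ hD hA hB hA' hB' hAc hBc hAB hcr hcD hT,
    sigma_universalRep_indicator _ hA hB hA' hB' hBc hAB]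
  set A := yxp ⁻¹' (A₁ ×ˢ A₂) with hAdef
  set Z : Set (ℝ × ℝ) := {z | Real.exp (-z.1) ≤ δ ^ 6} with hZ
  set W : Set (ℝ × ℝ) := {z | Real.exp (-c) * δ ^ 6 ≤ Real.exp (-z.1)} with hW
  have hZm : MeasurableSet Z := measurableSet_le (by fun_prop) measurable_const
  have hWm : MeasurableSet W := measurableSet_le measurable_const (by fun_prop)
  have hκ : 0 < Real.exp (-c) * δ ^ 6 := by positivity
  have hg := bddMeas_zSymbol hB' hBc ε
  have hzm := continuous_zpol.measurable
  have hX := measurableSet_halfSpace δ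
  have hgz : (fun k => hat B (coad k (ε • Rstar))) = fun k => zSymbol B ε (zpol k) :=
    funext fun k => (zSymbol_zpol B ε k).symm
  -- Off the half space e^{-x} > δ⁶, so the same lower bound κ = e^{-c}δ⁶ serves this term and the
  -- next.
  obtain ⟨c₁, hc₁, h₁⟩ := exists_mem_C0K_norm_sub_le hA₁' hA₁ hA₂' hA₂ (hg.indicator hZm.compl)
    (BddMeas.one (α := ℝ × ℝ)) (by simp)
    (fun η hη => zSymbol_indicator_tendsto hB hε hκ (fun z hz => by
      have h1 : Real.exp (-c) ≤ 1 := Real.exp_le_one_iff.2 (by linarith)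
      have h2 : δ ^ 6 < Real.exp (-z.1) := not_le.1 hz
      nlinarith [pow_pos hδ 6]) hη) (half_pos hη)
  obtain ⟨c₂, hc₂, h₂⟩ := exists_mem_C0K_norm_sub_le hA₁' hA₁ hA₂' hA₂
    (hg.indicator (hWm.inter hZm)) ((BddMeas.one (α := ℝ × ℝ)).indicator hZm.compl)
    (fun z => by by_cases hz : z ∈ Zᶜ <;> simp [hz])
    (fun η hη => zSymbol_indicator_tendsto hB hε hκ (fun z hz => hz.1) hη) (half_pos hη)
  set L := transInt A with hL
  have key : L ∘L mulOp volume (fun k => hat B (coad k (ε • Rstar))) -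
      mulInd (halfSpace δ) (measurableSet_halfSpace δ) ∘L L ∘L
        mulOp volume (boundarySymbol B ε r δ D) =
      (mulOp volume (fun k => (1 : ℝ × ℝ → ℂ) (zpol k)) ∘L L ∘L
        mulOp volume (fun k => Zᶜ.indicator (zSymbol B ε) (zpol k)) +
      mulOp volume (fun k => Zᶜ.indicator (1 : ℝ × ℝ → ℂ) (zpol k)) ∘L L ∘L
        mulOp volume (fun k => (W ∩ Z).indicator (zSymbol B ε) (zpol k))) +
      mulInd (halfSpace δ) (measurableSet_halfSpace δ) ∘L L ∘L
        mulOp volume (fun k => (halfSpace δ).indicator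
          (fun g => hat B (coad g (ε • Rstar))) k - boundarySymbol B ε r δ D k) := by
    ext1 ξ
    set X := halfSpace δ with hXdef
    have hVm : MeasurableSet (zpol ⁻¹' W) := hzm hWm
    set V := zpol ⁻¹' W with hV
    set v := mulOp volume (fun k => zSymbol B ε (zpol k)) ξ with hv
    have hgm : BddMeas fun k => zSymbol B ε (zpol k) := hg.comp hzm
    have e1 : mulOp volume (fun k => Zᶜ.indicator (zSymbol B ε) (zpol k)) ξ =
        mulInd Xᶜ hX.compl v := (mulInd_mulOp hX.compl hgm ξ).symm
    have e2 : mulOp volume (fun k => (W ∩ Z).indicator (zSymbol B ε) (zpol k)) ξ =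
        mulInd V hVm (mulInd X hX v) := by
      rw [hv, mulInd_mulOp hX hgm, mulInd_mulOp hVm (hgm.indicator hX), indicator_indicator]
      rfl
    have e3 : mulOp volume (fun k => X.indicator (fun g => hat B (coad g (ε • Rstar))) k -
        boundarySymbol B ε r δ D k) ξ =
        mulInd X hX v - mulOp volume (boundarySymbol B ε r δ D) ξ := by
      rw [← mulOp_sub ((bddMeas_hat_coad hB' hBc (ε • Rstar)).indicator hX)
        (bddMeas_boundarySymbol hB' hBc ε r δ D), sub_apply, hgz, ← mulInd_mulOp hX hgm]
    have e4 (w : L2G0) : mulOp volume (fun k => Zᶜ.indicator (1 : ℝ × ℝ → ℂ) (zpol k)) w =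
        mulInd Xᶜ hX.compl w := by
      rw [mulInd_eq_mulOp]
      rfl
    -- A translation from A changes x by at most c, so a point with e^{-x} < e^{-c}δ⁶ stays in the
    -- half space. This is why the second term may be cut off to `W`, where its symbol vanishes at
    -- infinity.
    have e5 (w : L2G0) : mulInd Xᶜ hX.compl (L (w - mulInd V hVm w)) = 0 := by
      rw [sub_mulInd, hL, mulInd_transInt_mulInd_congr hA' hA _ _ MeasurableSet.empty, mulInd_empty]
      intro h hh k hk
      refine iff_of_false (fun hk' => hk' ?_) (notMem_empty _)
      have h1 : Real.exp (-k.x) ≤ Real.exp (-c) * δ ^ 6 :=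
        (not_le.1 (show ¬Real.exp (-c) * δ ^ 6 ≤ Real.exp (-k.x) from hk)).le
      have h2 : Real.exp (-h.x) ≤ Real.exp c :=
        Real.exp_le_exp.2 ((neg_le_abs _).trans (hAc h hh).1)
      have h3 : Real.exp c * Real.exp (-c) = 1 := by rw [← Real.exp_add]; simp
      change Real.exp (-(h.x + k.x)) ≤ δ ^ 6
      rw [neg_add, Real.exp_add]
      refine (mul_le_mul h2 h1 (Real.exp_nonneg _) (Real.exp_nonneg _)).trans (le_of_eq ?_)
      rw [← mul_assoc, h3, one_mul]
    have e6 := e5 (mulInd X hX v)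
    rw [map_sub, map_sub, sub_eq_zero] at e6
    have e7 : mulOp volume (fun k => (1 : ℝ × ℝ → ℂ) (zpol k)) (L (mulInd Xᶜ hX.compl v)) =
        L (mulInd Xᶜ hX.compl v) := mulOp_one _
    simp only [sub_apply, add_apply, ContinuousLinearMap.comp_apply]
    rw [e1, e2, e3, e4, e7, ← e6, ← sub_mulInd hX, ← sub_mulInd hX, hgz, map_sub, map_sub, map_sub]
    abel
  rw [key]
  have hn := norm_boundarySymbol_sub_le (r := r) hε hr hδ hD hB' hc0 hBc
  refine (NearC0K.mono (NearC0K.add ⟨c₁, hc₁, h₁⟩ ⟨c₂, hc₂, h₂⟩) (add_halves η).le).add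
    (NearC0K.of_norm_le ?_)
  refine (ContinuousLinearMap.opNorm_comp_le _ _).trans ?_
  refine (mul_le_mul (norm_mulInd_le hX) ((ContinuousLinearMap.opNorm_comp_le _ _).trans
    (mul_le_mul (norm_transInt_le hA') (norm_mulOp_le ?_ ?_ hn) (norm_nonneg _)
      measureReal_nonneg)) (norm_nonneg _) zero_le_one).trans (one_mul _).le
  · exact ((bddMeas_hat_coad hB' hBc (ε • Rstar)).indicator hX).sub
      (bddMeas_boundarySymbol hB' hBc ε r δ D)
  · positivity

end Elementary

/-! ### A density criterion in `L¹` -/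

section Density
variable {α : Type*} {mα : MeasurableSpace α} {μ : Measure α} {K : Submodule ℂ (Lp ℂ 1 μ)}

/-- The indicator function of `s` is an integrable function in `K`. -/
def IndMem (K : Submodule ℂ (Lp ℂ 1 μ)) (s : Set α) : Prop :=
  ∃ (hs : MeasurableSet s) (hs' : μ s ≠ ∞), indicatorConstLp 1 hs hs' (1 : ℂ) ∈ K

lemma IndMem.empty : IndMem K ∅ :=
  ⟨.empty, by simp, by rw [indicatorConstLp_empty]; exact K.zero_mem⟩

lemma IndMem.union {s t : Set α} (hs : IndMem K s) (ht : IndMem K t) (h : Disjoint s t) :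
    IndMem K (s ∪ t) := by
  obtain ⟨h1, h2, h3⟩ := hs
  obtain ⟨h4, h5, h6⟩ := ht
  refine ⟨h1.union h4, (measure_union_lt_top h2.lt_top h5.lt_top).ne, ?_⟩
  rw [indicatorConstLp_disjoint_union h1 h4 h2 h5 h]
  exact K.add_mem h3 h6

lemma IndMem.diff {s t : Set α} (hs : IndMem K s) (ht : IndMem K t) (h : s ⊆ t) :
    IndMem K (t \ s) := by
  obtain ⟨h1, h2, h3⟩ := hs
  obtain ⟨h4, h5, h6⟩ := ht
  have h7 : μ (t \ s) ≠ ∞ := measure_ne_top_of_subset sdiff_subset h5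
  refine ⟨h4.diff h1, h7, ?_⟩
  have h8 := indicatorConstLp_disjoint_union (p := 1) h1 (h4.diff h1) h2 h7 disjoint_sdiff_right
    (1 : ℂ)
  simp only [union_sdiff_cancel h] at h8
  rw [h8] at h6
  exact (K.add_mem_iff_right h3).1 h6

/-- The measures of the differences tend to 0 by continuity from above, so the indicator functions
converge in L¹ to that of the union. Finite measure of the union is indispensable. -/
lemma IndMem.iUnion_of_monotone (hK : IsClosed (K : Set (Lp ℂ 1 μ))) {s : ℕ → Set α}
    (hs : ∀ n, IndMem K (s n)) (hm : Monotone s) (hfin : μ (⋃ n, s n) ≠ ∞) :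
    IndMem K (⋃ n, s n) := by
  choose h1 h2 h3 using hs
  refine ⟨.iUnion h1, hfin, hK.mem_of_tendsto (b := atTop)
    (tendsto_indicatorConstLp_set (ht := h1) (hμt := h2) ENNReal.one_ne_top ?_)
    (.of_forall h3)⟩
  have h4 (n : ℕ) : symmDiff (s n) (⋃ n, s n) = (⋃ n, s n) \ s n := by
    rw [Set.symmDiff_def, sdiff_eq_empty.2 (subset_iUnion s n), empty_union]
  simp only [h4]
  have h5 := tendsto_measure_iInter_atTop (μ := μ) (s := fun n => (⋃ n, s n) \ s n)
    (fun n => ((MeasurableSet.iUnion h1).diff (h1 n)).nullMeasurableSet)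
    (fun m n hmn => sdiff_subset_sdiff_right (hm hmn))
    ⟨0, measure_ne_top_of_subset sdiff_subset hfin⟩
  have h6 : ⋂ n, (⋃ n, s n) \ s n = ∅ := by
    rw [← sdiff_iUnion, sdiff_self]
  rw [h6, measure_empty] at h5
  exact h5

lemma IndMem.iUnion_of_disjoint (hK : IsClosed (K : Set (Lp ℂ 1 μ))) {s : ℕ → Set α}
    (hs : ∀ n, IndMem K (s n)) (hd : Pairwise (Function.onFun Disjoint s))
    (hfin : μ (⋃ n, s n) ≠ ∞) : IndMem K (⋃ n, s n) := by
  have h1 (n : ℕ) : IndMem K (⋃ i ∈ Finset.range n, s i) := by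
    induction n with
    | zero => simpa using IndMem.empty
    | succ n ih =>
      rw [Finset.range_add_one, Finset.set_biUnion_insert]
      refine (hs n).union ih ?_
      rw [disjoint_iUnion₂_right]
      exact fun i hi => hd (Finset.mem_range.1 hi).ne'
  have h2 : ⋃ n, s n = ⋃ n, ⋃ i ∈ Finset.range n, s i := by
    refine subset_antisymm (iUnion_subset fun n => ?_)
      (iUnion_subset fun n => iUnion₂_subset fun i _ => subset_iUnion s i)
    refine subset_trans ?_ (subset_iUnion _ (n + 1))
    exact subset_biUnion_of_mem (u := s) (Finset.self_mem_range_succ n)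
  rw [h2] at hfin ⊢
  exact IndMem.iUnion_of_monotone hK h1
    (fun m n hmn => biUnion_mono (fun i hi => Finset.range_mono hmn hi) fun i _ => subset_rfl) hfin

/-- A closed subspace of `L¹` that contains the indicator functions of the sets of a π-system
intersected with the sets of an exhaustion is the whole space. -/
theorem mem_of_isPiSystem (hK : IsClosed (K : Set (Lp ℂ 1 μ))) {C : Set (Set α)}
    (hgen : mα = MeasurableSpace.generateFrom C) (hC : IsPiSystem C) {E : ℕ → Set α}
    (hE : Monotone E) (hEu : ⋃ n, E n = univ) (hEK : ∀ n, IndMem K (E n))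
    (hCK : ∀ n, ∀ s ∈ C, IndMem K (s ∩ E n)) (F : Lp ℂ 1 μ) : F ∈ K := by
  have h1 (n : ℕ) (s : Set α) (hs : MeasurableSet s) : IndMem K (s ∩ E n) := by
    induction s, hs using MeasurableSpace.induction_on_inter hgen hC with
    | empty => simpa using IndMem.empty
    | basic t ht => exact hCK n t ht
    -- Complements are taken inside E n, which keeps all measures finite in the Dynkin argument.
    | compl t _ ih =>
      have h : tᶜ ∩ E n = E n \ (t ∩ E n) := by
        ext x
        simp only [mem_inter_iff, mem_compl_iff, Set.mem_sdiff]
        tauto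
      rw [h]
      exact ih.diff (hEK n) inter_subset_right
    | iUnion f hd _ ih =>
      rw [iUnion_inter]
      refine IndMem.iUnion_of_disjoint hK ih
        (fun i j hij => (hd hij).mono inter_subset_left inter_subset_left) ?_
      rw [← iUnion_inter]
      exact measure_ne_top_of_subset inter_subset_right (hEK n).2.1
  have h2 (s : Set α) (hs : MeasurableSet s) (hs' : μ s ≠ ∞) : IndMem K s := by
    have h3 : ⋃ n, s ∩ E n = s := by rw [← inter_iUnion, hEu, inter_univ]
    have h4 := IndMem.iUnion_of_monotone hK (fun n => h1 n s hs)
      (fun m n hmn => inter_subset_inter_right s (hE hmn)) (by rwa [h3])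
    rwa [h3] at h4
  refine Lp.induction ENNReal.one_ne_top (fun F => F ∈ K) (fun c s hs hμs => ?_)
    (fun f g _ _ _ hf hg => K.add_mem hf hg) hK F
  have h4 := K.smul_mem c (h2 s hs hμs.ne).2.2
  convert h4 using 1
  rw [Lp.simpleFunc.coe_indicatorConst]
  refine Lp.ext ?_
  filter_upwards [indicatorConstLp_coeFn (p := 1) (hs := hs) (hμs := hμs.ne) (c := c),
    indicatorConstLp_coeFn (p := 1) (hs := hs) (hμs := hμs.ne) (c := (1 : ℂ)),
    Lp.coeFn_smul c (indicatorConstLp 1 hs hμs.ne (1 : ℂ))] with x k1 k2 k3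
  rw [k1, k3, Pi.smul_apply, k2]
  by_cases hx : x ∈ s <;> simp [hx]

end Density

/-! ### Product sets generate the Borel sets of `G` -/

/-- The sets of all `exp(xX) exp(yY) exp(pP) exp(W)` with `y ∈ A₁`, `(x, p) ∈ A₂`, `W ∈ B`. -/
def yxpSet (A₁ : Set ℝ) (A₂ : Set (ℝ × ℝ)) (B : Set (ℝ × ℝ × ℝ)) : Set G6 :=
  prodSet (yxp ⁻¹' (A₁ ×ˢ A₂)) B

/-- The product sets with measurable factors. -/
def yxpSets : Set (Set G6) :=
  {s | ∃ A₁ A₂ B, MeasurableSet A₁ ∧ MeasurableSet A₂ ∧ MeasurableSet B ∧ s = yxpSet A₁ A₂ B}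

lemma yxpSet_inter (A₁ A₁' : Set ℝ) (A₂ A₂' : Set (ℝ × ℝ)) (B B' : Set (ℝ × ℝ × ℝ)) :
    yxpSet A₁ A₂ B ∩ yxpSet A₁' A₂' B' = yxpSet (A₁ ∩ A₁') (A₂ ∩ A₂') (B ∩ B') := by
  ext g
  simp only [yxpSet, prodSet, mem_inter_iff, mem_ofPred_eq, mem_preimage, mem_prod]
  tauto

lemma measurableSet_yxpSet {A₁ : Set ℝ} {A₂ : Set (ℝ × ℝ)} {B : Set (ℝ × ℝ × ℝ)}
    (h1 : MeasurableSet A₁) (h2 : MeasurableSet A₂) (h3 : MeasurableSet B) :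
    MeasurableSet (yxpSet A₁ A₂ B) :=
  measurableSet_prodSet (yxp.continuous.measurable (h1.prod h2)) h3

lemma isPiSystem_yxpSets : IsPiSystem yxpSets := by
  rintro _ ⟨A₁, A₂, B, h1, h2, h3, rfl⟩ _ ⟨A₁', A₂', B', h1', h2', h3', rfl⟩ -
  exact ⟨_, _, _, h1.inter h1', h2.inter h2', h3.inter h3', yxpSet_inter _ _ _ _ _ _⟩

/-- The measurable structure of G is a product structure, and the rectangles in G₀ transported by
`yxp` generate the structure of G₀ and span it countably. -/
lemma generateFrom_yxpSets :
    (inferInstance : MeasurableSpace G6) = MeasurableSpace.generateFrom yxpSets := by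
  refine le_antisymm ?_ (MeasurableSpace.generateFrom_le ?_)
  swap
  · rintro _ ⟨A₁, A₂, B, h1, h2, h3, rfl⟩
    exact measurableSet_yxpSet h1 h2 h3
  set C := (yxp ⁻¹' ·) '' image2 (· ×ˢ ·) {s : Set ℝ | MeasurableSet s}
    {t : Set (ℝ × ℝ) | MeasurableSet t} with hC
  have h1 : MeasurableSpace.generateFrom C = (inferInstance : MeasurableSpace G0) := by
    rw [hC, ← MeasurableSpace.comap_generateFrom, generateFrom_prod]
    exact yxp.measurableEmbedding.comap_eq
  have h2 : IsCountablySpanning C :=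
    ⟨fun _ => univ, fun _ => ⟨univ, ⟨univ, by simp, univ, by simp, univ_prod_univ⟩, rfl⟩,
      iUnion_const _⟩
  have h3 := generateFrom_eq_prod h1 (MeasurableSpace.generateFrom_measurableSet (α := ℝ × ℝ × ℝ))
    h2
    isCountablySpanning_measurableSet
  refine (h3.symm.le).trans (MeasurableSpace.generateFrom_mono ?_)
  rintro _ ⟨_, ⟨_, ⟨A₁, h4, A₂, h5, rfl⟩, rfl⟩, B, h6, rfl⟩
  exact ⟨A₁, A₂, B, h4, h5, h6, rfl⟩

/-- The bounded product sets. -/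
def yxpBall (n : ℕ) : Set G6 :=
  yxpSet (Metric.closedBall 0 n) (Metric.closedBall 0 n) (Metric.closedBall 0 n)

lemma monotone_yxpBall : Monotone yxpBall := by
  intro m n hmn
  have h : (m : ℝ) ≤ n := by exact_mod_cast hmn
  rintro g ⟨⟨h1, h2⟩, h3⟩
  exact ⟨⟨Metric.closedBall_subset_closedBall h h1, Metric.closedBall_subset_closedBall h h2⟩,
    Metric.closedBall_subset_closedBall h h3⟩

lemma iUnion_yxpBall : ⋃ n, yxpBall n = univ := by
  refine eq_univ_of_forall fun g => mem_iUnion.2 ?_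
  obtain ⟨n, hn⟩ := exists_nat_ge (max ‖(yxp g.base).1‖ (max ‖(yxp g.base).2‖ ‖g.fib‖))
  simp only [max_le_iff] at hn
  refine ⟨n, ⟨⟨?_, ?_⟩, ?_⟩⟩
  · simpa using hn.1
  · simpa using hn.2.1
  · simpa using hn.2.2

/-! ### Approximation of all elements of the group C*-algebra -/

namespace UnitaryRep

lemma integrated_add (π : UnitaryRep) (F F' : L1G) :
    π.integrated (F + F') = π.integrated F + π.integrated F' := by
  ext1 ξ
  rw [add_apply, integrated_apply, integrated_apply, integrated_apply,
    ← integral_add (π.integrable_smul F ξ) (π.integrable_smul F' ξ)]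
  refine integral_congr_ae ?_
  filter_upwards [Lp.coeFn_add F F'] with g hg
  rw [hg, Pi.add_apply, add_smul]

lemma integrated_smul (π : UnitaryRep) (z : ℂ) (F : L1G) :
    π.integrated (z • F) = z • π.integrated F := by
  ext1 ξ
  rw [smul_apply, integrated_apply, integrated_apply, ← integral_smul]
  refine integral_congr_ae ?_
  filter_upwards [Lp.coeFn_smul z F] with g hg
  rw [hg, Pi.smul_apply, smul_assoc]

lemma integrated_sub (π : UnitaryRep) (F F' : L1G) :
    π.integrated (F - F') = π.integrated F - π.integrated F' := by
  rw [eq_sub_iff_add_eq, ← integrated_add, sub_add_cancel]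

end UnitaryRep

lemma sigma_universalRep_add (l : ℝ × ℝ × ℝ) (F F' : L1G) :
    sigma l (universalRep (F + F')) = sigma l (universalRep F) + sigma l (universalRep F') :=
  (indRep l).integrated_add F F'

lemma sigma_universalRep_smul (l : ℝ × ℝ × ℝ) (z : ℂ) (F : L1G) :
    sigma l (universalRep (z • F)) = z • sigma l (universalRep F) :=
  (indRep l).integrated_smul z F

lemma norm_universalRep_sub_le (F F' : L1G) :
    ‖universalRep F - universalRep F'‖ ≤ ‖F - F'‖ := by
  refine lp.norm_le_of_forall_le (norm_nonneg _) fun π => ?_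
  refine le_trans (le_of_eq ?_) (π.norm_integrated_le (F - F'))
  rw [π.integrated_sub]
  rfl

section BoundaryTerm
variable (ε r δ D : ℝ) (k : ℤ × ℤ × ℤ) (ξ : L2G0)

lemma boundaryTerm_sub (a b : OperatorField) :
    boundaryTerm ε r δ D (a - b) k ξ = boundaryTerm ε r δ D a k ξ - boundaryTerm ε r δ D b k ξ :=
  map_sub (mulInd (bigBox r δ D k) (measurableSet_bigBox r δ D k)) _ _

lemma boundaryTerm_universalRep_add (F F' : L1G) :
    boundaryTerm ε r δ D (universalRep (F + F')) k ξ =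
      boundaryTerm ε r δ D (universalRep F) k ξ + boundaryTerm ε r δ D (universalRep F') k ξ := by
  simp only [boundaryTerm, sigma_universalRep_add]
  exact map_add (mulInd (bigBox r δ D k) (measurableSet_bigBox r δ D k)) _ _

lemma boundaryTerm_universalRep_smul (z : ℂ) (F : L1G) :
    boundaryTerm ε r δ D (universalRep (z • F)) k ξ =
      z • boundaryTerm ε r δ D (universalRep F) k ξ := by
  simp only [boundaryTerm, sigma_universalRep_smul]
  exact map_smul (mulInd (bigBox r δ D k) (measurableSet_bigBox r δ D k)) z _

end BoundaryTerm

/-! ### Stability of the approximation under linear combinations and limits. -/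

/-- `σ_{εR*}(a)` is approximated by the sums of the boundary terms up to `C₀(ℝ, 𝒦)`. -/
def BoundaryApprox (ε D : ℝ) (r : ℝ → ℝ) (a : OperatorField) : Prop :=
  ∀ η > 0, ∀ᶠ δ in 𝓝[>] (0 : ℝ), ∃ T : L2G0 →L[ℂ] L2G0,
    (∀ ξ, HasSum (fun k => boundaryTerm ε (r δ) δ D a k ξ) (T ξ)) ∧
      NearC0K (sigma (ε • Rstar) a - T) η

section Approx
variable {ε D : ℝ} {r : ℝ → ℝ} {a b : OperatorField}

lemma BoundaryApprox.add {F F' : L1G} (hF : BoundaryApprox ε D r (universalRep F))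
    (hF' : BoundaryApprox ε D r (universalRep F')) :
    BoundaryApprox ε D r (universalRep (F + F')) := by
  intro η hη
  filter_upwards [hF (η / 2) (half_pos hη), hF' (η / 2) (half_pos hη)]
    with δ ⟨S, hS, hS'⟩ ⟨T, hT, hT'⟩
  refine ⟨S + T, fun ξ => ?_, ?_⟩
  · exact ((hS ξ).add (hT ξ)).congr_fun fun k => boundaryTerm_universalRep_add _ _ _ _ _ _ _ _
  · rw [sigma_universalRep_add, add_sub_add_comm]
    exact (hS'.add hT').mono (add_halves η).le

lemma BoundaryApprox.smul (z : ℂ) {F : L1G} (hF : BoundaryApprox ε D r (universalRep F)) :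
    BoundaryApprox ε D r (universalRep (z • F)) := by
  intro η hη
  have h0 : 0 < ‖z‖ + 1 := by positivity
  filter_upwards [hF (η / (‖z‖ + 1)) (by positivity)] with δ ⟨S, hS, hS'⟩
  refine ⟨z • S, fun ξ => ?_, ?_⟩
  · exact ((hS ξ).const_smul z).congr_fun fun k => boundaryTerm_universalRep_smul _ _ _ _ _ _ _ _
  · rw [sigma_universalRep_smul, ← smul_sub]
    refine (hS'.smul z).mono ?_
    rw [mul_div_assoc', div_le_iff₀ h0]
    nlinarith

/-- The error a - b contributes at most ‖a - b‖ through σ and 27‖a - b‖ through its own boundary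
sum, for all δ at once. -/
lemma BoundaryApprox.of_forall_near (hD : 0 < D) (hr : ∀ δ, 0 < δ → 0 < r δ)
    (h : ∀ κ > 0, ∃ b, BoundaryApprox ε D r b ∧ ‖a - b‖ ≤ κ) : BoundaryApprox ε D r a := by
  intro η hη
  -- Since 28 · η/56 = η/2, the error a - b uses half of the allowed distance.
  obtain ⟨b, hb, hab⟩ := h (η / 56) (by positivity)
  filter_upwards [hb (η / 2) (half_pos hη), self_mem_nhdsWithin] with δ ⟨T, hT, hT'⟩ hδ
  obtain ⟨S, hS, hS'⟩ := exists_boundarySum ε (hr δ hδ) hδ hD (a - b)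
  refine ⟨S + T, fun ξ => ?_, ?_⟩
  · exact ((hS ξ).add (hT ξ)).congr_fun fun k => by rw [boundaryTerm_sub, sub_add_cancel]
  · have h : sigma (ε • Rstar) a - (S + T) =
        (sigma (ε • Rstar) (a - b) - S) + (sigma (ε • Rstar) b - T) := by
      have h1 : sigma (ε • Rstar) (a - b) = sigma (ε • Rstar) a - sigma (ε • Rstar) b := rfl
      rw [h1]
      abel
    rw [h]
    have h2 : NearC0K (sigma (ε • Rstar) (a - b) - S) (η / 2) := by
      refine .of_norm_le ((norm_sub_le _ _).trans ?_)
      have := norm_sigma_apply_le (ε • Rstar) (a - b)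
      linarith
    exact (h2.add hT').mono (add_halves η).le

variable (ε D r) in
/-- The space of all integrable functions that are approximated by their boundary terms. -/
def boundaryApproxSubmodule (hD : 0 < D) (hr : ∀ δ, 0 < δ → 0 < r δ) : Submodule ℂ L1G where
  carrier := {F | BoundaryApprox ε D r (universalRep F)}
  add_mem' := BoundaryApprox.add
  zero_mem' := fun η hη => by
    filter_upwards [self_mem_nhdsWithin] with δ hδ
    obtain ⟨S, hS, hS'⟩ := exists_boundarySum ε (hr δ hδ) hδ hD (universalRep 0)
    have h0 : ‖universalRep 0‖ ≤ 0 := by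
      rw [map_zero, norm_zero]
    refine ⟨S, hS, .of_norm_le ((norm_sub_le _ _).trans ?_)⟩
    have := norm_sigma_apply_le (ε • Rstar) (universalRep 0)
    linarith
  smul_mem' := fun z _ hF => hF.smul z

lemma isClosed_boundaryApproxSubmodule (hD : 0 < D) (hr : ∀ δ, 0 < δ → 0 < r δ) :
    IsClosed (boundaryApproxSubmodule ε D r hD hr : Set L1G) := by
  refine isClosed_of_closure_subset fun F hF => BoundaryApprox.of_forall_near hD hr fun κ hκ => ?_
  obtain ⟨F', hF', h⟩ := Metric.mem_closure_iff.1 hF κ hκ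
  rw [dist_eq_norm] at h
  exact ⟨universalRep F', hF', (norm_universalRep_sub_le F F').trans h.le⟩

/-- For δ < 1 and n ≥ 1 one has δⁿ ≤ δ^{1/2}. The powers needed below are n = 4, for the
displacement of the boxes, and n = 2, for the freezing of p. -/
lemma tendsto_exp_mul_pow (hr : Tendsto (fun δ => Real.exp (r δ) * δ ^ (1 / 2 : ℝ)) (𝓝[>] 0) (𝓝 0))
    {n : ℕ} (hn : n ≠ 0) : Tendsto (fun δ => δ ^ n * Real.exp (r δ)) (𝓝[>] 0) (𝓝 0) := by
  refine squeeze_zero' ?_ ?_ hr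
  · filter_upwards [self_mem_nhdsWithin] with δ hδ
    have : 0 < δ := hδ
    positivity
  · filter_upwards [Ioo_mem_nhdsGT (zero_lt_one' ℝ)] with δ hδ
    rw [mul_comm]
    refine mul_le_mul_of_nonneg_left ?_ (Real.exp_nonneg _)
    rw [← Real.rpow_natCast]
    refine Real.rpow_le_rpow_of_exponent_ge hδ.1 hδ.2.le ?_
    have : (1 : ℝ) ≤ n := by exact_mod_cast Nat.one_le_iff_ne_zero.2 hn
    linarith

theorem boundaryApprox_yxpSet (hε : |ε| = 1) (hD : 0 < D) (hr0 : ∀ δ, 0 < δ → 0 < r δ)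
    (hr1 : Tendsto r (𝓝[>] 0) atTop)
    (hr2 : Tendsto (fun δ => Real.exp (r δ) * δ ^ (1 / 2 : ℝ)) (𝓝[>] 0) (𝓝 0))
    {A₁ : Set ℝ} {A₂ : Set (ℝ × ℝ)} {B : Set (ℝ × ℝ × ℝ)} (hA₁ : MeasurableSet A₁)
    (hA₂ : MeasurableSet A₂) (hB : MeasurableSet B) (n : ℕ) :
    IndMem (boundaryApproxSubmodule ε D r hD hr0)
      (yxpSet A₁ A₂ B ∩ yxpBall n) := by
  rw [yxpBall, yxpSet_inter]
  set A₁' := A₁ ∩ Metric.closedBall 0 n with hA₁'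
  set A₂' := A₂ ∩ Metric.closedBall 0 n with hA₂'
  set B' := B ∩ Metric.closedBall 0 n with hB'
  have m1 : MeasurableSet A₁' := hA₁.inter Metric.isClosed_closedBall.measurableSet
  have m2 : MeasurableSet A₂' := hA₂.inter Metric.isClosed_closedBall.measurableSet
  have m3 : MeasurableSet B' := hB.inter Metric.isClosed_closedBall.measurableSet
  have f1 : volume A₁' < ∞ :=
    (measure_mono inter_subset_right).trans_lt (isCompact_closedBall _ _).measure_lt_top
  have f2 : volume A₂' < ∞ :=
    (measure_mono inter_subset_right).trans_lt (isCompact_closedBall _ _).measure_lt_top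
  have f3 : volume B' < ∞ :=
    (measure_mono inter_subset_right).trans_lt (isCompact_closedBall _ _).measure_lt_top
  have hA : MeasurableSet (yxp ⁻¹' (A₁' ×ˢ A₂')) := yxp.continuous.measurable (m1.prod m2)
  have hAB : volume (prodSet (yxp ⁻¹' (A₁' ×ˢ A₂')) B') ≠ ∞ := by
    rw [volume_prodSet, volume_yxp_preimage, Measure.volume_eq_prod, Measure.prod_prod]
    exact (ENNReal.mul_lt_top (ENNReal.mul_lt_top f1 f2) f3).ne
  refine ⟨measurableSet_yxpSet m1 m2 m3, hAB, fun η hη => ?_⟩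
  -- The radius n plays the role of c: `l1` yields the condition that translates stay in adjacent
  -- boxes, and `l4` makes the norm error small.
  have l1 := (tendsto_exp_mul_pow hr2 (n := 4) (by norm_num)).const_mul (n : ℝ)
  have l2 := (tendsto_exp_mul_pow hr2 (n := 2) (by norm_num)).const_mul D
  have l3 : Tendsto (fun δ : ℝ => δ ^ 6) (𝓝[>] 0) (𝓝 0) := by
    refine Tendsto.mono_left ?_ nhdsWithin_le_nhds
    simpa using (continuous_pow 6).tendsto (0 : ℝ)
  have l4 : Tendsto (fun δ : ℝ => volume.real (yxp ⁻¹' (A₁' ×ˢ A₂')) *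
      (3 * (D * δ ^ 2 * Real.exp (r δ) + δ ^ 6) * n * volume.real B')) (𝓝[>] 0) (𝓝 0) := by
    have := ((((l2.add l3).const_mul 3).mul_const (n : ℝ)).mul_const (volume.real B')).const_mul
      (volume.real (yxp ⁻¹' (A₁' ×ˢ A₂')))
    simpa [mul_assoc] using this
  rw [mul_zero] at l1
  filter_upwards [self_mem_nhdsWithin, hr1.eventually_ge_atTop (n : ℝ), l1.eventually_lt_const hD,
    l4.eventually_lt_const (half_pos hη)] with δ hδ h1 h2 h3
  obtain ⟨T, hT, -⟩ := exists_boundarySum ε (hr0 δ hδ) hδ hD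
    (universalRep (indicatorConstLp 1 (measurableSet_prodSet hA m3) hAB (1 : ℂ)))
  refine ⟨T, hT, (nearC0K_sub_boundarySum hε (hr0 δ hδ) hδ hD m1 m2 m3 f1 f2 f3 (Nat.cast_nonneg n)
    (fun y hy => by simpa using hy.2) (fun z hz => by simpa using hz.2)
    (fun W hW => by simpa using hW.2) hA hAB h1 (by rw [mul_assoc]; exact h2.le) hT
    (half_pos hη)).mono ?_⟩
  linarith

theorem boundaryApprox_of_mem_groupCStar (hε : |ε| = 1) (hD : 0 < D) (hr0 : ∀ δ, 0 < δ → 0 < r δ)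
    (hr1 : Tendsto r (𝓝[>] 0) atTop)
    (hr2 : Tendsto (fun δ => Real.exp (r δ) * δ ^ (1 / 2 : ℝ)) (𝓝[>] 0) (𝓝 0))
    (ha : a ∈ groupCStar) : BoundaryApprox ε D r a := by
  -- The exhausting sets are themselves truncated product sets, so one lemma provides both
  -- hypotheses of the density criterion.
  have hball (n : ℕ) : yxpBall n = yxpSet univ univ univ ∩ yxpBall n := by
    rw [yxpBall, yxpSet_inter, univ_inter, univ_inter, univ_inter]
  have hL1 (F : L1G) : F ∈ boundaryApproxSubmodule ε D r hD hr0 := by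
    refine mem_of_isPiSystem (isClosed_boundaryApproxSubmodule hD hr0) generateFrom_yxpSets
      isPiSystem_yxpSets monotone_yxpBall iUnion_yxpBall (fun n => ?_) (fun n s hs => ?_) F
    · rw [hball]
      exact boundaryApprox_yxpSet hε hD hr0 hr1 hr2 .univ .univ .univ n
    · obtain ⟨A₁, A₂, B, h1, h2, h3, rfl⟩ := hs
      exact boundaryApprox_yxpSet hε hD hr0 hr1 hr2 h1 h2 h3 n
  refine BoundaryApprox.of_forall_near hD hr0 fun κ hκ => ?_
  have ha' : a ∈ closure (range universalRep) := ha
  obtain ⟨_, ⟨F, rfl⟩, hF⟩ := Metric.mem_closure_iff.1 ha' κ hκ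
  rw [dist_eq_norm] at hF
  exact ⟨universalRep F, hL1 F, hF.le⟩

end Approx

end N628

end

open N628
theorem mainTheorem8 (ε : ℝ) (hε : ε = 1 ∨ ε = -1) (D : ℝ) (hD : 0 < D) (r : ℝ → ℝ)
    (hr0 : ∀ δ, 0 < δ → 0 < r δ) (hr1 : Tendsto r (𝓝[>] 0) atTop)
    (hr2 : Tendsto (fun δ => Real.exp (r δ) * δ ^ (1 / 2 : ℝ)) (𝓝[>] 0) (𝓝 0))
    (a : OperatorField) (ha : a ∈ groupCStar) :
    ∃ T : ℝ → (L2G0 →L[ℂ] L2G0),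
      (∀ δ, 0 < δ → ∀ ξ : L2G0, HasSum (fun k => boundaryTerm ε (r δ) δ D a k ξ) (T δ ξ)) ∧
      Tendsto (fun δ => Metric.infDist (rho (sigma (ε • Rstar) a - T δ)) C0K)
        (𝓝[>] 0) (𝓝 0) := by
  have hε' : |ε| = 1 := by rcases hε with rfl | rfl <;> simp
  have hex (δ : ℝ) : ∃ T : L2G0 →L[ℂ] L2G0,
      0 < δ → ∀ ξ, HasSum (fun k => boundaryTerm ε (r δ) δ D a k ξ) (T ξ) := by
    by_cases hδ : 0 < δ
    · obtain ⟨T, hT, -⟩ := exists_boundarySum ε (hr0 δ hδ) hδ hD a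
      exact ⟨T, fun _ => hT⟩
    · exact ⟨0, fun h => absurd h hδ⟩
  choose T hT using hex
  refine ⟨T, hT, Metric.tendsto_nhds.2 fun η hη => ?_⟩
  filter_upwards [boundaryApprox_of_mem_groupCStar hε' hD hr0 hr1 hr2 ha (η / 2) (half_pos hη),
    self_mem_nhdsWithin] with δ ⟨S, hS, c, hc, hSc⟩ hδ
  -- Sums are unique, so the operator provided by the approximation is the one chosen for all η
  -- simultaneously.
  have hST : S = T δ := ContinuousLinearMap.ext fun ξ => (hS ξ).unique (hT δ hδ ξ)
  rw [hST, ← dist_eq_norm] at hSc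
  rw [Real.dist_0_eq_abs, abs_of_nonneg Metric.infDist_nonneg]
  exact ((Metric.infDist_le_dist_of_mem hc).trans hSc).trans_lt (half_lt_self hη)
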